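/- **Proposition 3.16.** Let $n\ge 0$, let $\mathbf T_n$ be the set of standard Young tableaux on $\{1,\dots,n\}$ (entries increase along rows and down columns), and let $\mathbf T_n^2\subset\mathbf T_n$ be the set of those with two columns $T=(T_1,T_2)$, where $T_2$ may be empty. The shape ${\rm sh}(T)$ is the partition given by the column lengths, and $\le$ on partitions is the dominance order. Write $w\in\mathbf S_n$ as a word $[w(1),\dots,w(n)]$ and let $T(w)$ be the Robinson–Schensted tableau obtained by inserting the letters $w(n),w(n-1),\dots,w(1)$ successively by columns: a letter $j$ inserted into a column replaces the smallest entry greater than $j$, which is then inserted into the next column, or is put at the bottom if there is no such entry. Consider the following three orders, which on $\mathbf T_n^2$ are one and the same partial order. * Induced Duflo order: for $w,y\in\mathbf S_n$ put $w\le y$ if $w^{-1}(j)<w^{-1}(i)$ implies $y^{-1}(j)<y^{-1}(i)$ for all $i<j$. Put $T\le_D S$ if there is a sequence $T=P_1,\dots,P_k=S$ in $\mathbf T_n$ such that for each $r<k$ there are $w,y$ with $T(w)=P_r$, $T(y)=P_{r+1}$ and $w\le y$. * Chain order: $T\le_C S$ if ${\rm sh}(\pi_{i,j}(T))\le {\rm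 sh}(\pi_{i,j}(S))$ for all $1\le i<j\le n$, where $\pi_{i,j}(T)$ is obtained from $T$ by removing the entries $1,\dots,i-1,j+1,\dots,n$ by jeu de taquin. * Geometric order: let $G=SL_n(\mathbb C)$, let $B\subset G$ be the subgroup of upper triangular matrices, $\mathfrak n$ the space of strictly upper triangular matrices, and $\mathfrak n\cap{}^w\mathfrak n$ the span of the matrix units $X_{i,j}$ with $i<j$ and $w^{-1}(i)<w^{-1}(j)$. Let $\mathcal O_w$ be the nilpotent orbit whose Zariski closure is $\overline{G(\mathfrak n\cap{}^w\mathfrak n)}$ and let $\mathcal V_w=\overline{B(\mathfrak n\cap{}^w\mathfrak n)}\cap\mathcal O_w$, where $G$ acts by conjugation. The variety $\mathcal V_w$ depends only on $T=T(w)$ and is denoted $\mathcal V_T$. Put $T\le_G S$ if $\overline{\mathcal V}_S\subseteq\overline{\mathcal V}_T$. For a partial order $\le$ on $\mathbf T_n^2$, the cover $\mathcal D(T)$ of $T\in\mathbf T_n^2$ is the set of all $S\in\mathbf T_n^2$ with $T<S$ for which there is no $P\in\mathbf T_n^2$ with $T<P<S$. For $x\in T_2$ let $T\langle x\rangle=(T_1\cup\{x\},\,T_2\setminus\{x\})$.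 Put $T_{(n)}=T$, let $z_i$ be the largest entry of $T_{(i)}$, and let $T_{(i-1)}$ be obtained from $T_{(i)}$ by deleting the corner $z_i$ by reverse insertion: if $z_i$ is in the first column it is removed; if it is in the second column it is removed from there and replaces the largest entry smaller than $z_i$ of the first column. For $x\in T_2$ there is a unique $i$ with $2\le i\le n$ and $z_i=z_{i-1}=x$; put $T\{x\}=T_{(i)}$. Let $T\in\mathbf T_n^2$ and let the set of entries of $T_2$ be the union of the connected subsequences $\{a_1,\dots,a_1+k_1\},\dots,\{a_s,\dots,a_s+k_s\}$ with integers $k_j\ge 0$, where $a_i>a_{i-1}+k_{i-1}+1$ for $1<i\le s$. Then, for each of the three orders $\le_D,\le_G,\le_C$, $$\mathcal D(T)=\{\,T\langle a_j+k_j\rangle \;:\; 1\le j\le s,\ \ \pi_{1,a_j+k_j}(T)=T\{a_j+k_j\}\,\}.$$ -/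

import Mathlib

/-! Young tableaux are written as lists of columns, each column a list read from top to bottom. -/

namespace YoungOrder

/-- A standard Young tableau on `1, …, n`, as the list of its (nonempty) columns. -/
@[ext]
structure StdTableau (n : ℕ) where
  cols : List (List ℕ)
  col_ne_nil : ∀ C ∈ cols, C ≠ []
  col_increasing : ∀ C ∈ cols, C.Pairwise (· < ·)
  row_increasing :
    cols.IsChain (fun C D => D.length ≤ C.length ∧ ∀ p ∈ C.zip D, p.1 < p.2)
  entries : cols.flatten.Perm (List.range' 1 n)

/-- Forget empty columns. -/
def dropEmpty (T : List (List ℕ)) : List (List ℕ) :=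
  T.filter (fun C => C ≠ [])

/-! ### Insertion from the left and the tableau of a permutation -/

/-- Insertion of `j` into a column: `j` replaces the smallest entry greater than `j`, which is
returned, or is appended at the bottom if there is no such entry. -/
def colInsert (j : ℕ) : List ℕ → List ℕ × Option ℕ
  | [] => ([j], none)
  | a :: C => if j < a then (j :: C, some a) else (a :: (colInsert j C).1, (colInsert j C).2)

/-- The insertion `j ⇒ T`: the entry bumped from a column is inserted into the next column. -/
def tabInsert (j : ℕ) : List (List ℕ) → List (List ℕ)
  | [] => [[j]]
  | C :: T =>
    match colInsert j C with
    | (C', none) => C' :: T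
    | (C', some a) => C' :: tabInsert a T

/-- The word `[w(1), …, w(n)]` of a permutation of `1, …, n` (`k : Fin n` stands for `k + 1`). -/
def word {n : ℕ} (w : Equiv.Perm (Fin n)) : List ℕ :=
  List.ofFn (fun k => (w k : ℕ) + 1)

/-- The Robinson–Schensted tableau `T(w)`: the letters of the word of `w` are inserted
one by one, starting with the last letter. -/
def rsTableau {n : ℕ} (w : Equiv.Perm (Fin n)) : List (List ℕ) :=
  (word w).foldr tabInsert []

/-- The Young cell of `T`. -/
def cell {n : ℕ} (T : StdTableau n) : Set (Equiv.Perm (Fin n)) :=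
  {w | rsTableau w = T.cols}

/-! ### The order induced by the right weak order -/

/-- The right weak order; `w.symm i` is the place of `i` in the word of `w`. -/
def weakLE {n : ℕ} (w y : Equiv.Perm (Fin n)) : Prop :=
  ∀ i j : Fin n, i < j → w.symm j < w.symm i → y.symm j < y.symm i

/-- The induced Duflo order: chains of tableaux whose consecutive members
have representatives that are comparable in the right weak order. -/
def dufloLE {n : ℕ} (T S : StdTableau n) : Prop :=
  Relation.ReflTransGen
    (fun P Q : StdTableau n => ∃ w ∈ cell P, ∃ y ∈ cell Q, weakLE w y) T S

/-! ### Jeu de taquin and the chain order -/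

/-- The part of a slide that takes place inside one column. The column has a hole;
`C` lists the entries below the hole, and `D` lists the entries of the next column, from the
row of the hole downwards. The hole is filled with the smaller of its neighbours below and to the
right. The result is the list of entries which the column finally has from the row of the
hole downwards, and the number of downward steps made before the hole passed to the next column
(`none` if it never did). -/
def slideCol : List ℕ → List ℕ → List ℕ × Option ℕ
  | [], [] => ([], none)
  | [], d :: _ => ([d], some 0)
  | b :: C, [] => (b :: C, none)
  | b :: C, d :: D =>
    if b < d then (b :: (slideCol C D).1, (slideCol C D).2.map (· + 1))
    else (d :: b :: C, some 0)

/-- Jeu de taquin started by removing the entry in row `r` (counted from `0`) of the first of the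
listed columns. -/
def slide : ℕ → List (List ℕ) → List (List ℕ)
  | _, [] => []
  | r, C :: T =>
    match slideCol (C.drop (r + 1)) ((T.headD []).drop r) with
    | (E, none) => (C.take r ++ E) :: T
    | (E, some k) => (C.take r ++ E) :: slide (r + k) T

/-- Remove `x` from the column that contains it, by jeu de taquin. -/
def jdtAux (x : ℕ) : List (List ℕ) → List (List ℕ)
  | [] => []
  | C :: T => if x ∈ C then slide (C.idxOf x) (C :: T) else C :: jdtAux x T

/-- The tableau obtained from `T` by removing the entry `x` by jeu de taquin. -/
def jdtRemove (T : List (List ℕ)) (x : ℕ) : List (List ℕ) :=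
  dropEmpty (jdtAux x T)

/-- `π_{i,j}(T)`: the entries `n, n-1, …, j+1` and then `1, …, i-1` are removed by jeu de taquin. -/
def proj {n : ℕ} (i j : ℕ) (T : StdTableau n) : List (List ℕ) :=
  ((List.range' (j + 1) (n - j)).reverse ++ List.range' 1 (i - 1)).foldl jdtRemove T.cols

/-- The shape, as the list of column lengths. -/
def shape (T : List (List ℕ)) : List ℕ :=
  T.map List.length

/-- The dominance order `μ ≤ ν` on partitions. -/
def dominanceLE (μ ν : List ℕ) : Prop :=
  ∀ i, (μ.take i).sum ≤ (ν.take i).sum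

/-- The chain order. -/
def chainLE {n : ℕ} (T S : StdTableau n) : Prop :=
  ∀ i j, 1 ≤ i → i < j → j ≤ n → dominanceLE (shape (proj i j T)) (shape (proj i j S))

/-! ### Orbital varieties in `𝔰𝔩ₙ(ℂ)` and the geometric order -/

/-- Zariski closure in the space of complex `n × n` matrices. -/
def zariskiClosure {n : ℕ} (A : Set (Matrix (Fin n) (Fin n) ℂ)) :
    Set (Matrix (Fin n) (Fin n) ℂ) :=
  {X | ∀ p : MvPolynomial (Fin n × Fin n) ℂ,
    (∀ Y ∈ A, MvPolynomial.eval (fun ij => Y ij.1 ij.2) p = 0) →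
      MvPolynomial.eval (fun ij => X ij.1 ij.2) p = 0}

/-- The union of the conjugates of `A` by the elements of a set `H` in `SLₙ(ℂ)`. -/
def conjugates {n : ℕ} (H : Set (Matrix.SpecialLinearGroup (Fin n) ℂ))
    (A : Set (Matrix (Fin n) (Fin n) ℂ)) : Set (Matrix (Fin n) (Fin n) ℂ) :=
  {Y | ∃ g ∈ H, ∃ X ∈ A,
    Y = (g : Matrix (Fin n) (Fin n) ℂ) * X *
      ((g⁻¹ : Matrix.SpecialLinearGroup (Fin n) ℂ) : Matrix (Fin n) (Fin n) ℂ)}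

/-- The Borel subgroup of upper triangular matrices in `SLₙ(ℂ)`. -/
def borel (n : ℕ) : Set (Matrix.SpecialLinearGroup (Fin n) ℂ) :=
  {g | ∀ i j : Fin n, j < i → (g : Matrix (Fin n) (Fin n) ℂ) i j = 0}

/-- The space `𝔫 ∩ ʷ𝔫`, where `𝔫` is the algebra of strictly upper triangular matrices: it is
spanned by the matrix units at `(i, j)` with `i < j` and `w⁻¹(i) < w⁻¹(j)`. -/
def nilIntersection {n : ℕ} (w : Equiv.Perm (Fin n)) : Set (Matrix (Fin n) (Fin n) ℂ) :=
  {X | ∀ i j : Fin n, X i j ≠ 0 → i < j ∧ w.symm i < w.symm j}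

/-- The nilpotent orbit `𝒪_w`, the one whose closure is the closure of `G(𝔫 ∩ ʷ𝔫)`. -/
def nilOrbit {n : ℕ} (w : Equiv.Perm (Fin n)) : Set (Matrix (Fin n) (Fin n) ℂ) :=
  {X | zariskiClosure (conjugates Set.univ {X}) =
    zariskiClosure (conjugates Set.univ (nilIntersection w))}

/-- Steinberg's orbital variety `𝒱_w`, the intersection of `𝒪_w` with the closure of
`B(𝔫 ∩ ʷ𝔫)`. -/
def orbitalVariety {n : ℕ} (w : Equiv.Perm (Fin n)) : Set (Matrix (Fin n) (Fin n) ℂ) :=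
  zariskiClosure (conjugates (borel n) (nilIntersection w)) ∩ nilOrbit w

/-- The geometric order: `T ≤ S` if the closure of `𝒱_S` lies in the closure of `𝒱_T`. Here `𝒱_T`
is `𝒱_w` for a permutation `w` in the cell of `T`; it does not depend on the choice of `w`. -/
def geometricLE {n : ℕ} (T S : StdTableau n) : Prop :=
  ∃ w ∈ cell T, ∃ y ∈ cell S,
    zariskiClosure (orbitalVariety y) ⊆ zariskiClosure (orbitalVariety w)

/-! ### Covers -/

/-- The cover of `t` in the subset `A` for the partial order `le`: the elements `s > t` of `A` with
no element of `A` strictly between `t` and `s`. -/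
def cover {α : Type*} (le : α → α → Prop) (A : Set α) (t : α) : Set α :=
  {s | s ∈ A ∧ (le t s ∧ t ≠ s) ∧ ¬ ∃ p ∈ A, (le t p ∧ t ≠ p) ∧ (le p s ∧ p ≠ s)}

/-- The tableaux with two columns, the second of which may be empty. -/
def twoColumn (n : ℕ) : Set (StdTableau n) :=
  {T | T.cols.length ≤ 2}

/-! ### The tableaux `T⟨x⟩` and `T{x}` -/

/-- The first column of `T`. -/
def col₁ {n : ℕ} (T : StdTableau n) : List ℕ := T.cols.getD 0 []

/-- The second column of `T` (empty if there is none). -/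
def col₂ {n : ℕ} (T : StdTableau n) : List ℕ := T.cols.getD 1 []

/-- `T⟨x⟩`: the entry `x` of the second column is moved into the first column. -/
def moveToFirst {n : ℕ} (T : StdTableau n) (x : ℕ) : List (List ℕ) :=
  dropEmpty [(col₁ T).orderedInsert (· ≤ ·) x, (col₂ T).erase x]

/-- Pushing `j` into a column `C` from the right: `j` replaces the greatest entry of `C` smaller
than `j`, and that entry is returned. (As `C` is increasing, the entries smaller than `j` are the
first ones.) -/
def colPush (j : ℕ) (C : List ℕ) : List ℕ × ℕ :=
  (C.set ((C.filter (· < j)).length - 1) j, C.getD ((C.filter (· < j)).length - 1) 0)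

/-- Deletion of the corner entry `z`: it is removed from its column and pushed left through the
preceding columns. The second component is the entry pushed out of the first column. -/
def deleteAux (z : ℕ) : List (List ℕ) → List (List ℕ) × ℕ
  | [] => ([], z)
  | C :: T =>
    if z ∈ C then (C.erase z :: T, z)
    else ((colPush (deleteAux z T).2 C).1 :: (deleteAux z T).1, (colPush (deleteAux z T).2 C).2)

/-- The largest entry. -/
def maxEntry (T : List (List ℕ)) : ℕ :=
  T.flatten.foldr max 0

/-- `T ⇐ z`, where `z` is the largest entry of `T`. -/
def deleteMax (T : List (List ℕ)) : List (List ℕ) :=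
  dropEmpty (deleteAux (maxEntry T) T).1

/-- `T_(i)`: here `T_(n) = T` and `T_(i-1) = T_(i) ⇐ z_i`, with `z_i` the largest entry of
`T_(i)`. -/
def stage {n : ℕ} (T : StdTableau n) (i : ℕ) : List (List ℕ) :=
  deleteMax^[n - i] T.cols

/-- `T{x}` for an entry `x` of the second column: this is `T_(i)` for the unique `i` with
`2 ≤ i ≤ n` and `z_i = z_{i-1} = x`. -/
def brace {n : ℕ} (T : StdTableau n) (x : ℕ) : List (List ℕ) :=
  match (List.range' 2 (n - 1)).find?
    (fun i => maxEntry (stage T i) = x ∧ maxEntry (stage T (i - 1)) = x) with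
  | some i => stage T i
  | none => []

end YoungOrder

/-! A tableau with at most two columns is a nonnegative lattice path: the step at an entry goes up
for the first column and down for the second, and `h k` is the height before step `k`. Matching each
down step with the up step that it cancels gives arcs, and the arcs determine the path. The heart of
the proof is `order_iff`: on two-column tableaux each of the three orders is reverse inclusion of
arc sets.

For the chain order, removing the largest entries by jeu de taquin truncates the path, and removing
the smallest entry deletes only the arc that starts there (`jdtRemove_min`). Hence the second column
of π_{i,j}(T) has as many entries as there are arcs inside [i,j]. Inequalities between these counts
for all intervals force inclusion of arcs, by induction on the length of an arc
(`arc_of_card_arcEnds_le`).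

The other two orders are handled by the circle Duflo, geometric, arcs, Duflo. Weak order shrinks the
space 𝔫 ∩ ʷ𝔫, while Knuth moves do not change the closure of its Borel conjugates
(`KnuthStep.borelClosure_eq`). So a Duflo relation gives an inclusion of closures, even when its
chain passes through tableaux with more columns. For two columns, Gaussian elimination by upper
triangular conjugation (`partialPattern_subset`) shows that this closure is generated by matrices
supported exactly at the arcs. Ranks of south-west corners are invariant under the Borel subgroup,
bounded on closures, and count arcs in intervals, so inclusion of closures again gives inclusion of
arcs. Finally, if the arcs of S lie among those of T and S ≠ T, some arc of T missing in S is outer: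
the path never again goes below the height where the arc ends (`IsPath.exists_outer`). Turning its
down step x upwards deletes just this arc, yields T⟨x⟩, and is one Duflo step.

Covers are therefore the deletions of single outer arcs. Outer entries are ends of runs, and
`proj_eq_brace_iff` identifies outerness with the equality π_{1,x}(T) = T{x}: reverse insertion
keeps track of the minimum of the path beyond x. -/

namespace YoungOrder

/-! ### Lattice paths and their arcs -/

/-- `a` and `b` are matched in the height function `h`: the step at `a` goes up and the step at `b`
is the first one that comes back to the height before `a`. -/
def Arc (h : ℕ → ℤ) (a b : ℕ) : Prop :=
  a < b ∧ h (b + 1) = h a ∧ ∀ k, a < k → k ≤ b → h a < h k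

/-- A nonnegative path with steps `±1` at `1, …, n`. -/
structure IsPath (n : ℕ) (h : ℕ → ℤ) : Prop where
  zero : h 0 = 0
  nonneg : ∀ k, 0 ≤ h k
  step : ∀ k, 1 ≤ k → k ≤ n → h (k + 1) = h k + 1 ∨ h (k + 1) = h k - 1
  flat : ∀ k, k = 0 ∨ n < k → h (k + 1) = h k

variable {n : ℕ} {h g : ℕ → ℤ} {a b : ℕ}

theorem IsPath.step_le (hh : IsPath n h) (k : ℕ) : h (k + 1) ≤ h k + 1 ∧ h k ≤ h (k + 1) + 1 := by
  by_cases hk : 1 ≤ k ∧ k ≤ n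
  · rcases hh.step k hk.1 hk.2 with h1 | h1 <;> omega
  · have := hh.flat k (by omega)
    omega

theorem IsPath.mem_of_ne (hh : IsPath n h) {k : ℕ} (hk : h (k + 1) ≠ h k) : 1 ≤ k ∧ k ≤ n := by
  by_contra hc
  exact hk (hh.flat k (by omega))

theorem Arc.up (H : Arc h a b) : h a < h (a + 1) := H.2.2 _ (by omega) H.1

theorem Arc.down (H : Arc h a b) : h (b + 1) < h b := by
  have := H.2.2 b H.1 le_rfl
  have := H.2.1
  omega

theorem Arc.right_unique {c : ℕ} (H : Arc h a b) (H' : Arc h a c) : b = c := by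
  by_contra hne
  rcases lt_or_gt_of_ne hne with hlt | hlt
  · have := H'.2.2 (b + 1) (by have := H.1; omega) hlt
    have := H.2.1
    omega
  · have := H.2.2 (c + 1) (by have := H'.1; omega) hlt
    have := H'.2.1
    omega

theorem Arc.left_unique {c : ℕ} (H : Arc h a b) (H' : Arc h c b) : a = c := by
  by_contra hne
  have h1 := H.2.1
  have h2 := H'.2.1
  rcases lt_or_gt_of_ne hne with hlt | hlt
  · have := H.2.2 c hlt (by have := H'.1; omega)
    omega
  · have := H'.2.2 a hlt (by have := H.1; omega)
    omega

/-- A down step that ends at a height reached before is matched. -/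
theorem exists_arc_left (hs : ∀ k, h (k + 1) ≤ h k + 1) {i : ℕ} (hb : h (b + 1) < h b)
    (hi : i ≤ b) (hib : h i ≤ h (b + 1)) : ∃ a, i ≤ a ∧ Arc h a b := by
  -- Counting backwards from `b`, the least `d` gives the last position up to `b` whose height is at
  -- most the height after `b`.
  have hex : ∃ d, d ≤ b ∧ h (b - d) ≤ h (b + 1) := ⟨b - i, by omega, by
    rwa [show b - (b - i) = i by omega]⟩
  classical
  obtain ⟨d, ⟨hd1, hd2⟩, hmin⟩ : ∃ d, (d ≤ b ∧ h (b - d) ≤ h (b + 1)) ∧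
      ∀ m, m < d → ¬ (m ≤ b ∧ h (b - m) ≤ h (b + 1)) :=
    ⟨Nat.find hex, Nat.find_spec hex, fun m hm => Nat.find_min hex hm⟩
  have hgt : ∀ k, b - d < k → k ≤ b → h (b + 1) < h k := by
    intro k hk hkb
    have := hmin (b - k) (by omega)
    rw [show b - (b - k) = k by omega] at this
    by_contra hc
    exact this ⟨by omega, by omega⟩
  have hlt : b - d < b := by
    by_contra hc
    rw [show b - d = b by omega] at hd2
    omega
  have h1 := hgt (b - d + 1) (by omega) (by omega)
  have h2 := hs (b - d)
  have heq : h (b + 1) = h (b - d) := by omega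
  refine ⟨b - d, ?_, hlt, heq, fun k hk hkb => heq ▸ hgt k hk hkb⟩
  by_contra hc
  have := hgt i (by omega) hi
  omega

/-- An up step whose starting height is reached again is matched. -/
theorem exists_arc_right (hs : ∀ k, h k ≤ h (k + 1) + 1) {j : ℕ} (ha : h a < h (a + 1))
    (hj : a < j) (haj : h j ≤ h a) : ∃ b, b < j ∧ Arc h a b := by
  have hex : ∃ d, a < d ∧ h d ≤ h a := ⟨j, hj, haj⟩
  classical
  obtain ⟨d, ⟨hd1, hd2⟩, hmin⟩ : ∃ d, (a < d ∧ h d ≤ h a) ∧ ∀ m, m < d → ¬ (a < m ∧ h m ≤ h a) :=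
    ⟨Nat.find hex, Nat.find_spec hex, fun m hm => Nat.find_min hex hm⟩
  have hgt : ∀ k, a < k → k < d → h a < h k := by
    intro k hk hkd
    by_contra hc
    exact hmin k hkd ⟨hk, by omega⟩
  have hd : a + 1 < d := by
    by_contra hc
    rw [show d = a + 1 by omega] at hd2
    omega
  have h1 := hgt (d - 1) (by omega) (by omega)
  have h2 := hs (d - 1)
  rw [show d - 1 + 1 = d by omega] at h2
  refine ⟨d - 1, ?_, by omega, ?_, fun k hk hkd => hgt k hk (by omega)⟩
  · by_contra hc
    have := hgt j hj (by omega)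
    omega
  · rw [show d - 1 + 1 = d by omega]
    omega

theorem IsPath.arc_mem (hh : IsPath n h) (H : Arc h a b) : 1 ≤ a ∧ b ≤ n :=
  ⟨(hh.mem_of_ne (by have := H.up; omega)).1, (hh.mem_of_ne (by have := H.down; omega)).2⟩

theorem IsPath.exists_arc (hh : IsPath n h) (hb : h (b + 1) < h b) : ∃ a, Arc h a b := by
  obtain ⟨a, -, ha⟩ := exists_arc_left (i := 0) (fun k => (hh.step_le k).1) hb (by omega)
    (by rw [hh.zero]; exact hh.nonneg _)
  exact ⟨a, ha⟩

/-- The points under an arc are matched under this arc. -/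
theorem IsPath.inner (hh : IsPath n h) (H : Arc h a b) {c : ℕ} (h1 : a < c) (h2 : c < b) :
    (∃ d, d < b ∧ Arc h c d) ∨ ∃ d, a < d ∧ Arc h d c := by
  have hm := hh.arc_mem H
  have h3 := H.2.2 c h1 h2.le
  have h4 := H.2.1
  rcases hh.step c (by omega) (by omega) with hc | hc
  · left
    obtain ⟨d, hd, hcd⟩ := exists_arc_right (j := b + 1) (fun k => (hh.step_le k).2)
      (by omega : h c < h (c + 1)) (by omega) (by omega)
    refine ⟨d, ?_, hcd⟩
    by_contra hdb
    have : d = b := by omega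
    subst this
    have := H.left_unique hcd
    omega
  · right
    have h5 := H.2.2 (c + 1) (by omega) h2
    obtain ⟨d, hd, hcd⟩ := exists_arc_left (i := a) (fun k => (hh.step_le k).1)
      (by omega : h (c + 1) < h c) h1.le h5.le
    refine ⟨d, ?_, hcd⟩
    by_contra hda
    have : d = a := by omega
    subst this
    have := hcd.right_unique H
    omega

/-! ### Recovering arcs from their numbers in intervals -/

open Classical in
/-- The right ends of the arcs that lie in `[i, j]`. -/
noncomputable def arcEnds (h : ℕ → ℤ) (i j : ℕ) : Finset ℕ :=
  {b ∈ Finset.range (j + 1) | ∃ a, i ≤ a ∧ Arc h a b}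

theorem mem_arcEnds {i j : ℕ} : b ∈ arcEnds h i j ↔ b ≤ j ∧ ∃ a, i ≤ a ∧ Arc h a b := by
  simp [arcEnds]

/-- Induction on the length of the arc. Every point strictly under an arc of `g` is matched under it
in `g`, and these shorter arcs belong to `h` by induction. The count on `[a, b]` yields one further
arc of `h`; all interior points being used up, it must join `a` to `b`. -/
theorem arc_of_card_arcEnds_le (hg : IsPath n g)
    (hc : ∀ i j, 1 ≤ i → i < j → j ≤ n → (arcEnds g i j).card ≤ (arcEnds h i j).card) (l : ℕ) :
    ∀ a b, b - a = l → Arc g a b → Arc h a b := by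
  induction l using Nat.strong_induction_on with
  | _ l ih =>
    intro a b hl H
    have hm := hg.arc_mem H
    have inner : ∀ p q, Arc g p q → a ≤ p → q ≤ b → (p ≠ a ∨ q ≠ b) → Arc h p q := by
      intro p q hpq h1 h2 h3
      have := hpq.1
      exact ih (q - p) (by omega) p q rfl hpq
    -- Pigeonhole: the ends of the `g`-arcs in `[a, b]` other than `b` are fewer than the ends of
    -- the `h`-arcs there.
    obtain ⟨q, hq, hq'⟩ : ∃ q ∈ arcEnds h a b, q ∉ (arcEnds g a b).erase b := by
      by_contra! hcon
      have h1 := Finset.card_le_card (fun q hq => hcon q hq)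
      have hb : b ∈ arcEnds g a b := mem_arcEnds.2 ⟨le_rfl, a, le_rfl, H⟩
      rw [Finset.card_erase_of_mem hb] at h1
      have := Finset.card_pos.2 ⟨b, hb⟩
      have := hc a b hm.1 H.1 hm.2
      omega
    obtain ⟨hqb, p, hap, hpq⟩ := mem_arcEnds.1 hq
    have hlt := hpq.1
    by_cases hqb' : q = b
    · subst hqb'
      by_cases hpa : p = a
      · exact hpa ▸ hpq
      exfalso
      rcases hg.inner H (show a < p by omega) hlt with ⟨d, hd, hpd⟩ | ⟨d, hd, hdp⟩
      · have := (inner p d hpd hap hd.le (.inl hpa)).right_unique hpq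
        omega
      · have := (inner d p hdp hd.le hlt.le (.inl (by omega))).down
        have := hpq.up
        omega
    · exfalso
      apply hq'
      rw [Finset.mem_erase, mem_arcEnds]
      refine ⟨hqb', hqb, ?_⟩
      rcases hg.inner H (show a < q by omega) (by omega) with ⟨d, hd, hqd⟩ | ⟨d, hd, hdq⟩
      · exfalso
        have := (inner q d hqd (by omega) hd.le (.inl (by omega))).up
        have := hpq.down
        omega
      · exact ⟨d, hd.le, hdq⟩

/-- By nonnegativity every down step ends an arc, so the arcs determine the down steps, and hence
all steps. -/
theorem IsPath.eq_of_arc_iff (hh : IsPath n h) (hg : IsPath n g)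
    (H : ∀ a b, Arc h a b ↔ Arc g a b) : h = g := by
  have key : ∀ k, h (k + 1) < h k ↔ g (k + 1) < g k := fun k =>
    ⟨fun hk => ((H _ _).1 (hh.exists_arc hk).choose_spec).down,
      fun hk => ((H _ _).2 (hg.exists_arc hk).choose_spec).down⟩
  funext k
  induction k with
  | zero => rw [hh.zero, hg.zero]
  | succ k ih =>
    have := key k
    by_cases hk : 1 ≤ k ∧ k ≤ n
    · rcases hh.step k hk.1 hk.2 with h1 | h1 <;> rcases hg.step k hk.1 hk.2 with h2 | h2 <;> omega
    · rw [hh.flat k (by omega), hg.flat k (by omega), ih]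

/-! ### Outer arcs and their removal -/

/-- The step at `x` goes down, and the path does not go below its height after `x` later on. -/
def Outer (h : ℕ → ℤ) (x : ℕ) : Prop :=
  h (x + 1) < h x ∧ ∀ k, x < k → h (x + 1) ≤ h k

/-- The path with the down step at `x` turned into an up step. -/
def raise (h : ℕ → ℤ) (x : ℕ) (k : ℕ) : ℤ := if k ≤ x then h k else h k + 2

theorem raise_of_le {x k : ℕ} (hk : k ≤ x) : raise h x k = h k := if_pos hk

theorem raise_of_lt {x k : ℕ} (hk : x < k) : raise h x k = h k + 2 := if_neg (by omega)

/-- An arc passing over `x`, or starting there, would have to return below the height after `x`,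
which outerness forbids. So each other arc lies on one side of `x`, where the path is unchanged or
translated, and the new up step at `x` stays unmatched. -/
theorem arc_raise_iff {x m : ℕ} (hs : ∀ k, h k ≤ h (k + 1) + 1) (hx : Outer h x) (hm : Arc h m x)
    {p q : ℕ} :
    Arc (raise h x) p q ↔ Arc h p q ∧ q ≠ x := by
  have hmx := hm.1
  constructor
  · rintro ⟨h1, h2, h3⟩
    have hq : q ≠ x := by
      rintro rfl
      rw [raise_of_lt (by omega), raise_of_le (by omega)] at h2
      have := hs q
      have := h3 q h1 le_rfl
      rw [raise_of_le (by omega), raise_of_le le_rfl] at this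
      have := hm.2.1
      by_cases hpm : p < m
      · have := h3 m hpm (by omega)
        rw [raise_of_le (by omega), raise_of_le (by omega)] at this
        omega
      by_cases hpm' : p = m
      · subst hpm'
        omega
      have := hm.2.2 p (by omega) (by omega)
      omega
    refine ⟨?_, hq⟩
    rcases lt_or_gt_of_ne hq with hlt | hlt
    · rw [raise_of_le (by omega), raise_of_le (by omega)] at h2
      refine ⟨h1, h2, fun k hk hkq => ?_⟩
      have := h3 k hk hkq
      rwa [raise_of_le (by omega), raise_of_le (by omega)] at this
    · by_cases hpx : x < p
      · rw [raise_of_lt (by omega), raise_of_lt (by omega)] at h2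
        refine ⟨h1, by omega, fun k hk hkq => ?_⟩
        have := h3 k hk hkq
        rw [raise_of_lt (by omega), raise_of_lt (by omega)] at this
        omega
      · exfalso
        rw [raise_of_lt (by omega), raise_of_le (by omega)] at h2
        have := hx.2 (q + 1) (by omega)
        have := hm.2.1
        have := hs x
        by_cases hpx' : p = x
        · subst hpx'
          omega
        have := h3 x (by omega) (by omega)
        rw [raise_of_le (by omega), raise_of_le (by omega)] at this
        omega
  · rintro ⟨⟨h1, h2, h3⟩, hq⟩
    rcases lt_or_gt_of_ne hq with hlt | hlt
    · refine ⟨h1, by rwa [raise_of_le (by omega), raise_of_le (by omega)], fun k hk hkq => ?_⟩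
      rw [raise_of_le (by omega), raise_of_le (by omega)]
      exact h3 k hk hkq
    · by_cases hpx : x < p
      · refine ⟨h1, by rw [raise_of_lt (by omega), raise_of_lt (by omega), h2], fun k hk hkq => ?_⟩
        rw [raise_of_lt (by omega), raise_of_lt (by omega)]
        have := h3 k hk hkq
        omega
      · exfalso
        have := h3 (x + 1) (by omega) (by omega)
        have := hx.2 (q + 1) (by omega)
        omega

theorem IsPath.raise {x : ℕ} (hh : IsPath n h) (hx : Outer h x) : IsPath n (raise h x) := by
  have hx1 := hh.mem_of_ne (k := x) (by have := hx.1; omega)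
  refine ⟨by rw [raise_of_le (by omega), hh.zero], fun k => ?_, fun k h1 h2 => ?_, fun k hk => ?_⟩
  · have := hh.nonneg k
    unfold YoungOrder.raise
    split_ifs <;> omega
  · by_cases hkx : k = x
    · subst hkx
      rw [raise_of_lt (by omega), raise_of_le (by omega)]
      have := hx.1
      have := hh.step_le k
      omega
    · have := hh.step k h1 h2
      unfold YoungOrder.raise
      split_ifs <;> omega
  · have := hh.flat k hk
    unfold YoungOrder.raise
    split_ifs <;> omega

/-- Take the arc `(m, x)` of `h` missing in `g` whose right end is largest. If `h` later fell below
its height after `x`, the first step doing so would end an arc around `(m, x)`. By maximality that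
arc lies in `g`, so `m` is matched under it in `g`, and then by an arc of `h`; this can only be `(m,
x)`. -/
theorem IsPath.exists_outer (hh : IsPath n h) (hg : IsPath n g)
    (hsub : ∀ a b, Arc g a b → Arc h a b) (hne : h ≠ g) :
    ∃ m x, Outer h x ∧ Arc h m x ∧ ∀ a b, Arc g a b → b ≠ x := by
  -- Writing the right end as `n - d` turns the largest `x` into the least `d`.
  have hex : ∃ d, ∃ m x, x + d = n ∧ Arc h m x ∧ ¬ Arc g m x := by
    by_contra! hcon
    refine hne (hh.eq_of_arc_iff hg fun a b => ⟨fun hab => ?_, hsub a b⟩)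
    exact hcon (n - b) a b (by have := (hh.arc_mem hab).2; omega) hab
  classical
  obtain ⟨d, ⟨m, x, hd, hmx, hng⟩, hmin⟩ : ∃ d, (∃ m x, x + d = n ∧ Arc h m x ∧ ¬ Arc g m x) ∧
      ∀ e, e < d → ¬ (∃ m x, x + e = n ∧ Arc h m x ∧ ¬ Arc g m x) :=
    ⟨Nat.find hex, Nat.find_spec hex, fun m hm => Nat.find_min hex hm⟩
  have hlt := hmx.1
  refine ⟨m, x, ⟨hmx.down, ?_⟩, hmx, ?_⟩
  · by_contra! hcon
    have hex' : ∃ k, x < k ∧ h k < h (x + 1) := hcon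
    obtain ⟨k, ⟨hk1, hk2⟩, hkmin⟩ : ∃ k, (x < k ∧ h k < h (x + 1)) ∧
        ∀ e, e < k → ¬ (x < e ∧ h e < h (x + 1)) :=
      ⟨Nat.find hex', Nat.find_spec hex', fun m hm => Nat.find_min hex' hm⟩
    have hk3 : x + 1 < k := by
      by_contra hc
      rw [show k = x + 1 by omega] at hk2
      omega
    obtain ⟨q, rfl⟩ : ∃ q, k = q + 1 := ⟨k - 1, by omega⟩
    have hq : h (x + 1) ≤ h q := by
      by_contra hc
      exact hkmin q (by omega) ⟨by omega, by omega⟩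
    obtain ⟨p, hpq⟩ := hh.exists_arc (show h (q + 1) < h q by omega)
    have hpm : p < m := by
      have h1 := hpq.2.1
      have h2 := hmx.2.1
      have h3 := hpq.1
      by_contra hc
      rcases (by omega : p = m ∨ (m < p ∧ p ≤ x) ∨ x < p) with h4 | h4 | h4
      · subst h4
        omega
      · have := hmx.2.2 p h4.1 h4.2
        omega
      · exact hkmin p (by omega) ⟨h4, by omega⟩
    have hgpq : Arc g p q := by
      by_contra hc
      have := (hh.arc_mem hpq).2
      exact hmin (n - q) (by omega) ⟨p, q, by omega, hpq, hc⟩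
    rcases hg.inner hgpq hpm (by omega) with ⟨d, -, hd⟩ | ⟨d, -, hd⟩
    · exact hng ((hsub _ _ hd).right_unique hmx ▸ hd)
    · have := (hsub _ _ hd).down
      have := hmx.up
      omega
  · rintro a b hab rfl
    have := (hsub _ _ hab).left_unique hmx
    subst this
    exact hng hab

end YoungOrder

namespace YoungOrder

/-! ### Tableaux with two columns as lattice paths -/

/-- The tableau with columns `C` and `D`, either of which may be empty. -/
def tab (C D : List ℕ) : List (List ℕ) := dropEmpty [C, D]

theorem tab_cons_cons (c d : ℕ) (C D : List ℕ) : tab (c :: C) (d :: D) = [c :: C, d :: D] := by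
  simp [tab, dropEmpty]

theorem tab_cons_nil (c : ℕ) (C : List ℕ) : tab (c :: C) [] = [c :: C] := by
  simp [tab, dropEmpty]

theorem tab_nil_nil : tab [] [] = [] := by
  simp [tab, dropEmpty]

/-- The difference of the numbers of entries smaller than `k` in the two columns. -/
def pathOf (C D : List ℕ) (k : ℕ) : ℤ := (C.countP (· < k) : ℤ) - D.countP (· < k)

theorem countP_lt_succ (C : List ℕ) (k : ℕ) :
    C.countP (· < k + 1) = C.countP (· < k) + C.count k := by
  induction C with
  | nil => simp
  | cons c C ih =>
    simp only [List.countP_cons, List.count_cons, ih, decide_eq_true_eq, beq_iff_eq]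
    split_ifs <;> omega

theorem pathOf_succ (C D : List ℕ) (k : ℕ) :
    pathOf C D (k + 1) = pathOf C D k + C.count k - D.count k := by
  simp only [pathOf, countP_lt_succ]
  push_cast
  ring

/-- The columns of a standard tableau with arbitrary distinct entries. -/
structure Ballot (C D : List ℕ) : Prop where
  left : C.Pairwise (· < ·)
  right : D.Pairwise (· < ·)
  disj : ∀ x ∈ C, x ∉ D
  nonneg : ∀ k, 0 ≤ pathOf C D k

theorem countP_lt_eq_zero {C : List ℕ} {k : ℕ} (hC : ∀ x ∈ C, k ≤ x) : C.countP (· < k) = 0 := by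
  rw [List.countP_eq_zero]
  intro x hx
  simpa using hC x hx

theorem nonneg_of_zip {C D : List ℕ} (hl : D.length ≤ C.length)
    (hz : ∀ p ∈ C.zip D, p.1 < p.2) (k : ℕ) : 0 ≤ pathOf C D k := by
  induction C generalizing D with
  | nil =>
    obtain rfl : D = [] := by simpa using hl
    simp [pathOf]
  | cons c C ih =>
    cases D with
    | nil => simp [pathOf]
    | cons d D =>
      simp only [List.zip_cons_cons, List.mem_cons, forall_eq_or_imp] at hz
      have h1 := ih (by simpa using hl) hz.2
      have h2 := hz.1
      simp only [pathOf, List.countP_cons, decide_eq_true_eq] at h1 ⊢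
      split_ifs <;> push_cast <;> omega

/-- The converse of `nonneg_of_zip`. If the head of `D` were the smaller one, the path would be
negative just after it. Stripping both heads leaves the heights beyond `d` unchanged, and up to `d`
the shortened `D` contributes nothing. -/
theorem zip_of_nonneg {C D : List ℕ} (hD : D.Pairwise (· < ·)) (hC : C.Pairwise (· < ·))
    (hd : ∀ x ∈ C, x ∉ D) (h : ∀ k, 0 ≤ pathOf C D k) :
    D.length ≤ C.length ∧ ∀ p ∈ C.zip D, p.1 < p.2 := by
  induction C generalizing D with
  | nil =>
    cases D with
    | nil => simp
    | cons d D =>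
      have := h (d + 1)
      simp [pathOf] at this
      omega
  | cons c C ih =>
    cases D with
    | nil => simp
    | cons d D =>
      have hcd : c < d := by
        by_contra hc
        have hne : c ≠ d := fun e => hd c (by simp) (by simp [e])
        have h1 := h (d + 1)
        have h2 : (c :: C).countP (· < d + 1) = 0 := countP_lt_eq_zero (by
          intro x hx
          rcases List.mem_cons.1 hx with rfl | hx
          · omega
          · have := (List.pairwise_cons.1 hC).1 x hx
            omega)
        simp only [pathOf, h2, List.countP_cons] at h1
        simp at h1
        omega
      have := ih (D := D) (List.pairwise_cons.1 hD).2 (List.pairwise_cons.1 hC).2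
        (fun x hx hx' => hd x (by simp [hx]) (by simp [hx'])) (fun k => by
          have := h k
          simp only [pathOf, List.countP_cons, decide_eq_true_eq] at this ⊢
          by_cases hdk : d < k
          · simp only [hdk, if_true, show c < k by omega] at this
            push_cast at this
            omega
          · have h2 : D.countP (· < k) = 0 := countP_lt_eq_zero fun x hx => by
              have := (List.pairwise_cons.1 hD).1 x hx
              omega
            rw [h2]
            simp)
      simpa [hcd] using this

theorem Ballot.zip {C D : List ℕ} (H : Ballot C D) :
    D.length ≤ C.length ∧ ∀ p ∈ C.zip D, p.1 < p.2 :=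
  zip_of_nonneg H.right H.left H.disj H.nonneg

/-- The columns of a standard Young tableau with at most two columns. -/
structure TwoCol (n : ℕ) (C D : List ℕ) : Prop extends Ballot C D where
  perm : (C ++ D).Perm (List.range' 1 n)

theorem TwoCol.of_perm {n : ℕ} {C D : List ℕ} (hC : C.Pairwise (· < ·)) (hD : D.Pairwise (· < ·))
    (hp : (C ++ D).Perm (List.range' 1 n)) (hn : ∀ k, 0 ≤ pathOf C D k) : TwoCol n C D where
  left := hC
  right := hD
  disj := by
    have : (C ++ D).Nodup := hp.nodup_iff.2 List.nodup_range'
    rw [List.nodup_append] at this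
    exact fun x hx hx' => this.2.2 x hx x hx' rfl
  nonneg := hn
  perm := hp

theorem StdTableau.twoCol {n : ℕ} (T : StdTableau n) (hT : T ∈ twoColumn n) :
    TwoCol n (col₁ T) (col₂ T) ∧ T.cols = tab (col₁ T) (col₂ T) := by
  obtain ⟨cols, h1, h2, h3, h4⟩ := T
  simp only [twoColumn, Set.mem_ofPred_eq] at hT
  simp only [col₁, col₂]
  rcases cols with _ | ⟨C, _ | ⟨D, _ | ⟨E, l⟩⟩⟩
  · exact ⟨.of_perm (by simp) (by simp) (by simpa using h4) (by simp [pathOf]), by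
      simp [tab, dropEmpty]⟩
  · exact ⟨.of_perm (by simpa using h2) (by simp) (by simpa using h4) (by simp [pathOf]), by
      have := h1 C (by simp)
      simp [tab, dropEmpty, this]⟩
  · refine ⟨.of_perm (h2 C (by simp)) (h2 D (by simp)) (by simpa using h4) ?_, ?_⟩
    · simp only [List.isChain_cons_cons] at h3
      exact nonneg_of_zip h3.1.1 h3.1.2
    · have hC := h1 C (by simp)
      have hD := h1 D (by simp)
      simp [tab, dropEmpty, hC, hD]
  · simp at hT

theorem Ballot.right_nil {C D : List ℕ} (H : Ballot C D) (hC : C = []) : D = [] := by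
  have := H.zip.1
  subst hC
  simpa using this

theorem Ballot.getD {C D : List ℕ} (H : Ballot C D) :
    (tab C D).getD 0 [] = C ∧ (tab C D).getD 1 [] = D := by
  rcases C with _ | ⟨c, C⟩
  · rw [H.right_nil rfl]
    simp [tab_nil_nil]
  · rcases D with _ | ⟨d, D⟩
    · simp [tab_cons_nil]
    · simp [tab_cons_cons]

theorem TwoCol.exists_tableau {n : ℕ} {C D : List ℕ} (H : TwoCol n C D) :
    ∃ T : StdTableau n, T ∈ twoColumn n ∧ T.cols = tab C D ∧ col₁ T = C ∧ col₂ T = D := by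
  have hz := H.toBallot.zip
  have hmem : ∀ E ∈ tab C D, (E = C ∨ E = D) ∧ E ≠ [] := by
    intro E hE
    simpa [tab, dropEmpty] using hE
  refine ⟨⟨tab C D, fun E hE => (hmem E hE).2, fun E hE => ?_, ?_, ?_⟩, ?_, rfl, ?_⟩
  · rcases (hmem E hE).1 with rfl | rfl
    exacts [H.left, H.right]
  · rcases C with _ | ⟨c, C⟩
    · rw [H.toBallot.right_nil rfl]
      simp [tab_nil_nil]
    · rcases D with _ | ⟨d, D⟩
      · simp [tab_cons_nil]
      · rw [tab_cons_cons]
        exact .cons_cons hz (.singleton _)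
  · have : (tab C D).flatten = C ++ D := by
      rcases C with _ | ⟨c, C⟩ <;> rcases D with _ | ⟨d, D⟩ <;> simp [tab, dropEmpty]
    rw [this]
    exact H.perm
  · exact (List.length_filter_le _ _).trans (by simp)
  · exact H.toBallot.getD

theorem TwoCol.mem_iff {n : ℕ} {C D : List ℕ} (H : TwoCol n C D) {x : ℕ} :
    x ∈ C ∨ x ∈ D ↔ 1 ≤ x ∧ x ≤ n := by
  rw [← List.mem_append, H.perm.mem_iff, List.mem_range'_1]
  omega

theorem Ballot.count_left {C D : List ℕ} (H : Ballot C D) (k : ℕ) :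
    C.count k = if k ∈ C then 1 else 0 := by
  split_ifs with h
  · exact List.count_eq_one_of_mem (H.left.imp ne_of_lt) h
  · exact List.count_eq_zero.2 h

theorem Ballot.count_right {C D : List ℕ} (H : Ballot C D) (k : ℕ) :
    D.count k = if k ∈ D then 1 else 0 := by
  split_ifs with h
  · exact List.count_eq_one_of_mem (H.right.imp ne_of_lt) h
  · exact List.count_eq_zero.2 h

theorem Ballot.up_iff {C D : List ℕ} (H : Ballot C D) {k : ℕ} :
    pathOf C D k < pathOf C D (k + 1) ↔ k ∈ C := by
  have := H.disj k
  rw [pathOf_succ, H.count_left, H.count_right]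
  split_ifs <;> simp_all

theorem Ballot.down_iff {C D : List ℕ} (H : Ballot C D) {k : ℕ} :
    pathOf C D (k + 1) < pathOf C D k ↔ k ∈ D := by
  have := H.disj k
  rw [pathOf_succ, H.count_left, H.count_right]
  split_ifs <;> simp_all

theorem TwoCol.isPath {n : ℕ} {C D : List ℕ} (H : TwoCol n C D) : IsPath n (pathOf C D) := by
  refine ⟨by simp [pathOf], H.nonneg, fun k h1 h2 => ?_, fun k hk => ?_⟩
  · rw [pathOf_succ, H.count_left, H.count_right]
    rcases H.mem_iff.2 ⟨h1, h2⟩ with h | h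
    · simp [h, H.disj k h]
    · have : k ∉ C := fun hc => H.disj k hc h
      simp [h, this]
  · have : ¬ (k ∈ C ∨ k ∈ D) := by
      rw [H.mem_iff]
      omega
    rw [not_or] at this
    rw [pathOf_succ, H.count_left, H.count_right]
    simp [this]

theorem TwoCol.ext {n : ℕ} {C D C' D' : List ℕ} (H : TwoCol n C D) (H' : TwoCol n C' D')
    (h : pathOf C D = pathOf C' D') : C = C' ∧ D = D' := by
  constructor
  · refine List.Pairwise.eq_of_mem_iff H.left H'.left fun {x} => ?_
    rw [← H.up_iff, ← H'.up_iff, h]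
  · refine List.Pairwise.eq_of_mem_iff H.right H'.right fun {x} => ?_
    rw [← H.down_iff, ← H'.down_iff, h]

theorem pathOf_move {C D : List ℕ} {x : ℕ} (hx : x ∈ D) :
    pathOf (C.orderedInsert (· ≤ ·) x) (D.erase x) = raise (pathOf C D) x := by
  funext k
  have h1 := (List.perm_orderedInsert (· ≤ ·) x C).countP_eq (· < k)
  have h2 := (List.perm_cons_erase hx).countP_eq (· < k)
  simp only [pathOf, raise]
  rw [h1, h2, List.countP_cons, List.countP_cons]
  by_cases hk : x < k
  · simp only [hk, decide_true, if_true, if_neg (show ¬ k ≤ x by omega)]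
    push_cast
    ring
  · simp [hk, show k ≤ x by omega]

theorem TwoCol.move {n : ℕ} {C D : List ℕ} (H : TwoCol n C D) {x : ℕ}
    (ho : Outer (pathOf C D) x) : TwoCol n (C.orderedInsert (· ≤ ·) x) (D.erase x) := by
  have hx : x ∈ D := H.down_iff.1 ho.1
  have hxC : x ∉ C := fun h => H.disj x h hx
  refine .of_perm ?_ (H.right.erase x) ?_ ?_
  · have h1 : (C.orderedInsert (· ≤ ·) x).Pairwise (· ≤ ·) :=
      (H.left.imp le_of_lt).orderedInsert x
    have h2 : (C.orderedInsert (· ≤ ·) x).Nodup := by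
      rw [(List.perm_orderedInsert (· ≤ ·) x C).nodup_iff, List.nodup_cons]
      exact ⟨hxC, H.left.imp ne_of_lt⟩
    exact (h1.and h2).imp fun h => lt_of_le_of_ne h.1 h.2
  · refine List.Perm.trans ?_ H.perm
    refine ((List.perm_orderedInsert (· ≤ ·) x C).append_right _).trans ?_
    exact List.perm_middle.symm.trans ((List.perm_cons_erase hx).symm.append_left C)
  · rw [pathOf_move hx]
    exact (H.isPath.raise ho).nonneg

end YoungOrder

namespace YoungOrder

/-! ### Jeu de taquin on tableaux with two columns -/

theorem filter_append_singleton_of_max {C : List ℕ} (hC : C.Pairwise (· < ·)) {z : ℕ} (hz : z ∈ C)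
    (hmax : ∀ x ∈ C, x ≤ z) : C.filter (· < z) ++ [z] = C := by
  induction C with
  | nil => simp at hz
  | cons c C ih =>
    rw [List.pairwise_cons] at hC
    by_cases hcz : c = z
    · subst hcz
      have : C = [] := by
        rw [List.eq_nil_iff_forall_not_mem]
        intro x hx
        have := hC.1 x hx
        have := hmax x (by simp [hx])
        omega
      simp [this]
    · have h1 := hmax c (by simp)
      rw [List.filter_cons_of_pos (by simpa using lt_of_le_of_ne h1 hcz), List.cons_append,
        ih hC.2 (by simpa [Ne.symm hcz] using hz) fun x hx => hmax x (by simp [hx])]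

theorem filter_lt_eq_self {C : List ℕ} {z : ℕ} (h : ∀ x ∈ C, x < z) : C.filter (· < z) = C := by
  rw [List.filter_eq_self]
  simpa using h

theorem countP_filter_lt (C : List ℕ) (z k : ℕ) :
    (C.filter (· < z)).countP (· < k) = C.countP (· < min k z) := by
  rw [List.countP_filter]
  congr 1
  funext x
  simp

theorem pathOf_filter (C D : List ℕ) (z k : ℕ) :
    pathOf (C.filter (· < z)) (D.filter (· < z)) k = pathOf C D (min k z) := by
  simp only [pathOf, countP_filter_lt]

theorem Ballot.filter {C D : List ℕ} (H : Ballot C D) (z : ℕ) :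
    Ballot (C.filter (· < z)) (D.filter (· < z)) where
  left := H.left.filter _
  right := H.right.filter _
  disj x hx hx' := H.disj x (List.mem_of_mem_filter hx) (List.mem_of_mem_filter hx')
  nonneg k := by
    rw [pathOf_filter]
    exact H.nonneg _

theorem Ballot.step_le {C D : List ℕ} (H : Ballot C D) (k : ℕ) :
    pathOf C D (k + 1) ≤ pathOf C D k + 1 ∧ pathOf C D k ≤ pathOf C D (k + 1) + 1 := by
  rw [pathOf_succ, H.count_left, H.count_right]
  split_ifs <;> push_cast <;> omega

theorem Ballot.exists_arc {C D : List ℕ} (H : Ballot C D) {b : ℕ} (hb : b ∈ D) :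
    ∃ a, Arc (pathOf C D) a b := by
  obtain ⟨a, -, ha⟩ := exists_arc_left (i := 0) (fun k => (H.step_le k).1) (H.down_iff.2 hb)
    (by omega) (by simpa [pathOf] using H.nonneg (b + 1))
  exact ⟨a, ha⟩

theorem Ballot.length_le_of_max {C D : List ℕ} (H : Ballot C D) {z : ℕ} (hD : ∀ x ∈ D, x < z) :
    D.length ≤ (C.filter (· < z)).length := by
  have := H.nonneg z
  have h1 : D.countP (· < z) = D.length := List.countP_eq_length.2 (by simpa using hD)
  rw [pathOf, h1] at this
  rw [← List.countP_eq_length_filter]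
  omega

theorem slideCol_nil_right (C : List ℕ) : slideCol C [] = (C, none) := by
  cases C <;> rfl

theorem dropEmpty_cons_dropEmpty (C D : List ℕ) : dropEmpty (C :: dropEmpty [D]) = tab C D := by
  rcases C with _ | ⟨c, C⟩ <;> rcases D with _ | ⟨d, D⟩ <;> simp [tab, dropEmpty]

/-- The largest entry is at the bottom of its column and has no right neighbour, so the slide stops
at once. When it lies in the first column, the ballot condition makes the second column too short to
reach its row. -/
theorem jdtRemove_max {C D : List ℕ} (H : Ballot C D) {z : ℕ} (hz : z ∈ C ∨ z ∈ D)
    (hC : ∀ x ∈ C, x ≤ z) (hD : ∀ x ∈ D, x ≤ z) :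
    jdtRemove (tab C D) z = tab (C.filter (· < z)) (D.filter (· < z)) := by
  rcases hz with hz | hz
  · have hD' : ∀ x ∈ D, x < z := fun x hx =>
      lt_of_le_of_ne (hD x hx) fun e => H.disj z hz (e ▸ hx)
    have hl := H.length_le_of_max hD'
    have hC' := filter_append_singleton_of_max H.left hz hC
    rw [filter_lt_eq_self hD']
    generalize hC0 : C.filter (· < z) = C0 at hC' hl ⊢
    have hz0 : z ∉ C0 := by
      rw [← hC0]
      simp
    subst hC'
    have hidx : (C0 ++ [z]).idxOf z = C0.length := by
      rw [List.idxOf_append_of_notMem hz0]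
      simp
    have key : ∀ T : List (List ℕ), T.headD [] = D →
        jdtAux z ((C0 ++ [z]) :: T) = C0 :: T := by
      intro T hT
      rw [jdtAux, if_pos (by simp), hidx, slide, hT, List.drop_eq_nil_of_le hl,
        slideCol_nil_right]
      simp
    rw [jdtRemove]
    rcases D with _ | ⟨d, D⟩
    · have : tab (C0 ++ [z]) [] = [C0 ++ [z]] := by simp [tab, dropEmpty]
      rw [this, key _ rfl]
      exact dropEmpty_cons_dropEmpty C0 []
    · have : tab (C0 ++ [z]) (d :: D) = [C0 ++ [z], d :: D] := by simp [tab, dropEmpty]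
      rw [this, key _ rfl]
      rfl
  · have hzC : z ∉ C := fun h => H.disj z h hz
    have hC' : ∀ x ∈ C, x < z := fun x hx =>
      lt_of_le_of_ne (hC x hx) fun e => hzC (e ▸ hx)
    have hD' := filter_append_singleton_of_max H.right hz hD
    rw [filter_lt_eq_self hC']
    have hne : C ≠ [] := fun h => by
      rw [H.right_nil h] at hz
      simp at hz
    generalize hD0 : D.filter (· < z) = D0 at hD' ⊢
    have hz0 : z ∉ D0 := by
      rw [← hD0]
      simp
    subst hD'
    have hidx : (D0 ++ [z]).idxOf z = D0.length := by
      rw [List.idxOf_append_of_notMem hz0]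
      simp
    have : tab C (D0 ++ [z]) = [C, D0 ++ [z]] := by simp [tab, dropEmpty, hne]
    rw [jdtRemove, this, jdtAux, if_neg hzC, jdtAux, if_pos (by simp), hidx, slide]
    simp [slideCol, tab]

theorem TwoCol.foldl_jdtRemove_max {n : ℕ} {C D : List ℕ} (H : TwoCol n C D) (l j : ℕ)
    (hj : j + l = n) :
    (List.range' (j + 1) l).reverse.foldl jdtRemove (tab C D) =
      tab (C.filter (· < j + 1)) (D.filter (· < j + 1)) := by
  induction l generalizing j with
  | zero =>
    rw [filter_lt_eq_self fun x hx => ?_, filter_lt_eq_self fun x hx => ?_]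
    · rfl
    · have := (H.mem_iff.1 (.inr hx)).2
      omega
    · have := (H.mem_iff.1 (.inl hx)).2
      omega
  | succ l ih =>
    rw [List.range'_succ, List.reverse_cons, List.foldl_append, ih (j + 1) (by omega)]
    have h1 := H.mem_iff.2 (show 1 ≤ j + 1 ∧ j + 1 ≤ n by omega)
    simp only [List.foldl_cons, List.foldl_nil]
    rw [jdtRemove_max (H.toBallot.filter _) (by simpa using h1) (by simp) (by simp),
      List.filter_filter, List.filter_filter]
    congr 2 <;> · funext x; simp; omega

/-- While the hole moves down, the remaining entries of `C` and `D` satisfy the row condition. It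
turns right at the first violation, which is the first step `d` where the path of the pair reaches
height `-1`. -/
theorem slideCol_spec {C D : List ℕ} (hC : C.Pairwise (· < ·)) (hD : D.Pairwise (· < ·))
    (hd : ∀ x ∈ C, x ∉ D) :
    (slideCol C D = (C, none) ∧ ∀ k, 0 ≤ pathOf C D k) ∨
    ∃ D₁ d D₂, D = D₁ ++ d :: D₂ ∧
      slideCol C D = (C.orderedInsert (· ≤ ·) d, some D₁.length) ∧
      pathOf C D (d + 1) = -1 ∧ ∀ k, k ≤ d → 0 ≤ pathOf C D k := by
  induction C generalizing D with
  | nil =>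
    rcases D with _ | ⟨d, D⟩
    · left
      simp [slideCol, pathOf]
    · right
      have h0 : ∀ k, k ≤ d + 1 → D.countP (· < k) = 0 := fun k hk => countP_lt_eq_zero
        fun x hx => by
          have := (List.pairwise_cons.1 hD).1 x hx
          omega
      refine ⟨[], d, D, rfl, rfl, ?_, fun k hk => ?_⟩
      · simp only [pathOf, List.countP_cons, h0 (d + 1) le_rfl, List.countP_nil]
        simp
      · simp [pathOf, h0 k (by omega), hk]
  | cons b C ih =>
    rcases D with _ | ⟨d, D⟩
    · left
      simp [slideCol, pathOf]
    rw [List.pairwise_cons] at hC hD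
    have h0 : ∀ k, k ≤ d + 1 → D.countP (· < k) = 0 := fun k hk => countP_lt_eq_zero
      fun x hx => by
        have := hD.1 x hx
        omega
    by_cases hbd : b < d
    · have hpath : ∀ k, d < k → pathOf (b :: C) (d :: D) k = pathOf C D k := by
        intro k hk
        simp [pathOf, hk, hbd.trans hk]
      have hsmall : ∀ k, k ≤ d → 0 ≤ pathOf (b :: C) (d :: D) k := by
        intro k hk
        simp [pathOf, List.countP_cons, h0 k (by omega), hk]
        positivity
      rcases ih hC.2 hD.2 (fun x hx hx' => hd x (by simp [hx]) (by simp [hx'])) with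
        ⟨h1, h2⟩ | ⟨D₁, e, D₂, rfl, h2, h3, h4⟩
      · left
        refine ⟨by rw [slideCol, if_pos hbd, h1]; rfl, fun k => ?_⟩
        by_cases hk : d < k
        · rw [hpath k hk]
          exact h2 k
        · exact hsmall k (by omega)
      · right
        have hde : d < e := hD.1 e (by simp)
        refine ⟨d :: D₁, e, D₂, rfl, ?_, ?_, fun k hk => ?_⟩
        · rw [slideCol, if_pos hbd, h2, List.orderedInsert_cons, if_neg (by omega)]
          simp
        · rw [hpath _ (by omega), h3]
        · by_cases hk' : d < k
          · rw [hpath k hk']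
            exact h4 k hk
          · exact hsmall k (by omega)
    · right
      have hne : b ≠ d := fun e => hd b (by simp) (by simp [e])
      have h1 : ∀ k, k ≤ d + 1 → C.countP (· < k) = 0 := fun k hk => countP_lt_eq_zero
        fun x hx => by
          have := hC.1 x hx
          omega
      refine ⟨[], d, D, rfl, ?_, ?_, fun k hk => ?_⟩
      · rw [slideCol, if_neg hbd, List.orderedInsert_cons, if_pos (by omega)]
        rfl
      · simp only [pathOf, List.countP_cons, h0 (d + 1) le_rfl, h1 (d + 1) le_rfl,
          decide_eq_true_eq]
        rw [if_neg (by omega), if_pos (by omega)]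
        simp
      · simp [pathOf, List.countP_cons, h0 k (by omega), hk]
        positivity

theorem Arc.left_mem {C D : List ℕ} (H : Ballot C D) {p q : ℕ} (h : Arc (pathOf C D) p q) :
    p ∈ C := H.up_iff.1 h.up

theorem Arc.right_mem {C D : List ℕ} (H : Ballot C D) {p q : ℕ} (h : Arc (pathOf C D) p q) :
    q ∈ D := H.down_iff.1 h.down

/-- `g'` is `g` without the up step at `i`, before which `g` is zero; the rest sinks by one, so only
an arc starting at `i` is lost. -/
theorem arc_shift {g g' : ℕ → ℤ} {i : ℕ} (h0 : ∀ k, k ≤ i → g k = 0)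
    (h1 : ∀ k, k ≤ i → g' k = 0) (h2 : g' (i + 1) = 0) (h3 : ∀ k, i < k → g' k = g k - 1)
    {p q : ℕ} : Arc g' p q ↔ p ≠ i ∧ Arc g p q := by
  constructor
  · intro H
    have h4 : i < p := by
      have := H.up
      by_contra hc
      have h5 := h1 p (by omega)
      by_cases hp : p = i
      · subst hp
        omega
      · have h6 := h1 (p + 1) (by omega)
        omega
    obtain ⟨h5, h6, h7⟩ := H
    rw [h3 _ (by omega), h3 _ (by omega)] at h6
    refine ⟨by omega, h5, by omega, fun k hk hkq => ?_⟩
    have := h7 k hk hkq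
    rw [h3 _ (by omega), h3 _ (by omega)] at this
    omega
  · rintro ⟨hp, H⟩
    have h4 : i < p := by
      have := H.up
      by_contra hc
      have h5 := h0 p (by omega)
      have h6 := h0 (p + 1) (by omega)
      omega
    obtain ⟨h5, h6, h7⟩ := H
    refine ⟨h5, by rw [h3 _ (by omega), h3 _ (by omega), h6], fun k hk hkq => ?_⟩
    have := h7 k hk hkq
    rw [h3 _ (by omega), h3 _ (by omega)]
    omega

/-- Removing the smallest entry by jeu de taquin removes its arc. -/
theorem jdtRemove_min {m : ℕ} {C D : List ℕ} (H : Ballot (m :: C) D) :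
    ∃ C' D', jdtRemove (tab (m :: C) D) m = tab C' D' ∧ Ballot C' D' ∧
      (∀ x, (x ∈ C' ∨ x ∈ D') ↔ (x ∈ C ∨ x ∈ D)) ∧
      ∀ p q, Arc (pathOf C' D') p q ↔ p ≠ m ∧ Arc (pathOf (m :: C) D) p q := by
  have hC := List.pairwise_cons.1 H.left
  have hDm : ∀ x ∈ D, m < x := by
    intro x hx
    obtain ⟨a, ha⟩ := H.exists_arc hx
    rcases List.mem_cons.1 (ha.left_mem H) with rfl | h
    · exact ha.1
    · exact (hC.1 a h).trans ha.1
  have hdisj : ∀ x ∈ C, x ∉ D := fun x hx => H.disj x (by simp [hx])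
  have hz : ∀ k, k ≤ m + 1 → pathOf C D k = 0 := by
    intro k hk
    rw [pathOf, countP_lt_eq_zero, countP_lt_eq_zero]
    · simp
    · intro x hx
      have := hDm x hx
      omega
    · intro x hx
      have := hC.1 x hx
      omega
  have hcons : ∀ k, pathOf (m :: C) D k = pathOf C D k + if m < k then 1 else 0 := by
    intro k
    simp only [pathOf, List.countP_cons, decide_eq_true_eq]
    push_cast
    ring
  have hcons1 : ∀ k, k ≤ m → pathOf (m :: C) D k = 0 := fun k hk => by
    rw [hcons, hz k (by omega), if_neg (by omega), add_zero]
  have hcons2 : ∀ k, m < k → pathOf C D k = pathOf (m :: C) D k - 1 := fun k hk => by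
    rw [hcons, if_pos hk]
    ring
  have htab : tab (m :: C) D = (m :: C) :: dropEmpty [D] := by
    simp [tab, dropEmpty]
  have hhead : (dropEmpty [D]).headD [] = D := by
    cases D <;> simp [dropEmpty]
  have hjdt : jdtAux m (tab (m :: C) D) = match slideCol C D with
      | (E, none) => E :: dropEmpty [D]
      | (E, some k) => E :: slide k (dropEmpty [D]) := by
    rw [htab, jdtAux, if_pos (by simp), List.idxOf_cons_self, slide, hhead]
    rcases h : slideCol C D with ⟨E, _ | k⟩ <;> simp [h]
  rcases slideCol_spec hC.2 H.right hdisj with ⟨h1, h2⟩ | ⟨D₁, d, D₂, rfl, h2, h3, h4⟩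
  · refine ⟨C, D, ?_, ⟨hC.2, H.right, hdisj, h2⟩, fun x => Iff.rfl, fun p q => ?_⟩
    · rw [jdtRemove, hjdt, h1]
      exact dropEmpty_cons_dropEmpty C D
    · exact arc_shift hcons1 (fun k hk => hz k (by omega)) (hz _ le_rfl) hcons2
  · set D := D₁ ++ d :: D₂ with hD
    have hdD : d ∈ D := by simp [hD]
    have hmd := hDm d hdD
    have herase : D.erase d = D₁ ++ D₂ := by
      have : d ∉ D₁ := by
        have := H.right
        rw [hD, List.pairwise_append] at this
        intro h
        have := this.2.2 d h d (by simp)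
        omega
      rw [hD, List.erase_append_right _ this, List.erase_cons_head]
    have hpath := pathOf_move (C := C) hdD
    have hdC : d ∉ C := fun h => hdisj d h hdD
    have harc : Arc (pathOf (m :: C) D) m d := by
      refine ⟨hmd, ?_, fun k hk hkd => ?_⟩
      · rw [hcons, h3, if_pos (by omega), hcons1 m le_rfl]
        simp
      · rw [hcons1 m le_rfl, hcons, if_pos hk]
        have := h4 k hkd
        omega
    -- The arc of the smallest entry starts at height zero, and the path is nonnegative.
    have houter : Outer (pathOf (m :: C) D) d := by
      refine ⟨harc.down, fun k hk => ?_⟩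
      rw [harc.2.1, hcons1 m le_rfl]
      exact H.nonneg k
    refine ⟨C.orderedInsert (· ≤ ·) d, D.erase d, ?_, ⟨?_, H.right.erase d, ?_, fun k => ?_⟩,
      fun x => ?_, fun p q => ?_⟩
    · have : dropEmpty [D] = [D] := by simp [dropEmpty, hD]
      rw [jdtRemove, hjdt, h2, herase, this]
      simp only [slide]
      rw [List.headD_nil, List.drop_nil, slideCol_nil_right]
      simp [hD, tab]
    · have h5 : (C.orderedInsert (· ≤ ·) d).Pairwise (· ≤ ·) :=
        (hC.2.imp le_of_lt).orderedInsert d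
      have h6 : (C.orderedInsert (· ≤ ·) d).Nodup := by
        rw [(List.perm_orderedInsert (· ≤ ·) d C).nodup_iff, List.nodup_cons]
        exact ⟨hdC, hC.2.imp ne_of_lt⟩
      exact (h5.and h6).imp fun h => lt_of_le_of_ne h.1 h.2
    · intro x hx hx'
      have hnd : D.Nodup := H.right.imp ne_of_lt
      rw [hnd.mem_erase_iff] at hx'
      rw [List.mem_orderedInsert] at hx
      exact hdisj x (hx.resolve_left hx'.1) hx'.2
    · rw [hpath]
      by_cases hk : k ≤ d
      · rw [raise_of_le hk]
        exact h4 k hk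
      · rw [raise_of_lt (by omega), hcons2 k (by omega)]
        have := H.nonneg k
        omega
    · have hnd : D.Nodup := H.right.imp ne_of_lt
      rw [hnd.mem_erase_iff, List.mem_orderedInsert]
      by_cases hxd : x = d
      · subst hxd
        simp [hdD]
      · simp [hxd]
    · have h5 := arc_raise_iff (p := p) (q := q) (fun k => (H.step_le k).2) houter harc
      -- The slide changes the path twice: the down step `d` is raised, and the up step `m` is
      -- deleted. Each change loses the arc `(m, d)` and nothing else.
      have h6 : Arc (pathOf (C.orderedInsert (· ≤ ·) d) (D.erase d)) p q ↔
          p ≠ m ∧ Arc (raise (pathOf (m :: C) D) d) p q := by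
        rw [hpath]
        refine arc_shift (fun k hk => ?_) (fun k hk => ?_) ?_ (fun k hk => ?_)
        · rw [raise_of_le (by omega), hcons1 k hk]
        · rw [raise_of_le (by omega), hz k (by omega)]
        · rw [raise_of_le (by omega), hz _ le_rfl]
        · unfold raise
          rw [hcons2 k hk]
          split_ifs <;> ring
      rw [h6, h5]
      constructor
      · rintro ⟨h7, h8, -⟩
        exact ⟨h7, h8⟩
      · rintro ⟨h7, h8⟩
        refine ⟨h7, h8, ?_⟩
        rintro rfl
        exact h7 (h8.left_unique harc)

theorem arc_filter_iff {C D : List ℕ} (H : Ballot C D) {z p q : ℕ} :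
    Arc (pathOf (C.filter (· < z)) (D.filter (· < z))) p q ↔ q < z ∧ Arc (pathOf C D) p q := by
  have key : ∀ k, k ≤ z → pathOf (C.filter (· < z)) (D.filter (· < z)) k = pathOf C D k := by
    intro k hk
    rw [pathOf_filter, min_eq_left hk]
  constructor
  · intro h
    have hq : q < z := by simpa using List.of_mem_filter (h.right_mem (H.filter z))
    obtain ⟨h1, h2, h3⟩ := h
    rw [key _ (by omega), key _ (by omega)] at h2
    refine ⟨hq, h1, h2, fun k hk hkq => ?_⟩
    have := h3 k hk hkq
    rwa [key _ (by omega), key _ (by omega)] at this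
  · rintro ⟨hq, h1, h2, h3⟩
    refine ⟨h1, by rwa [key _ (by omega), key _ (by omega)], fun k hk hkq => ?_⟩
    rw [key _ (by omega), key _ (by omega)]
    exact h3 k hk hkq

/-- The induction on `i` removes one smallest entry at a time; what survives are the arcs lying in
`[i + 1, j]`. -/
theorem TwoCol.foldl_jdtRemove {n : ℕ} {C D : List ℕ} (H : TwoCol n C D) {i j : ℕ} (hi : i ≤ j)
    (hj : j ≤ n) :
    ∃ C' D', (List.range' 1 i).foldl jdtRemove
        (tab (C.filter (· < j + 1)) (D.filter (· < j + 1))) = tab C' D' ∧ Ballot C' D' ∧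
      (∀ x, (x ∈ C' ∨ x ∈ D') ↔ (i + 1 ≤ x ∧ x ≤ j)) ∧
      ∀ p q, Arc (pathOf C' D') p q ↔ i + 1 ≤ p ∧ q ≤ j ∧ Arc (pathOf C D) p q := by
  induction i with
  | zero =>
    refine ⟨_, _, rfl, H.toBallot.filter _, fun x => ?_, fun p q => ?_⟩
    · simp only [List.mem_filter, decide_eq_true_eq, ← or_and_right, H.mem_iff]
      omega
    · rw [arc_filter_iff H.toBallot, Nat.lt_succ_iff]
      constructor
      · rintro ⟨h1, h2⟩
        exact ⟨(H.isPath.arc_mem h2).1, h1, h2⟩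
      · rintro ⟨-, h⟩
        exact h
  | succ i ih =>
    obtain ⟨C', D', h1, h2, h3, h4⟩ := ih (by omega)
    -- The smallest remaining entry cannot be the right end of an arc.
    have hmem : i + 1 ∈ C' := by
      rcases (h3 (i + 1)).2 (by omega) with h | h
      · exact h
      · obtain ⟨a, ha⟩ := h2.exists_arc h
        have := (h3 a).1 (.inl (ha.left_mem h2))
        have := ha.1
        omega
    obtain ⟨C'', rfl⟩ : ∃ C'', C' = (i + 1) :: C'' := by
      rcases C' with _ | ⟨c, C''⟩
      · simp at hmem
      · have := (h3 c).1 (by simp)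
        rcases List.mem_cons.1 hmem with h | h
        · exact ⟨C'', by rw [h]⟩
        · have := (List.pairwise_cons.1 h2.left).1 _ h
          omega
    obtain ⟨E, F, h5, h6, h7, h8⟩ := jdtRemove_min h2
    refine ⟨E, F, ?_, h6, fun x => ?_, fun p q => ?_⟩
    · rw [List.range'_concat, List.foldl_append, h1]
      simpa [add_comm] using h5
    · have h9 := h3 x
      have h10 : x = i + 1 → ¬ (x ∈ C'' ∨ x ∈ D') := by
        rintro rfl (h | h)
        · have := (List.pairwise_cons.1 h2.left).1 _ h
          omega
        · exact h2.disj _ (by simp) h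
      rw [h7]
      by_cases hx : x = i + 1
      · have := h10 hx
        simp only [this, false_iff]
        omega
      · simp only [List.mem_cons, hx, false_or] at h9
        rw [h9]
        omega
    · rw [h8, h4]
      constructor
      · rintro ⟨h9, h10, h11⟩
        exact ⟨by omega, h11⟩
      · rintro ⟨h9, h10⟩
        exact ⟨by omega, by omega, h10⟩

/-- Each entry of the second column is the right end of exactly one arc, so its length counts the
arcs inside `[i, j]`. The total size being fixed, this determines the shape. -/
theorem TwoCol.proj_eq {n : ℕ} {T : StdTableau n} {C D : List ℕ} (H : TwoCol n C D)
    (hT : T.cols = tab C D) {i j : ℕ} (hi : 1 ≤ i) (hij : i ≤ j) (hj : j ≤ n) :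
    ∃ C' D', proj i j T = tab C' D' ∧ Ballot C' D' ∧ C'.length + D'.length = j + 1 - i ∧
      D'.length = (arcEnds (pathOf C D) i j).card := by
  obtain ⟨C', D', h1, h2, h3, h4⟩ := H.foldl_jdtRemove (i := i - 1) (j := j) (by omega) hj
  rw [Nat.sub_add_cancel hi] at h3 h4
  have hC' : C'.Nodup := h2.left.imp ne_of_lt
  have hD' : D'.Nodup := h2.right.imp ne_of_lt
  refine ⟨C', D', ?_, h2, ?_, ?_⟩
  · rw [proj, List.foldl_append, hT, H.foldl_jdtRemove_max (n - j) j (by omega), h1]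
  · have : C'.toFinset ∪ D'.toFinset = Finset.Icc i j := by
      ext x
      simp [h3]
    rw [← List.toFinset_card_of_nodup hC', ← List.toFinset_card_of_nodup hD',
      ← Finset.card_union_of_disjoint, this, Nat.card_Icc]
    rw [Finset.disjoint_left]
    simpa using h2.disj
  · rw [← List.toFinset_card_of_nodup hD']
    congr 1
    ext x
    rw [List.mem_toFinset, mem_arcEnds]
    constructor
    · intro hx
      obtain ⟨a, ha⟩ := h2.exists_arc hx
      have := (h4 a x).1 ha
      exact ⟨this.2.1, a, this.1, this.2.2⟩
    · rintro ⟨hx, a, ha, hax⟩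
      exact ((h4 a x).2 ⟨ha, hx, hax⟩).right_mem h2

/-- With at most two columns and equal size, only the first partial sum matters; a longer first
column means a shorter second one. -/
theorem dominanceLE_shape_tab {C D C' D' : List ℕ} (H : Ballot C D) (H' : Ballot C' D')
    (hl : C.length + D.length = C'.length + D'.length) :
    dominanceLE (shape (tab C D)) (shape (tab C' D')) ↔ D'.length ≤ D.length := by
  have key : ∀ {C D : List ℕ}, Ballot C D →
      ((shape (tab C D)).take 0).sum = 0 ∧ ((shape (tab C D)).take 1).sum = C.length ∧
      ∀ i, ((shape (tab C D)).take (i + 2)).sum = C.length + D.length := by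
    intro C D H
    rcases C with _ | ⟨c, C⟩
    · rw [H.right_nil rfl]
      simp [tab_nil_nil, shape]
    · rcases D with _ | ⟨d, D⟩
      · simp [tab_cons_nil, shape]
      · simp [tab_cons_cons, shape]
  obtain ⟨h1, h2, h3⟩ := key H
  obtain ⟨h1', h2', h3'⟩ := key H'
  constructor
  · intro h
    have := h 1
    omega
  · rintro h (_ | _ | i)
    · omega
    · rw [zero_add]
      omega
    · exact ((h3 i).trans (hl.trans (h3' i).symm)).le

theorem chainLE_iff {n : ℕ} {T S : StdTableau n} {C D C' D' : List ℕ} (H : TwoCol n C D)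
    (hT : T.cols = tab C D) (H' : TwoCol n C' D') (hS : S.cols = tab C' D') :
    chainLE T S ↔ ∀ i j, 1 ≤ i → i < j → j ≤ n →
      (arcEnds (pathOf C' D') i j).card ≤ (arcEnds (pathOf C D) i j).card := by
  refine forall_congr' fun i => forall_congr' fun j => forall_congr' fun h1 =>
    forall_congr' fun h2 => forall_congr' fun h3 => ?_
  obtain ⟨E, F, h4, h5, h6, h7⟩ := H.proj_eq hT h1 h2.le h3
  obtain ⟨E', F', h4', h5', h6', h7'⟩ := H'.proj_eq hS h1 h2.le h3
  rw [h4, h4', dominanceLE_shape_tab h5 h5' (by omega), h7, h7']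

theorem card_arcEnds_mono {h g : ℕ → ℤ} (hsub : ∀ a b, Arc g a b → Arc h a b) (i j : ℕ) :
    (arcEnds g i j).card ≤ (arcEnds h i j).card := by
  refine Finset.card_le_card fun b hb => ?_
  obtain ⟨h1, a, h2, h3⟩ := mem_arcEnds.1 hb
  exact mem_arcEnds.2 ⟨h1, a, h2, hsub a b h3⟩

end YoungOrder

namespace YoungOrder

/-! ### Reverse insertion on tableaux with two columns -/

theorem flatten_tab (C D : List ℕ) : (tab C D).flatten = C ++ D := by
  rcases C with _ | ⟨c, C⟩ <;> rcases D with _ | ⟨d, D⟩ <;> simp [tab, dropEmpty]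

theorem tab_of_ne_nil {C D : List ℕ} (hC : C ≠ []) (hD : D ≠ []) : tab C D = [C, D] := by
  simp [tab, dropEmpty, hC, hD]

theorem foldr_max_lt {l : List ℕ} {x : ℕ} (hx : 0 < x) (h : ∀ y ∈ l, y < x) :
    l.foldr max 0 < x := by
  induction l with
  | nil => simpa
  | cons a l ih =>
    rw [List.foldr_cons, max_lt_iff]
    exact ⟨h a (by simp), ih fun y hy => h y (by simp [hy])⟩

theorem le_foldr_max {l : List ℕ} {y : ℕ} (h : y ∈ l) : y ≤ l.foldr max 0 := by
  induction l with
  | nil => simp at h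
  | cons a l ih =>
    rw [List.foldr_cons]
    rcases List.mem_cons.1 h with rfl | h
    · exact le_max_left _ _
    · exact (ih h).trans (le_max_right _ _)

theorem maxEntry_tab {C D : List ℕ} {z : ℕ} (hz : z ∈ C ∨ z ∈ D) (hC : ∀ x ∈ C, x ≤ z)
    (hD : ∀ x ∈ D, x ≤ z) : maxEntry (tab C D) = z := by
  rw [maxEntry, flatten_tab]
  refine le_antisymm (Nat.lt_succ_iff.1 (foldr_max_lt (by omega) fun y hy => ?_))
    (le_foldr_max (List.mem_append.2 hz))
  rcases List.mem_append.1 hy with h | h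
  · exact Nat.lt_succ_iff.2 (hC y h)
  · exact Nat.lt_succ_iff.2 (hD y h)

theorem deleteMax_left {C D : List ℕ} {z : ℕ} (hC : ∀ x ∈ C, x < z) (hD : ∀ x ∈ D, x < z) :
    deleteMax (tab (C ++ [z]) D) = tab C D := by
  have hm : maxEntry (tab (C ++ [z]) D) = z := maxEntry_tab (by simp)
    (fun x hx => by
      rcases List.mem_append.1 hx with h | h
      · exact (hC x h).le
      · simp at h
        omega) fun x hx => (hD x hx).le
  have hz : z ∉ C := fun h => (hC z h).false
  have htab : tab (C ++ [z]) D = (C ++ [z]) :: dropEmpty [D] := by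
    simp [tab, dropEmpty]
  rw [deleteMax, hm, htab, deleteAux, if_pos (by simp), List.erase_append_right _ hz]
  simpa using dropEmpty_cons_dropEmpty C D

/-- As `u` is the last entry of the first column and all entries there are below `z`, it is the one
replaced. The entry `z` is then the corner of the first column, which is why an entry of the second
column takes two deletions to disappear. -/
theorem deleteMax_right {C D : List ℕ} {u z : ℕ} (hC : ∀ x ∈ C, x < z) (hu : u < z)
    (hD : ∀ x ∈ D, x < z) : deleteMax (tab (C ++ [u]) (D ++ [z])) = tab (C ++ [z]) D := by
  have hCu : ∀ x ∈ C ++ [u], x < z := fun x hx => by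
    rcases List.mem_append.1 hx with h | h
    · exact hC x h
    · simp at h
      omega
  have hm : maxEntry (tab (C ++ [u]) (D ++ [z])) = z := maxEntry_tab (by simp)
    (fun x hx => (hCu x hx).le) fun x hx => by
      rcases List.mem_append.1 hx with h | h
      · exact (hD x h).le
      · simp at h
        omega
  have hz : z ∉ C ++ [u] := fun h => (hCu z h).false
  have hzD : z ∉ D := fun h => (hD z h).false
  rw [deleteMax, hm, tab_of_ne_nil (by simp) (by simp), deleteAux, if_neg hz, deleteAux,
    if_pos (by simp), List.erase_append_right _ hzD]
  simp only [colPush, filter_lt_eq_self hCu]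
  simp [tab]

theorem deleteAux_lt {T : List (List ℕ)} {x z : ℕ} (hz : z < x) (hT : ∀ C ∈ T, ∀ y ∈ C, y < x) :
    (∀ C ∈ (deleteAux z T).1, ∀ y ∈ C, y < x) ∧ (deleteAux z T).2 < x := by
  induction T with
  | nil => simpa [deleteAux] using hz
  | cons C T ih =>
    have hC := hT C (by simp)
    have hT' : ∀ C ∈ T, ∀ y ∈ C, y < x := fun E hE => hT E (by simp [hE])
    obtain ⟨h1, h2⟩ := ih hT'
    rw [deleteAux]
    split_ifs with h
    · refine ⟨fun E hE y hy => ?_, hz⟩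
      rcases List.mem_cons.1 hE with rfl | hE
      · exact hC y (List.mem_of_mem_erase hy)
      · exact hT' E hE y hy
    · refine ⟨fun E hE y hy => ?_, ?_⟩
      · rcases List.mem_cons.1 hE with rfl | hE
        · rcases List.mem_or_eq_of_mem_set hy with h | rfl
          · exact hC y h
          · exact h2
        · exact h1 E hE y hy
      · simp only [colPush]
        generalize (C.filter (· < (deleteAux z T).2)).length - 1 = i
        rw [List.getD_eq_getElem?_getD]
        rcases hi : C[i]? with _ | y
        · simp
          omega
        · exact hC y (List.mem_of_getElem? hi)

theorem maxEntry_lt {T : List (List ℕ)} {x : ℕ} (hx : 0 < x) (hT : ∀ C ∈ T, ∀ y ∈ C, y < x) :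
    maxEntry T < x := by
  refine foldr_max_lt hx fun y hy => ?_
  obtain ⟨C, hC, hy⟩ := List.mem_flatten.1 hy
  exact hT C hC y hy

theorem iterate_deleteMax_lt {T : List (List ℕ)} {x : ℕ} (hx : 0 < x)
    (hT : ∀ C ∈ T, ∀ y ∈ C, y < x) (m : ℕ) : ∀ C ∈ deleteMax^[m] T, ∀ y ∈ C, y < x := by
  induction m with
  | zero => exact hT
  | succ m ih =>
    rw [Function.iterate_succ_apply']
    intro C hC
    exact (deleteAux_lt (maxEntry_lt hx ih) ih).1 C (List.mem_of_mem_filter hC)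

theorem filter_lt_eq_take {C : List ℕ} (hC : C.Pairwise (· < ·)) (k : ℕ) :
    C.filter (· < k) = C.take (C.countP (· < k)) := by
  induction C with
  | nil => simp
  | cons c C ih =>
    rw [List.pairwise_cons] at hC
    by_cases h : c < k
    · rw [List.filter_cons_of_pos (by simpa), List.countP_cons_of_pos (by simpa), List.take_succ_cons,
        ih hC.2]
    · have h0 : C.countP (· < k) = 0 := countP_lt_eq_zero fun x hx => by
        have := hC.1 x hx
        omega
      rw [List.filter_cons_of_neg (by simpa using h), List.countP_cons_of_neg (by simpa using h), h0,
        ih hC.2, h0]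
      simp

theorem lt_of_mem_take {C : List ℕ} (hC : C.Pairwise (· < ·)) {c k : ℕ}
    (hc : c ≤ C.countP (· < k)) {x : ℕ} (hx : x ∈ C.take c) : x < k := by
  have h1 : x ∈ C.filter (· < k) := by
    rw [filter_lt_eq_take hC]
    exact List.take_subset_take_left C hc hx
  simpa using List.of_mem_filter h1

theorem filter_lt_succ {C : List ℕ} (hC : C.Pairwise (· < ·)) {z : ℕ} (hz : z ∈ C) :
    C.filter (· < z + 1) = C.filter (· < z) ++ [z] := by
  have h := filter_append_singleton_of_max (hC.filter (· < z + 1)) (z := z) (by simpa using hz)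
    (by simp)
  rw [← h, List.filter_filter]
  congr 2
  funext x
  simp
  omega

theorem filter_lt_succ_of_notMem {C : List ℕ} {z : ℕ} (hz : z ∉ C) :
    C.filter (· < z + 1) = C.filter (· < z) := by
  refine List.filter_congr fun x hx => ?_
  have : x ≠ z := fun e => hz (e ▸ hx)
  simp
  omega

theorem take_eq_append {C : List ℕ} {c : ℕ} (h1 : c + 1 ≤ C.length) :
    ∃ u, C.take (c + 1) = C.take c ++ [u] := by
  exact ⟨C[c], by rw [List.take_succ_eq_append_getElem (by omega)]⟩

/-- The stages of reverse insertion: after the entries greater than `z` have been dealt with, the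
first column is an initial part of the original one. -/
theorem TwoCol.iterate_deleteMax {n : ℕ} {C D : List ℕ} (H : TwoCol n C D) (l z : ℕ)
    (hz : z + l = n) :
    ∃ c, c ≤ C.countP (· < z + 1) ∧
      deleteMax^[n - (c + D.countP (· < z + 1))] (tab C D) =
        tab (C.take c) (D.filter (· < z + 1)) ∧
      (∀ k, z < k → (c : ℤ) - D.countP (· < z + 1) ≤ pathOf C D k) ∧
      ∃ k, z < k ∧ (c : ℤ) - D.countP (· < z + 1) = pathOf C D k := by
  -- The invariant is that `c` minus the number of entries up to `z` in the second column equals the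
  -- minimum of the path at positions beyond `z`.
  induction l generalizing z with
  | zero =>
    obtain rfl : z = n := by omega
    have hC : ∀ k, z < k → ∀ x ∈ C, x < k := fun k hk x hx => by
      have := (H.mem_iff.1 (.inl hx)).2
      omega
    have hD : ∀ k, z < k → ∀ x ∈ D, x < k := fun k hk x hx => by
      have := (H.mem_iff.1 (.inr hx)).2
      omega
    have hC' : ∀ k, z < k → C.countP (· < k) = C.length := fun k hk =>
      List.countP_eq_length.2 (by simpa using hC k hk)
    have hD' : ∀ k, z < k → D.countP (· < k) = D.length := fun k hk =>
      List.countP_eq_length.2 (by simpa using hD k hk)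
    have hl := H.perm.length_eq
    rw [List.length_append, List.length_range'] at hl
    have hp : ∀ k, z < k → pathOf C D k = C.length - D.length := fun k hk => by
      rw [pathOf, hC' k hk, hD' k hk]
    have hz1 : z < z + 1 := by omega
    refine ⟨C.length, (hC' _ hz1).ge, ?_, fun k hk => ?_, z + 1, hz1, ?_⟩
    · rw [hD' _ hz1, hl, Nat.sub_self, List.take_length, filter_lt_eq_self (hD _ hz1)]
      rfl
    · rw [hp k hk, hD' _ hz1]
    · rw [hp _ hz1, hD' _ hz1]
  | succ l ih =>
    obtain ⟨c, h1, h2, h3, h4⟩ := ih (z + 1) (by omega)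
    have hl := H.perm.length_eq
    rw [List.length_append, List.length_range'] at hl
    have hCl : C.countP (· < z + 1 + 1) ≤ C.length := List.countP_le_length
    have hDl : D.countP (· < z + 1 + 1) ≤ D.length := List.countP_le_length
    have hc := countP_lt_succ C (z + 1)
    have hd := countP_lt_succ D (z + 1)
    have hp := pathOf_succ C D (z + 1)
    have hh := H.toBallot.count_left (z + 1)
    have hh' := H.toBallot.count_right (z + 1)
    have hpz : pathOf C D (z + 1) = C.countP (· < z + 1) - D.countP (· < z + 1) := rfl
    obtain ⟨k, hk1, hk2⟩ := h4
    have hk0 := H.nonneg k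
    have h5 := h3 (z + 1 + 1) (by omega)
    -- A second-column entry uses two stages and takes one entry of the first column with it. The
    -- difference is unchanged, and so is the minimum, since the new position is higher than the
    -- next one.
    by_cases hzD : z + 1 ∈ D
    · have hzC : z + 1 ∉ C := fun h => H.disj _ h hzD
      rw [if_neg hzC] at hh
      rw [if_pos hzD] at hh'
      obtain ⟨c, rfl⟩ : ∃ c', c = c' + 1 := ⟨c - 1, by omega⟩
      obtain ⟨u, hu⟩ := take_eq_append (C := C) (c := c) (by omega)
      have hCz : ∀ x ∈ C.take c ++ [u], x < z + 1 := fun x hx => by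
        rw [← hu] at hx
        exact lt_of_mem_take H.left (by omega) hx
      refine ⟨c, by omega, ?_, fun k' hk' => ?_, k, by omega, ?_⟩
      · rw [show n - (c + D.countP (· < z + 1)) = 2 + (n - (c + 1 + D.countP (· < z + 1 + 1))) by
          omega, Function.iterate_add_apply, h2, hu, filter_lt_succ H.right hzD]
        rw [Function.iterate_succ_apply, Function.iterate_one,
          deleteMax_right (fun x hx => hCz x (by simp [hx])) (hCz u (by simp)) (by simp),
          deleteMax_left (fun x hx => hCz x (by simp [hx])) (by simp)]
      · by_cases hkz : k' = z + 1
        · subst hkz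
          push_cast at *
          omega
        · have := h3 k' (by omega)
          push_cast at *
          omega
      · push_cast at *
        omega
    · have hzC : z + 1 ∈ C := (H.mem_iff.2 (by omega : 1 ≤ z + 1 ∧ z + 1 ≤ n)).resolve_right hzD
      rw [if_pos hzC] at hh
      rw [if_neg hzD] at hh'
      -- A first-column entry is either still present, and then its removal takes one stage and the
      -- new position attains the minimum, or it was pushed out earlier, and then no stage is spent.
      by_cases hcz : c = C.countP (· < z + 1 + 1)
      · obtain ⟨c, rfl⟩ : ∃ c', c = c' + 1 := ⟨c - 1, by omega⟩
        have hcc : c = C.countP (· < z + 1) := by omega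
        refine ⟨c, by omega, ?_, fun k' hk' => ?_, z + 1, by omega, by omega⟩
        · rw [show n - (c + D.countP (· < z + 1)) = 1 + (n - (c + 1 + D.countP (· < z + 1 + 1))) by
            omega, Function.iterate_add_apply, h2, hcz, ← filter_lt_eq_take H.left,
            filter_lt_succ H.left hzC, filter_lt_succ_of_notMem hzD, Function.iterate_one,
            deleteMax_left (by simp) (by simp), filter_lt_eq_take H.left, hcc]
        · by_cases hkz : k' = z + 1
          · subst hkz
            omega
          · have := h3 k' (by omega)
            push_cast at *
            omega
      · refine ⟨c, by omega, ?_, fun k' hk' => ?_, k, by omega, by omega⟩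
        · rw [← filter_lt_succ_of_notMem hzD, ← h2]
          congr 3
          omega
        · by_cases hkz : k' = z + 1
          · subst hkz
            omega
          · have := h3 k' (by omega)
            omega

/-- Both tableaux have the same second column, the entries of `D` up to `x`. Their first columns are
initial parts of `C`, of lengths given by the height after `x` for the projection and by the minimum
of the path beyond `x` for `T{x}`. They agree exactly when that minimum is attained right after `x`.
-/
theorem proj_eq_brace_iff {n : ℕ} {T : StdTableau n} {C D : List ℕ} (H : TwoCol n C D)
    (hT : T.cols = tab C D) {x : ℕ} (hx : x ∈ D) :
    proj 1 x T = brace T x ↔ Outer (pathOf C D) x := by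
  have hxn := H.mem_iff.1 (.inr hx)
  have hxC : x ∉ C := fun h => H.disj x h hx
  obtain ⟨c, h1, h2, h3, k, hk1, hk2⟩ := H.iterate_deleteMax (n - x) x (by omega)
  have hl := H.perm.length_eq
  rw [List.length_append, List.length_range'] at hl
  have hCl : C.countP (· < x + 1) ≤ C.length := List.countP_le_length
  have hDl : D.countP (· < x + 1) ≤ D.length := List.countP_le_length
  have hd := countP_lt_succ D x
  rw [H.count_right, if_pos hx] at hd
  have hk0 := H.nonneg k
  -- `D` contributes `x` itself and the difference is a height of the path, hence nonnegative; so
  -- `c` is positive.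
  obtain ⟨c, rfl⟩ : ∃ c', c = c' + 1 := ⟨c - 1, by omega⟩
  obtain ⟨u, hu⟩ := take_eq_append (C := C) (c := c) (by omega)
  have hCx : ∀ y ∈ C.take c ++ [u], y < x := fun y hy => by
    rw [← hu] at hy
    refine lt_of_mem_take H.left (h1.trans ?_) hy
    rw [countP_lt_succ, H.count_left, if_neg hxC, add_zero]
  set d := D.countP (· < x + 1)
  have hst : ∀ m, m ≤ c + 1 + d → stage T (c + 1 + d - m) =
      deleteMax^[m] (tab (C.take (c + 1)) (D.filter (· < x + 1))) := by
    intro m hm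
    rw [stage, hT, ← h2, ← Function.iterate_add_apply]
    congr 1
    omega
  have hs0 := hst 0 (by omega)
  rw [Nat.sub_zero, Function.iterate_zero, id_eq] at hs0
  have hs1 := hst 1 (by omega)
  rw [Function.iterate_one, hu, filter_lt_succ H.right hx,
    deleteMax_right (fun y hy => hCx y (by simp [hy])) (hCx u (by simp)) (by simp)] at hs1
  have hbrace : brace T x = stage T (c + 1 + d) := by
    have hfind : (List.range' 2 (n - 1)).find?
        (fun i => maxEntry (stage T i) = x ∧ maxEntry (stage T (i - 1)) = x) =
          some (c + 1 + d) := by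
      rw [List.find?_range'_eq_some]
      refine ⟨?_, ?_, fun j hj1 hj2 => ?_⟩
      · rw [decide_eq_true_eq]
        constructor
        · rw [hs0]
          refine maxEntry_tab (by simp [hx]) (fun y hy => ?_) (by simp)
          rw [hu] at hy
          exact (hCx y hy).le
        · rw [hs1]
          refine maxEntry_tab (by simp) (fun y hy => ?_) (fun y hy => ?_)
          · rcases List.mem_append.1 hy with h | h
            · exact (hCx y (by simp [h])).le
            · simp at h
              omega
          · simp at hy
            omega
      · rw [List.mem_range'_1]
        omega
      -- Two deletions after stage `c + 1 + d` the entry `x` is gone and all entries are smaller,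
      -- which persists; hence `find?` meets no earlier index.
      · have h5 : maxEntry (stage T (j - 1)) < x := by
          obtain ⟨m, hm⟩ : ∃ m, j - 1 = c + 1 + d - (m + 2) := ⟨c + 1 + d - 2 - (j - 1), by omega⟩
          rw [hm, hst _ (by omega), Function.iterate_add_apply]
          refine maxEntry_lt (by omega) (iterate_deleteMax_lt (by omega) ?_ m)
          rw [Function.iterate_succ_apply, Function.iterate_one, hu, filter_lt_succ H.right hx,
            deleteMax_right (fun y hy => hCx y (by simp [hy])) (hCx u (by simp)) (by simp),
            deleteMax_left (fun y hy => hCx y (by simp [hy])) (by simp)]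
          intro E hE y hy
          have : y ∈ (tab (C.take c) (D.filter (· < x))).flatten := List.mem_flatten.2 ⟨E, hE, hy⟩
          rw [flatten_tab, List.mem_append] at this
          rcases this with h | h
          · exact hCx y (by simp [h])
          · simp at h
            exact h.2
        simp [h5.ne]
    rw [brace, hfind]
  rw [hbrace, hs0, proj, List.foldl_append, hT, H.foldl_jdtRemove_max (n - x) x (by omega)]
  have hDne : D.filter (· < x + 1) ≠ [] := fun h => by
    have : x ∈ D.filter (· < x + 1) := by simp [hx]
    rw [h] at this
    simp at this
  have hpx : pathOf C D (x + 1) = C.countP (· < x + 1) - d := rfl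
  have hlen : (C.filter (· < x + 1)).length = C.countP (· < x + 1) := by
    rw [List.countP_eq_length_filter]
  have hCne : C.filter (· < x + 1) ≠ [] := fun h => by
    rw [h] at hlen
    simp only [List.length_nil] at hlen
    omega
  have hiff : tab (C.filter (· < x + 1)) (D.filter (· < x + 1)) =
      tab (C.take (c + 1)) (D.filter (· < x + 1)) ↔ c + 1 = C.countP (· < x + 1) := by
    rw [tab_of_ne_nil hCne hDne, tab_of_ne_nil (by simp [hu]) hDne]
    constructor
    · intro h
      rw [List.cons.injEq] at h
      rw [← hlen, h.1, List.length_take]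
      omega
    · intro h
      rw [h, filter_lt_eq_take H.left]
  have hfold : ∀ l : List (List ℕ), (List.range' 1 (1 - 1)).foldl jdtRemove l = l := fun l => rfl
  rw [hfold, hiff]
  constructor
  · intro h
    refine ⟨H.down_iff.2 hx, fun k' hk' => ?_⟩
    have := h3 k' hk'
    push_cast at *
    omega
  · rintro ⟨-, h⟩
    have := h k hk1
    push_cast at *
    omega

end YoungOrder

namespace YoungOrder

/-! ### Words and permutations -/

theorem word_perm {n : ℕ} (w : Equiv.Perm (Fin n)) : (word w).Perm (List.range' 1 n) := by
  have hnd : (word w).Nodup := by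
    rw [word, List.nodup_ofFn]
    intro a b hab
    simp only [Nat.add_right_cancel_iff] at hab
    exact w.injective (Fin.ext hab)
  refine (List.perm_ext_iff_of_nodup hnd List.nodup_range').2 fun a => ?_
  rw [word, List.mem_ofFn', Set.mem_range, List.mem_range'_1]
  constructor
  · rintro ⟨k, rfl⟩
    have := (w k).2
    omega
  · rintro ⟨h1, h2⟩
    refine ⟨w.symm ⟨a - 1, by omega⟩, ?_⟩
    simp
    omega

theorem exists_word {n : ℕ} {l : List ℕ} (hl : l.Perm (List.range' 1 n)) :
    ∃ w : Equiv.Perm (Fin n), word w = l := by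
  have hlen : l.length = n := by simpa using hl.length_eq
  have hnd : l.Nodup := hl.nodup_iff.2 List.nodup_range'
  have hmem : ∀ k (hk : k < l.length), 1 ≤ l[k] ∧ l[k] ≤ n := fun k hk => by
    have := hl.mem_iff.1 (List.getElem_mem hk)
    rw [List.mem_range'_1] at this
    omega
  let f : Fin n → Fin n := fun k => ⟨l[(k : ℕ)]'(by omega) - 1, by
    have := hmem k (by omega)
    omega⟩
  have hf : Function.Injective f := by
    intro a b hab
    have ha := hmem a (by omega)
    have hb := hmem b (by omega)
    have : l[(a : ℕ)]'(by omega) = l[(b : ℕ)]'(by omega) := by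
      have : l[(a : ℕ)]'(by omega) - 1 = l[(b : ℕ)]'(by omega) - 1 := congrArg Fin.val hab
      omega
    exact Fin.ext ((hnd.getElem_inj_iff).1 this)
  refine ⟨Equiv.ofBijective f (Finite.injective_iff_bijective.1 hf), ?_⟩
  refine List.ext_getElem (by simp [word, hlen]) fun k h1 h2 => ?_
  have := hmem k h2
  simp [word, f]
  omega

theorem idxOf_word {n : ℕ} (w : Equiv.Perm (Fin n)) (i : Fin n) :
    (word w).idxOf ((i : ℕ) + 1) = w.symm i := by
  have hnd : (word w).Nodup := (word_perm w).nodup_iff.2 List.nodup_range'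
  have hlt : (w.symm i : ℕ) < (word w).length := by
    simp [word]
  have h := hnd.idxOf_getElem (w.symm i : ℕ) hlt
  have : (word w)[(w.symm i : ℕ)] = (i : ℕ) + 1 := by
    simp [word]
  rwa [this] at h

/-- How positions change when a letter `x` is moved to the left past the letters of `A`. -/
theorem idxOf_move {P A Q : List ℕ} {x : ℕ} (hnd : (P ++ A ++ x :: Q).Nodup) :
    ((P ++ A ++ x :: Q).idxOf x = P.length + A.length ∧
      (P ++ x :: A ++ Q).idxOf x = P.length) ∧
    ∀ t, t ≠ x → ((P ++ A ++ x :: Q).idxOf t < P.length ∧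
        (P ++ x :: A ++ Q).idxOf t = (P ++ A ++ x :: Q).idxOf t) ∨
      (t ∈ A ∧ P.length ≤ (P ++ A ++ x :: Q).idxOf t ∧
        (P ++ A ++ x :: Q).idxOf t < P.length + A.length ∧
        (P ++ x :: A ++ Q).idxOf t = (P ++ A ++ x :: Q).idxOf t + 1) ∨
      (P.length + A.length < (P ++ A ++ x :: Q).idxOf t ∧
        (P ++ x :: A ++ Q).idxOf t = (P ++ A ++ x :: Q).idxOf t) := by
  have hx : x ∉ P ++ A := by
    rw [List.nodup_append] at hnd
    exact fun h => hnd.2.2 x h x (by simp) rfl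
  have hxP : x ∉ P := fun h => hx (by simp [h])
  refine ⟨⟨?_, ?_⟩, fun t ht => ?_⟩
  · rw [List.idxOf_append_of_notMem hx, List.idxOf_cons_self]
    simp
  · rw [List.append_assoc]
    exact (List.idxOf_append_of_notMem hxP).trans (by simp)
  · simp only [List.idxOf_append, List.mem_append, List.idxOf_cons_ne _ ht.symm, List.mem_cons, ht,
      false_or, List.length_append, List.length_cons]
    by_cases h1 : t ∈ P
    · have := List.idxOf_lt_length_of_mem h1
      simp [h1, this]
    · by_cases h2 : t ∈ A
      · have := List.idxOf_lt_length_of_mem h2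
        right
        left
        simp [h1, h2]
        omega
      · right
        right
        simp [h1, h2]
        omega

/-- Only the pairs formed by `x` and a letter of `A` change their order, and they become inversions
because `x` is the larger letter. -/
theorem weakLE_of_move {n : ℕ} {w y : Equiv.Perm (Fin n)} {P A Q : List ℕ} {x : ℕ}
    (hw : word w = P ++ A ++ x :: Q) (hy : word y = P ++ x :: A ++ Q) (hx : ∀ t ∈ A, t < x) :
    weakLE w y := by
  have hnd : (P ++ A ++ x :: Q).Nodup := by
    rw [← hw]
    exact (word_perm w).nodup_iff.2 List.nodup_range'
  intro i j hij hji
  rw [Fin.lt_def] at hij hji ⊢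
  rw [← idxOf_word, ← idxOf_word, hw] at hji
  rw [← idxOf_word, ← idxOf_word, hy]
  obtain ⟨⟨h1, h2⟩, h3⟩ := idxOf_move hnd
  by_cases hix : (i : ℕ) + 1 = x
  · have h4 := h3 ((j : ℕ) + 1) (by omega)
    rw [hix] at hji ⊢
    rcases h4 with h4 | h4 | h4
    · omega
    · have := hx _ h4.1
      omega
    · omega
  · have h4 := h3 ((i : ℕ) + 1) hix
    by_cases hjx : (j : ℕ) + 1 = x
    · rw [hjx] at hji ⊢
      omega
    · have h5 := h3 ((j : ℕ) + 1) hjx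
      omega

/-! ### Column insertion -/

theorem colInsert_of_lt {C : List ℕ} {j : ℕ} (h : ∀ x ∈ C, x < j) :
    colInsert j C = (C ++ [j], none) := by
  induction C with
  | nil => rfl
  | cons c C ih =>
    have := h c (by simp)
    rw [colInsert, if_neg (by omega), ih fun x hx => h x (by simp [hx])]
    rfl

theorem colInsert_bump {L Q : List ℕ} {j q : ℕ} (h : ∀ x ∈ L, x < j) (hq : j < q) :
    colInsert j (L ++ q :: Q) = (L ++ j :: Q, some q) := by
  induction L with
  | nil => simp [colInsert, hq]
  | cons c L ih =>
    have := h c (by simp)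
    rw [List.cons_append, colInsert, if_neg (by omega), ih fun x hx => h x (by simp [hx])]
    rfl

theorem tabInsert_of_lt {C D : List ℕ} {j : ℕ} (h : ∀ x ∈ C, x < j) (hCD : C = [] → D = []) :
    tabInsert j (tab C D) = tab (C ++ [j]) D := by
  rcases C with _ | ⟨c, C⟩
  · rw [hCD rfl]
    rfl
  · have h1 : tab (c :: C) D = (c :: C) :: dropEmpty [D] := by simp [tab, dropEmpty]
    have h2 : tab (c :: C ++ [j]) D = (c :: C ++ [j]) :: dropEmpty [D] := by simp [tab, dropEmpty]
    rw [h1, h2, tabInsert, colInsert_of_lt h]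

theorem tabInsert_bump {L Q D : List ℕ} {j q : ℕ} (h : ∀ x ∈ L, x < j) (hq : j < q)
    (hD : ∀ x ∈ D, x < q) :
    tabInsert j (tab (L ++ q :: Q) D) = tab (L ++ j :: Q) (D ++ [q]) := by
  have h1 : tab (L ++ q :: Q) D = (L ++ q :: Q) :: dropEmpty [D] := by simp [tab, dropEmpty]
  have h2 : tab (L ++ j :: Q) (D ++ [q]) = [L ++ j :: Q, D ++ [q]] := by simp [tab, dropEmpty]
  rw [h1, h2, tabInsert, colInsert_bump h hq]
  rcases D with _ | ⟨d, D⟩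
  · rfl
  · have : dropEmpty [d :: D] = [d :: D] := by simp [dropEmpty]
    simp only [this, tabInsert, colInsert_of_lt hD]

theorem foldr_tabInsert_column {C D R : List ℕ} (hR : R.Pairwise (· < ·))
    (hCR : ∀ x ∈ C, ∀ r ∈ R, x < r) (hCD : C = [] → D = []) :
    R.reverse.foldr tabInsert (tab C D) = tab (C ++ R) D := by
  induction R generalizing C with
  | nil => simp
  | cons r R ih =>
    rw [List.pairwise_cons] at hR
    rw [List.reverse_cons, List.foldr_append, List.foldr_cons, List.foldr_nil,
      tabInsert_of_lt (fun x hx => hCR x hx r (by simp)) hCD,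
      ih hR.2 (fun x hx r' hr' => ?_) (by simp), List.append_assoc, List.singleton_append]
    rcases List.mem_append.1 hx with h | h
    · exact hCR x h r' (by simp [hr'])
    · rw [List.mem_singleton.1 h]
      exact hR.1 r' hr'

/-- The right fold inserts the entries of `R` from the smallest on. Each one bumps the entry of `Q`
in its row, which is larger by the row condition and lands at the bottom of the second column. -/
theorem foldr_tabInsert_bump {L D R Q : List ℕ} (hR : R.Pairwise (· < ·))
    (hQ : Q.Pairwise (· < ·)) (hLR : ∀ x ∈ L, ∀ r ∈ R, x < r) (hDQ : ∀ x ∈ D, ∀ q ∈ Q, x < q)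
    (hl : Q.length ≤ R.length) (hz : ∀ p ∈ R.zip Q, p.1 < p.2) (hLD : L ++ Q = [] → D = []) :
    R.reverse.foldr tabInsert (tab (L ++ Q) D) = tab (L ++ R) (D ++ Q) := by
  induction R generalizing L D Q with
  | nil =>
    obtain rfl : Q = [] := by simpa using hl
    simp
  | cons r R ih =>
    rcases Q with _ | ⟨q, Q⟩
    · simpa using foldr_tabInsert_column (C := L ++ []) (D := D) hR (by simpa using hLR) hLD
    · have hR' := List.pairwise_cons.1 hR
      have hQ' := List.pairwise_cons.1 hQ
      have hrq : r < q := hz (r, q) (by simp)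
      rw [List.reverse_cons, List.foldr_append, List.foldr_cons, List.foldr_nil,
        tabInsert_bump (fun x hx => hLR x hx r (by simp)) hrq fun x hx => hDQ x hx q (by simp)]
      have := ih (L := L ++ [r]) (D := D ++ [q]) (Q := Q) hR'.2 hQ'.2 (fun x hx r' hr' => ?_)
        (fun x hx q' hq' => ?_) (by simpa using hl) (fun p hp => hz p (by simp [hp])) (by simp)
      · simpa using this
      · rcases List.mem_append.1 hx with h | h
        · exact hLR x h r' (by simp [hr'])
        · rw [List.mem_singleton.1 h]
          exact hR'.1 r' hr'
      · rcases List.mem_append.1 hx with h | h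
        · exact hDQ x h q' (by simp [hq'])
        · rw [List.mem_singleton.1 h]
          exact hQ'.1 q' hq'

/-- Insertion of a word that consists of a tableau with columns `R`, `Q` on the large letters,
followed by a tableau with columns `C`, `D` on the small letters. -/
theorem foldr_tabInsert_columns {C D R Q : List ℕ} (H : Ballot C D) (H' : Ballot R Q)
    (h : ∀ x, x ∈ C ∨ x ∈ D → ∀ r, r ∈ R ∨ r ∈ Q → x < r) :
    (R.reverse ++ Q.reverse ++ (C.reverse ++ D.reverse)).foldr tabInsert [] =
      tab (C ++ R) (D ++ Q) := by
  have h1 := foldr_tabInsert_column (C := []) (D := []) H.right (by simp) (by simp)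
  have h2 := foldr_tabInsert_bump (L := []) (D := []) (R := C) (Q := D) H.left H.right (by simp)
    (by simp) H.zip.1 H.zip.2 (by simp)
  have h3 := foldr_tabInsert_column (C := C) (D := D) H'.right
    (fun x hx r hr => h x (.inl hx) r (.inr hr)) H.right_nil
  have h4 := foldr_tabInsert_bump (L := C) (D := D) H'.left H'.right
    (fun x hx r hr => h x (.inl hx) r (.inl hr)) (fun x hx r hr => h x (.inr hx) r (.inr hr))
    H'.zip.1 H'.zip.2 (fun e => H.right_nil (List.append_eq_nil_iff.1 e).1)
  simp only [List.nil_append, tab_nil_nil] at h1 h2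
  rw [List.foldr_append, List.foldr_append, List.foldr_append, h1, h2, h3, h4]

theorem Ballot.foldr_tabInsert {C D : List ℕ} (H : Ballot C D) :
    (C.reverse ++ D.reverse).foldr tabInsert [] = tab C D := by
  have hnil : Ballot [] [] := ⟨by simp, by simp, by simp, by simp [pathOf]⟩
  simpa using foldr_tabInsert_columns hnil H (by simp)

/-! ### Knuth moves -/

/-- Elementary Knuth transformations of words. -/
inductive KnuthStep : List ℕ → List ℕ → Prop
  | left (P Q : List ℕ) (x y z : ℕ) : x < y → y < z →
      KnuthStep (P ++ x :: z :: y :: Q) (P ++ z :: x :: y :: Q)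
  | right (P Q : List ℕ) (x y z : ℕ) : x < y → y < z →
      KnuthStep (P ++ y :: z :: x :: Q) (P ++ y :: x :: z :: Q)

theorem KnuthStep.perm {l l' : List ℕ} (h : KnuthStep l l') : l.Perm l' := by
  rcases h with ⟨P, Q, x, y, z, h1, h2⟩ | ⟨P, Q, x, y, z, h1, h2⟩
  · exact (List.Perm.swap _ _ _).append_left P
  · exact ((List.Perm.swap _ _ _).cons _).append_left P

/-- Sequences of Knuth transformations. -/
def Knuth : List ℕ → List ℕ → Prop := Relation.ReflTransGen KnuthStep

theorem Knuth.refl (l : List ℕ) : Knuth l l := Relation.ReflTransGen.refl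

theorem Knuth.trans {l l' l'' : List ℕ} (h : Knuth l l') (h' : Knuth l' l'') : Knuth l l'' :=
  Relation.ReflTransGen.trans h h'

theorem Knuth.perm {l l' : List ℕ} (h : Knuth l l') : l.Perm l' := by
  induction h with
  | refl => exact List.Perm.refl _
  | tail _ h ih => exact ih.trans h.perm

theorem Knuth.append {l l' : List ℕ} (h : Knuth l l') (P Q : List ℕ) :
    Knuth (P ++ l ++ Q) (P ++ l' ++ Q) := by
  induction h with
  | refl => exact Knuth.refl _
  | tail _ h ih =>
    refine ih.trans (Relation.ReflTransGen.single ?_)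
    rcases h with ⟨P', Q', x, y, z, h1, h2⟩ | ⟨P', Q', x, y, z, h1, h2⟩
    · simpa using KnuthStep.left (P ++ P') (Q' ++ Q) x y z h1 h2
    · simpa using KnuthStep.right (P ++ P') (Q' ++ Q) x y z h1 h2

/-- `j` passes each letter of the decreasing run with the following letter as the witness of
intermediate size. -/
theorem Knuth.move_left {Q : List ℕ} {j a : ℕ} (hQ : (Q ++ [a]).Pairwise (· > ·))
    (hj : ∀ q ∈ Q ++ [a], j < q) : Knuth (j :: Q ++ [a]) (Q ++ [j, a]) := by
  induction Q with
  | nil => exact Knuth.refl _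
  | cons q Q ih =>
    rw [List.cons_append, List.pairwise_cons] at hQ
    have h1 : Knuth (j :: q :: Q ++ [a]) (q :: (j :: Q ++ [a])) := by
      obtain ⟨r, R, hr⟩ : ∃ r R, Q ++ [a] = r :: R := by
        rcases Q with _ | ⟨r, Q⟩
        · exact ⟨a, [], rfl⟩
        · exact ⟨r, Q ++ [a], rfl⟩
      refine Relation.ReflTransGen.single ?_
      simp only [List.cons_append, hr]
      exact KnuthStep.left [] R j r q (hj r (by simp [hr])) (hQ.1 r (by simp [hr]))
    exact h1.trans (by simpa using (ih hQ.2 fun q' hq' => hj q' (by simp at hq' ⊢; tauto)).append [q] [])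

/-- Here the witness is the preceding letter of the decreasing run, which lies between `a` and the
letter being passed. -/
theorem Knuth.move_right {P : List ℕ} {j a : ℕ} (hP : (j :: P).Pairwise (· > ·))
    (ha : j < a) : Knuth (j :: a :: P) (j :: P ++ [a]) := by
  induction P generalizing j with
  | nil => exact Knuth.refl _
  | cons p P ih =>
    rw [List.pairwise_cons] at hP
    have hpj : p < j := hP.1 p (by simp)
    have h1 : Knuth (j :: a :: p :: P) (j :: p :: a :: P) :=
      Relation.ReflTransGen.single (KnuthStep.right [] P p j a hpj ha)
    exact h1.trans (by simpa using (ih hP.2 (hpj.trans ha)).append [j] [])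

theorem colInsert_spec {C : List ℕ} (hC : C.Pairwise (· < ·)) {j : ℕ} (hj : j ∉ C) :
    (colInsert j C = (C ++ [j], none) ∧ ∀ x ∈ C, x < j) ∨
    ∃ L a Q, C = L ++ a :: Q ∧ colInsert j C = (L ++ j :: Q, some a) ∧ j < a ∧ ∀ x ∈ L, x < j := by
  induction C with
  | nil => simp [colInsert]
  | cons c C ih =>
    rw [List.pairwise_cons] at hC
    by_cases hjc : j < c
    · right
      exact ⟨[], c, C, rfl, by simp [colInsert, hjc], hjc, by simp⟩
    · have hcj : c < j := by
        have : j ≠ c := fun e => hj (by simp [e])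
        omega
      rcases ih hC.2 (fun h => hj (by simp [h])) with ⟨h1, h2⟩ | ⟨L, a, Q, rfl, h2, h3, h4⟩
      · left
        simp [colInsert, hjc, h1, hcj]
        exact h2
      · right
        exact ⟨c :: L, a, Q, rfl, by simp [colInsert, hjc, h2], h3, by simpa [hcj] using h4⟩

/-- The columns of a tableau read from bottom to top, from left to right. -/
def reading (T : List (List ℕ)) : List ℕ := (T.map List.reverse).flatten

theorem reading_cons (C : List ℕ) (T : List (List ℕ)) :
    reading (C :: T) = C.reverse ++ reading T := rfl

/-- If `j` bumps `a` from the column `L ++ a :: Q`, then `j` first travels past the entries of `Q`,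
which are read before `a`; next `a` travels past those of `L` to the front of the next column, and
the insertion continues there. -/
theorem knuth_tabInsert {T : List (List ℕ)} (hT : ∀ C ∈ T, C.Pairwise (· < ·)) {j : ℕ}
    (hnd : (j :: reading T).Nodup) :
    Knuth (j :: reading T) (reading (tabInsert j T)) ∧
      ∀ C ∈ tabInsert j T, C.Pairwise (· < ·) := by
  induction T generalizing j with
  | nil =>
    exact ⟨Knuth.refl _, by simp [tabInsert]⟩
  | cons C T ih =>
    have hC := hT C (by simp)
    have hT' : ∀ C ∈ T, C.Pairwise (· < ·) := fun E hE => hT E (by simp [hE])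
    have hjC : j ∉ C := fun h => by
      rw [List.nodup_cons, reading_cons] at hnd
      exact hnd.1 (by simp [h])
    rcases colInsert_spec hC hjC with ⟨h1, h2⟩ | ⟨L, a, Q, rfl, h2, h3, h4⟩
    · have h5 : tabInsert j (C :: T) = (C ++ [j]) :: T := by
        rw [tabInsert, h1]
      rw [h5, reading_cons, reading_cons]
      refine ⟨by simpa using Knuth.refl _, fun E hE => ?_⟩
      rcases List.mem_cons.1 hE with rfl | hE
      · rw [List.pairwise_append]
        exact ⟨hC, by simp, fun x hx y hy => by rw [List.mem_singleton.1 hy]; exact h2 x hx⟩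
      · exact hT' E hE
    · have h5 : tabInsert j ((L ++ a :: Q) :: T) = (L ++ j :: Q) :: tabInsert a T := by
        rw [tabInsert, h2]
      have hC' := List.pairwise_append.1 hC
      have haQ := List.pairwise_cons.1 hC'.2.1
      have hnd' : (a :: reading T).Nodup := by
        rw [reading_cons] at hnd
        refine hnd.sublist ?_
        simp only [List.reverse_append, List.reverse_cons, List.append_assoc, List.singleton_append]
        exact (((List.sublist_append_right L.reverse _).cons_cons a).trans
          (List.sublist_append_right Q.reverse _)).cons j
      obtain ⟨h6, h7⟩ := ih hT' hnd'
      rw [h5]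
      refine ⟨?_, fun E hE => ?_⟩
      · simp only [reading_cons, List.reverse_append, List.reverse_cons]
        have hQa : (Q.reverse ++ [a]).Pairwise (· > ·) := by
          have := List.pairwise_reverse.2 hC'.2.1
          simpa using this
        have hjQ : ∀ q ∈ Q.reverse ++ [a], j < q := by
          intro q hq
          simp only [List.mem_append, List.mem_reverse, List.mem_singleton] at hq
          rcases hq with hq | rfl
          · exact h3.trans (haQ.1 q hq)
          · exact h3
        have hjL : (j :: L.reverse).Pairwise (· > ·) := by
          rw [List.pairwise_cons]
          exact ⟨fun x hx => h4 x (by simpa using hx), List.pairwise_reverse.2 hC'.1⟩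
        have k1 := (Knuth.move_left hQa hjQ).append [] (L.reverse ++ reading T)
        have k2 := (Knuth.move_right hjL h3).append Q.reverse (reading T)
        have k3 := h6.append (Q.reverse ++ j :: L.reverse) []
        simp only [List.append_assoc, List.cons_append, List.nil_append, List.append_nil]
          at k1 k2 k3 ⊢
        exact (k1.trans k2).trans k3
      · rcases List.mem_cons.1 hE with rfl | hE
        · rw [List.pairwise_append, List.pairwise_cons]
          refine ⟨hC'.1, ⟨fun x hx => h3.trans (haQ.1 x hx), haQ.2⟩, fun x hx y hy => ?_⟩
          rcases List.mem_cons.1 hy with rfl | hy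
          · exact h4 x hx
          · exact ((h4 x hx).trans h3).trans (haQ.1 y hy)
        · exact h7 E hE

theorem knuth_foldr_tabInsert {l : List ℕ} (hl : l.Nodup) :
    Knuth l (reading (l.foldr tabInsert [])) ∧
      ∀ C ∈ l.foldr tabInsert [], C.Pairwise (· < ·) := by
  induction l with
  | nil => exact ⟨Knuth.refl _, by simp⟩
  | cons j l ih =>
    obtain ⟨h1, h2⟩ := ih (List.nodup_cons.1 hl).2
    have h3 : Knuth (j :: l) (j :: reading (l.foldr tabInsert [])) := by
      simpa using h1.append [j] []
    obtain ⟨h4, h5⟩ := knuth_tabInsert h2 (h3.perm.nodup_iff.1 hl)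
    exact ⟨h3.trans h4, h5⟩

theorem knuth_word {n : ℕ} {w : Equiv.Perm (Fin n)} {T : StdTableau n} (hw : w ∈ cell T) :
    Knuth (word w) (reading T.cols) := by
  have h := (knuth_foldr_tabInsert ((word_perm w).nodup_iff.2 List.nodup_range')).1
  have h' : (word w).foldr tabInsert [] = T.cols := hw
  rwa [h'] at h

theorem reading_tab (C D : List ℕ) : reading (tab C D) = C.reverse ++ D.reverse := by
  rcases C with _ | ⟨c, C⟩ <;> rcases D with _ | ⟨d, D⟩ <;> simp [tab, dropEmpty, reading]

theorem TwoCol.exists_mem_cell {n : ℕ} {C D : List ℕ} (H : TwoCol n C D) {T : StdTableau n}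
    (hT : T.cols = tab C D) : ∃ w ∈ cell T, word w = C.reverse ++ D.reverse := by
  obtain ⟨w, hw⟩ := exists_word
    (((List.reverse_perm C).append (List.reverse_perm D)).trans H.perm)
  refine ⟨w, ?_, hw⟩
  show (word w).foldr tabInsert [] = T.cols
  rw [hw, hT, H.toBallot.foldr_tabInsert]

/-- Moving an outer entry `x` to the first column is a step of the Duflo order. -/
theorem TwoCol.dufloLE_move {n : ℕ} {C D : List ℕ} (H : TwoCol n C D) {x : ℕ}
    (hx : Outer (pathOf C D) x) {T S : StdTableau n} (hT : T.cols = tab C D)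
    (hS : S.cols = tab (C.orderedInsert (· ≤ ·) x) (D.erase x)) : dufloLE T S := by
  have hxD : x ∈ D := H.down_iff.1 hx.1
  have hxC : x ∉ C := fun h => H.disj x h hxD
  have split : ∀ {E : List ℕ}, E.Pairwise (· < ·) →
      E = E.filter (· < x + 1) ++ E.filter (x < ·) := by
    intro E hE
    induction E with
    | nil => rfl
    | cons e E ih =>
      rw [List.pairwise_cons] at hE
      by_cases he : e < x + 1
      · rw [List.filter_cons_of_pos (by simp; omega),
          List.filter_cons_of_neg (by simp; omega), List.cons_append, ← ih hE.2]
      · have h1 : E.filter (· < x + 1) = [] := by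
          rw [List.filter_eq_nil_iff]
          intro y hy
          have := hE.1 y hy
          simp
          omega
        have h2 : E.filter (x < ·) = E := by
          rw [List.filter_eq_self]
          intro y hy
          have := hE.1 y hy
          simp
          omega
        rw [List.filter_cons_of_neg (by simpa using (by omega : x + 1 ≤ e)),
          List.filter_cons_of_pos (by simpa using (by omega : x < e)), h1, h2]
        rfl
  have hC := split H.left
  have hD := split H.right
  rw [filter_lt_succ_of_notMem hxC] at hC
  rw [filter_lt_succ H.right hxD] at hD
  -- Outerness makes the part of the path beyond `x`, measured from the height after `x`,
  -- nonnegative. The entries greater than `x` thus form a tableau of their own.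
  have hR : Ballot (C.filter (x < ·)) (D.filter (x < ·)) := by
    refine ⟨H.left.filter _, H.right.filter _,
      fun y hy hy' => H.disj y (List.mem_of_mem_filter hy) (List.mem_of_mem_filter hy'),
      fun k => ?_⟩
    have key : ∀ E : List ℕ, x < k → E.countP (· < k) =
        E.countP (· < x + 1) + (E.filter (x < ·)).countP (· < k) := by
      intro E hk
      induction E with
      | nil => simp
      | cons e E ih =>
        by_cases he : x < e
        · rw [List.filter_cons_of_pos (by simpa)]
          simp only [List.countP_cons, ih, decide_eq_true_eq]
          split_ifs <;> omega
        · rw [List.filter_cons_of_neg (by simpa using he)]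
          simp only [List.countP_cons, ih, decide_eq_true_eq]
          split_ifs <;> omega
    by_cases hk : x < k
    · have := hx.2 k hk
      simp only [pathOf, key C hk, key D hk] at this ⊢
      push_cast at this
      omega
    · rw [pathOf, countP_lt_eq_zero fun y hy => ?_, countP_lt_eq_zero fun y hy => ?_]
      · simp
      · have := List.of_mem_filter hy
        simp at this
        omega
      · have := List.of_mem_filter hy
        simp at this
        omega
  have hL := H.toBallot.filter (x + 1)
  rw [filter_lt_succ_of_notMem hxC, filter_lt_succ H.right hxD] at hL
  have hL' : Ballot (C.filter (· < x) ++ [x]) (D.filter (· < x)) := by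
    have h1 : (C.filter (· < x)).countP (· < x + 1) = (C.filter (· < x)).length :=
      List.countP_eq_length.2 fun y hy => by
        have := List.of_mem_filter hy
        simp at this ⊢
        omega
    refine ⟨?_, H.right.filter _, ?_, fun k => ?_⟩
    · rw [List.pairwise_append]
      exact ⟨H.left.filter _, by simp, by simp⟩
    · intro y hy hy'
      rcases List.mem_append.1 hy with h | h
      · exact hL.disj y h (by simp [hy'])
      · simp at h hy'
        omega
    · have := hL.nonneg k
      simp only [pathOf, List.countP_append] at this ⊢
      push_cast at this ⊢
      omega
  have hlt : ∀ y, y ∈ C.filter (· < x) ∨ y ∈ D.filter (· < x) ++ [x] →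
      ∀ r, r ∈ C.filter (x < ·) ∨ r ∈ D.filter (x < ·) → y < r := by
    intro y hy r hr
    have h1 : y ≤ x := by
      simp at hy
      omega
    have h2 : x < r := by
      simp at hr
      omega
    omega
  generalize hC0 : C.filter (· < x) = C₀ at *
  generalize hC1 : C.filter (x < ·) = C₁ at *
  generalize hD0 : D.filter (· < x) = D₀ at *
  generalize hD1 : D.filter (x < ·) = D₁ at *
  have hC0x : ∀ y ∈ C₀, y < x := by
    rw [← hC0]
    simp
  have hD0x : x ∉ D₀ := by
    rw [← hD0]
    simp
  have hC1x : ∀ y ∈ C₁, x < y := by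
    rw [← hC1]
    simp
  have hins : C.orderedInsert (· ≤ ·) x = C₀ ++ [x] ++ C₁ := by
    rw [hC]
    clear hC hC0 hL hL' hlt
    induction C₀ with
    | nil =>
      rcases C₁ with _ | ⟨c, C₁⟩
      · rfl
      · have := hC1x c (by simp)
        rw [List.nil_append, List.orderedInsert_cons, if_pos this.le]
        rfl
    | cons c C₀ ih =>
      have := hC0x c (by simp)
      rw [List.cons_append, List.orderedInsert_cons, if_neg (by omega),
        ih fun y hy => hC0x y (by simp [hy])]
      rfl
  have hera : D.erase x = D₀ ++ D₁ := by
    rw [hD, List.append_assoc, List.erase_append_right _ hD0x]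
    simp
  -- Reading the tableau of large entries before that of small ones gives words for both tableaux
  -- that differ only in the place of `x`: after the small entries of the first column for `T`,
  -- before them for `S`.
  have hTw := foldr_tabInsert_columns hL hR hlt
  have hSw := foldr_tabInsert_columns hL' hR fun y hy => hlt y (by
    simp only [List.mem_append] at hy ⊢
    tauto)
  rw [← hC, ← hD, ← hT] at hTw
  rw [← hins, ← hera, ← hS] at hSw
  have hrev : ∀ E : List ℕ, E.reverse.Perm E := List.reverse_perm
  have hpw : (C₁.reverse ++ D₁.reverse ++ (C₀.reverse ++ (D₀ ++ [x]).reverse)).Perm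
      (List.range' 1 n) := by
    refine List.Perm.trans ?_ H.perm
    rw [List.perm_iff_count]
    intro y
    rw [hC, hD]
    simp only [List.count_append, List.count_reverse]
    omega
  have hpy : (C₁.reverse ++ D₁.reverse ++ ((C₀ ++ [x]).reverse ++ D₀.reverse)).Perm
      (List.range' 1 n) := by
    refine List.Perm.trans ?_ hpw
    rw [List.perm_iff_count]
    intro y
    simp only [List.count_append, List.count_reverse]
    omega
  obtain ⟨w, hw⟩ := exists_word hpw
  obtain ⟨y, hy⟩ := exists_word hpy
  refine Relation.ReflTransGen.single ⟨w, ?_, y, ?_, ?_⟩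
  · show (word w).foldr tabInsert [] = T.cols
    rw [hw, hTw]
  · show (word y).foldr tabInsert [] = S.cols
    rw [hy, hSw]
  · refine weakLE_of_move (P := C₁.reverse ++ D₁.reverse) (A := C₀.reverse) (Q := D₀.reverse)
      (x := x) ?_ ?_ (by simpa using hC0x)
    · simp [hw]
    · simp [hy]

end YoungOrder

namespace YoungOrder

/-! ### Zariski closures and conjugation -/

section Zariski

variable {n : ℕ} {A B : Set (Matrix (Fin n) (Fin n) ℂ)}

theorem subset_zariskiClosure (A : Set (Matrix (Fin n) (Fin n) ℂ)) : A ⊆ zariskiClosure A :=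
  fun X hX _ hp => hp X hX

theorem zariskiClosure_subset (h : A ⊆ zariskiClosure B) : zariskiClosure A ⊆ zariskiClosure B :=
  fun _ hX p hp => hX p fun _ hY => h hY p hp

theorem zariskiClosure_mono (h : A ⊆ B) : zariskiClosure A ⊆ zariskiClosure B :=
  zariskiClosure_subset (h.trans (subset_zariskiClosure B))

/-- Multiplication on both sides by fixed matrices is polynomial in the entries, so a polynomial
vanishing on `B` pulls back to one vanishing on `A`. -/
theorem mul_mem_zariskiClosure {g h X : Matrix (Fin n) (Fin n) ℂ} (hX : X ∈ zariskiClosure A)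
    (H : ∀ Y ∈ A, g * Y * h ∈ zariskiClosure B) : g * X * h ∈ zariskiClosure B := by
  intro p hp
  let q : MvPolynomial (Fin n × Fin n) ℂ := MvPolynomial.bind₁ (fun ij =>
    ∑ k, (∑ l, MvPolynomial.C (g ij.1 l) * MvPolynomial.X (l, k)) * MvPolynomial.C (h k ij.2)) p
  have hq : ∀ Y : Matrix (Fin n) (Fin n) ℂ, MvPolynomial.eval (fun ij => Y ij.1 ij.2) q =
      MvPolynomial.eval (fun ij => (g * Y * h) ij.1 ij.2) p := by
    intro Y
    simp only [q, MvPolynomial.eval, MvPolynomial.eval₂Hom_bind₁]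
    congr 2
    funext ij
    simp [Matrix.mul_apply]
  rw [← hq]
  refine hX q fun Y hY => ?_
  rw [hq]
  exact H Y hY p hp

/-- A point of a line lies in the closure of a set if all points of the line with a nonzero
`(a, b)`-entry do. -/
theorem mem_zariskiClosure_of_line {a b : Fin n} {X : Matrix (Fin n) (Fin n) ℂ}
    (H : ∀ s : ℂ, X a b + s ≠ 0 → X + Matrix.single a b s ∈ zariskiClosure B) :
    X ∈ zariskiClosure B := by
  intro p hp
  let q : Polynomial ℂ := MvPolynomial.aeval (fun ij : Fin n × Fin n =>
    Polynomial.C (X ij.1 ij.2) + Polynomial.C (Matrix.single a b (1 : ℂ) ij.1 ij.2) * Polynomial.X) p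
  have hq : ∀ s : ℂ, q.eval s =
      MvPolynomial.eval (fun ij => (X + Matrix.single a b s) ij.1 ij.2) p := by
    intro s
    have h1 : q.eval s = (Polynomial.evalRingHom s).comp
        (MvPolynomial.aeval (R := ℂ) (fun ij : Fin n × Fin n => Polynomial.C (X ij.1 ij.2) +
          Polynomial.C (Matrix.single a b (1 : ℂ) ij.1 ij.2) * Polynomial.X)).toRingHom p := rfl
    rw [h1]
    congr 1
    refine MvPolynomial.ringHom_ext (fun r => ?_) (fun ij => ?_)
    · simp
    · by_cases hab : a = ij.1 ∧ b = ij.2 <;> simp [Matrix.single_apply, hab]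
  have h0 : q = 0 := by
    refine Polynomial.eq_zero_of_infinite_isRoot q (Set.Infinite.mono (s := {-X a b}ᶜ) ?_ ?_)
    · intro s hs
      show q.eval s = 0
      rw [hq]
      refine H s (fun h => hs ?_) p hp
      rw [Set.mem_singleton_iff]
      linear_combination h
    · exact (Set.finite_singleton _).infinite_compl
  have := hq 0
  rw [h0] at this
  simpa using this.symm

theorem conjugates_mono {H K : Set (Matrix.SpecialLinearGroup (Fin n) ℂ)} (h : H ⊆ K)
    (hAB : A ⊆ B) : conjugates H A ⊆ conjugates K B := by
  rintro Y ⟨g, hg, X, hX, rfl⟩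
  exact ⟨g, h hg, X, hAB hX, rfl⟩

theorem conjugates_subset_zariskiClosure {H : Set (Matrix.SpecialLinearGroup (Fin n) ℂ)}
    (hH : ∀ g ∈ H, ∀ h ∈ H, g * h ∈ H) (hA : A ⊆ zariskiClosure (conjugates H B)) :
    conjugates H A ⊆ zariskiClosure (conjugates H B) := by
  rintro Y ⟨g, hg, X, hX, rfl⟩
  refine mul_mem_zariskiClosure (hA hX) ?_
  rintro Z ⟨h, hh, V, hV, rfl⟩
  refine subset_zariskiClosure _ ⟨g * h, hH g hg h hh, V, hV, ?_⟩
  rw [mul_inv_rev]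
  simp only [Matrix.SpecialLinearGroup.coe_mul, mul_assoc]

theorem subset_conjugates {H : Set (Matrix.SpecialLinearGroup (Fin n) ℂ)} (hH : 1 ∈ H)
    (A : Set (Matrix (Fin n) (Fin n) ℂ)) : A ⊆ conjugates H A := by
  intro X hX
  exact ⟨1, hH, X, hX, by simp⟩

theorem one_mem_borel : (1 : Matrix.SpecialLinearGroup (Fin n) ℂ) ∈ borel n := by
  intro i j hij
  rw [Matrix.SpecialLinearGroup.coe_one, Matrix.one_apply_ne hij.ne']

theorem mul_mem_borel (g : Matrix.SpecialLinearGroup (Fin n) ℂ) (hg : g ∈ borel n)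
    (h : Matrix.SpecialLinearGroup (Fin n) ℂ) (hh : h ∈ borel n) : g * h ∈ borel n := by
  have hg' : (g : Matrix (Fin n) (Fin n) ℂ).BlockTriangular id := fun i j hij => hg i j hij
  have hh' : (h : Matrix (Fin n) (Fin n) ℂ).BlockTriangular id := fun i j hij => hh i j hij
  intro i j hij
  rw [Matrix.SpecialLinearGroup.coe_mul]
  exact (hg'.mul hh') hij

theorem coe_inv_eq {g : Matrix.SpecialLinearGroup (Fin n) ℂ} {h : Matrix (Fin n) (Fin n) ℂ}
    (hgh : (g : Matrix (Fin n) (Fin n) ℂ) * h = 1) :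
    ((g⁻¹ : Matrix.SpecialLinearGroup (Fin n) ℂ) : Matrix (Fin n) (Fin n) ℂ) = h := by
  have h1 : ((g⁻¹ : Matrix.SpecialLinearGroup (Fin n) ℂ) : Matrix (Fin n) (Fin n) ℂ) *
      (g : Matrix (Fin n) (Fin n) ℂ) = 1 := by
    rw [← Matrix.SpecialLinearGroup.coe_mul, inv_mul_cancel, Matrix.SpecialLinearGroup.coe_one]
  exact left_inv_eq_right_inv h1 hgh

theorem inv_mem_borel {g : Matrix.SpecialLinearGroup (Fin n) ℂ} (hg : g ∈ borel n) :
    g⁻¹ ∈ borel n := by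
  have hg' : (g : Matrix (Fin n) (Fin n) ℂ).BlockTriangular id := fun i j hij => hg i j hij
  have h1 : (g : Matrix (Fin n) (Fin n) ℂ) *
      ((g⁻¹ : Matrix.SpecialLinearGroup (Fin n) ℂ) : Matrix (Fin n) (Fin n) ℂ) = 1 := by
    rw [← Matrix.SpecialLinearGroup.coe_mul, mul_inv_cancel, Matrix.SpecialLinearGroup.coe_one]
  have := invertibleOfRightInverse _ _ h1
  have h2 := Matrix.blockTriangular_inv_of_blockTriangular hg'
  intro i j hij
  rw [← Matrix.inv_eq_right_inv h1]
  exact h2 hij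

/-- Conjugation by an invertible upper triangular matrix, of any determinant. -/
theorem mem_conjugates_borel {g h X : Matrix (Fin n) (Fin n) ℂ} (hgh : g * h = 1)
    (hg : g.BlockTriangular id) (hX : X ∈ A) : g * X * h ∈ conjugates (borel n) A := by
  rcases Nat.eq_zero_or_pos n with rfl | hn
  · exact ⟨1, one_mem_borel, X, hX, Subsingleton.elim _ _⟩
  have hdet : g.det * h.det = 1 := by rw [← Matrix.det_mul, hgh, Matrix.det_one]
  have hg0 : g.det ≠ 0 := left_ne_zero_of_mul_eq_one hdet
  -- Rescaling by an `n`-th root of the inverse determinant puts `g` into the special linear group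
  -- without changing the conjugation.
  obtain ⟨c, hc⟩ := IsAlgClosed.exists_pow_nat_eq (g.det)⁻¹ hn
  have hc0 : c ≠ 0 := by
    rintro rfl
    rw [zero_pow hn.ne'] at hc
    exact inv_ne_zero hg0 hc.symm
  have hs : (c • g).det = 1 := by
    rw [Matrix.det_smul, Fintype.card_fin, hc, inv_mul_cancel₀ hg0]
  obtain ⟨s, hs'⟩ : ∃ s : Matrix.SpecialLinearGroup (Fin n) ℂ,
      (s : Matrix (Fin n) (Fin n) ℂ) = c • g := ⟨⟨c • g, hs⟩, rfl⟩
  refine ⟨s, fun i j hij => ?_, X, hX, ?_⟩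
  · rw [hs', Matrix.smul_apply, hg hij, smul_zero]
  · rw [coe_inv_eq (h := c⁻¹ • h), hs']
    · rw [Matrix.smul_mul, Matrix.smul_mul, Matrix.mul_smul, smul_smul, mul_inv_cancel₀ hc0,
        one_smul]
    · rw [hs', Matrix.smul_mul, Matrix.mul_smul, smul_smul, mul_inv_cancel₀ hc0, one_smul, hgh]

/-- The closure of the union of the conjugates under the Borel subgroup. -/
def borelClosure (A : Set (Matrix (Fin n) (Fin n) ℂ)) : Set (Matrix (Fin n) (Fin n) ℂ) :=
  zariskiClosure (conjugates (borel n) A)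

theorem subset_borelClosure (A : Set (Matrix (Fin n) (Fin n) ℂ)) : A ⊆ borelClosure A :=
  (subset_conjugates one_mem_borel A).trans (subset_zariskiClosure _)

theorem borelClosure_subset (h : A ⊆ borelClosure B) : borelClosure A ⊆ borelClosure B :=
  zariskiClosure_subset (conjugates_subset_zariskiClosure mul_mem_borel h)

theorem conj_mem_borelClosure {g h X : Matrix (Fin n) (Fin n) ℂ}
    (hhg : h * g = 1) (hg : h.BlockTriangular id) (hX : g * X * h ∈ A) : X ∈ borelClosure A := by
  have h1 := subset_zariskiClosure _ (mem_conjugates_borel (A := A) hhg hg hX)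
  have h2 : h * (g * X * h) * g = X := by
    rw [← mul_assoc, ← mul_assoc, hhg, one_mul, mul_assoc, hhg, mul_one]
  rwa [h2] at h1

end Zariski

/-! ### Knuth moves do not change the orbital variety -/

/-- Matrices supported at the non-inversions with respect to the positions `f`. -/
def nonInversions {n : ℕ} (f : Fin n → ℕ) : Set (Matrix (Fin n) (Fin n) ℂ) :=
  {X | ∀ i j, X i j ≠ 0 → i < j ∧ f i < f j}

theorem blockTriangular_transvection {n : ℕ} {a b : Fin n} (hab : a < b) (t : ℂ) :
    (Matrix.transvection a b t).BlockTriangular id := by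
  intro i j hij
  have hij' : j < i := hij
  rw [Matrix.transvection, Matrix.add_apply, Matrix.one_apply_ne hij'.ne', Matrix.single_apply,
    if_neg, add_zero]
  rintro ⟨rfl, rfl⟩
  exact (hij'.trans hab).false

theorem add_single_mem_nonInversions {n : ℕ} {f : Fin n → ℕ} {X : Matrix (Fin n) (Fin n) ℂ}
    (hX : X ∈ nonInversions f) {a b : Fin n} (hab : a < b) (hf : f a < f b) (s : ℂ) :
    X + Matrix.single a b s ∈ nonInversions f := by
  intro i j hij
  by_cases h : a = i ∧ b = j
  · rw [← h.1, ← h.2]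
    exact ⟨hab, hf⟩
  · rw [Matrix.add_apply, Matrix.single_apply, if_neg h, add_zero] at hij
    exact hX i j hij

/-- The matrix `X` after conjugation by a transvection. -/
theorem conj_transvection_apply {n : ℕ} {a b : Fin n} (X : Matrix (Fin n) (Fin n) ℂ)
    (t : ℂ) (i j : Fin n) :
    (Matrix.transvection a b t * X * Matrix.transvection a b (-t)) i j =
      X i j + (if i = a then t * X b j else 0) -
        if j = b then t * (X i a + if i = a then t * X b a else 0) else 0 := by
  have h : ∀ k, (Matrix.transvection a b t * X) i k = X i k + if i = a then t * X b k else 0 := by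
    intro k
    split_ifs with hi
    · rw [hi, Matrix.transvection_mul_apply_same]
    · rw [Matrix.transvection_mul_apply_of_ne _ _ _ _ hi, add_zero]
  by_cases hj : j = b
  · rw [if_pos hj, hj, Matrix.mul_transvection_apply_same, h, h]
    ring
  · rw [if_neg hj, Matrix.mul_transvection_apply_of_ne _ _ _ _ hj, h, sub_zero]

theorem conj_transvection_mem_borelClosure {n : ℕ} {a b : Fin n} (hab : a < b)
    {X : Matrix (Fin n) (Fin n) ℂ} (t : ℂ) {A : Set (Matrix (Fin n) (Fin n) ℂ)}
    (h : Matrix.transvection a b t * X * Matrix.transvection a b (-t) ∈ A) :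
    X ∈ borelClosure A := by
  refine conj_mem_borelClosure ?_ (blockTriangular_transvection hab _) h
  · rw [Matrix.transvection_mul_transvection_same _ _ hab.ne, neg_add_cancel,
      Matrix.transvection_zero]

/-- The positions `f'` arise from `f` by exchanging the neighbours `u` and `v`. -/
structure SwapPositions {n : ℕ} (f f' : Fin n → ℕ) (u v : Fin n) (m : ℕ) : Prop where
  inj : Function.Injective f
  left : f u = m
  right : f v = m + 1
  left' : f' u = m + 1
  right' : f' v = m
  eq : ∀ t, t ≠ u → t ≠ v → f' t = f t

/-- The exchanged letters are neighbours, so no third letter lies between them and only their mutual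
order changes. -/
theorem SwapPositions.lt {n : ℕ} {f f' : Fin n → ℕ} {u v : Fin n} {m : ℕ}
    (H : SwapPositions f f' u v m) (i j : Fin n) (hij : f i < f j) (hne : ¬ (i = u ∧ j = v)) :
    f' i < f' j := by
  obtain ⟨h0, h1, h2, h3, h4, h5⟩ := H
  have hcases : ∀ t, (t = u ∧ f t = m ∧ f' t = m + 1) ∨ (t = v ∧ f t = m + 1 ∧ f' t = m) ∨
      (f' t = f t ∧ f t ≠ m ∧ f t ≠ m + 1) := by
    intro t
    by_cases hu : t = u
    · subst hu
      exact .inl ⟨rfl, h1, h3⟩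
    by_cases hv : t = v
    · subst hv
      exact .inr (.inl ⟨rfl, h2, h4⟩)
    · exact .inr (.inr ⟨h5 t hu hv, fun h => hu (h0 (h.trans h1.symm)),
        fun h => hv (h0 (h.trans h2.symm))⟩)
  rcases hcases i with h6 | h6 | h6 <;> rcases hcases j with h7 | h7 | h7 <;>
    omega

theorem SwapPositions.symm {n : ℕ} {f f' : Fin n → ℕ} {u v : Fin n} {m : ℕ}
    (H : SwapPositions f f' u v m) : SwapPositions f' f v u m := by
  refine ⟨fun i j hij => ?_, H.right', H.left', H.right, H.left, fun t h1 h2 => (H.eq t h2 h1).symm⟩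
  by_contra hne
  have hlt := H.lt
  rcases lt_or_gt_of_ne (fun h => hne (H.inj h) : f i ≠ f j) with h | h
  · by_cases hu : i = u ∧ j = v
    · rw [hu.1, hu.2, H.left', H.right'] at hij
      omega
    · exact (hlt i j h hu).ne hij
  · by_cases hu : j = u ∧ i = v
    · rw [hu.1, hu.2, H.left', H.right'] at hij
      omega
    · exact (hlt j i h hu).ne' hij

theorem SwapPositions.nonInversions_subset {n : ℕ} {f f' : Fin n → ℕ} {u v : Fin n} {m : ℕ}
    (H : SwapPositions f f' u v m) (huv : v < u) : nonInversions f ⊆ nonInversions f' := by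
  intro X hX i j hij
  obtain ⟨h1, h2⟩ := hX i j hij
  refine ⟨h1, H.lt i j h2 ?_⟩
  rintro ⟨rfl, rfl⟩
  exact (h1.trans huv).false

/-- Only the entry at `(x, z)` has to disappear. Generically the entry at `(x, y)` is nonzero, and
conjugation by a transvection at `(y, z)` uses it as a pivot. Since `y` stands right after `x` and
`z`, the other changed entries stay at non-inversions. -/
theorem nonInversions_subset_left {n : ℕ} {f f' : Fin n → ℕ} {x y z : Fin n} (hxy : x < y)
    (hyz : y < z) {m : ℕ} (hs : SwapPositions f f' x z m) (hy : f y = m + 2) :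
    nonInversions f ⊆ borelClosure (nonInversions f') := by
  have hkeep := hs.lt
  obtain ⟨hf, hx, hz, -, -, -⟩ := hs
  intro X hX
  -- The closure allows the pivot to be assumed nonzero.
  refine mem_zariskiClosure_of_line (a := x) (b := y) fun s hs => ?_
  have hX' := add_single_mem_nonInversions hX hxy (by omega) s
  have hne : (X + Matrix.single x y s) x y ≠ 0 := by simpa using hs
  generalize X + Matrix.single x y s = X at hX' hne
  have hzero : ∀ i j, ¬ (i < j ∧ f i < f j) → X i j = 0 := fun i j h => by
    by_contra hc
    exact h (hX' i j hc)
  refine conj_transvection_mem_borelClosure hyz (X x z / X x y) ?_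
  intro i j hij
  rw [conj_transvection_apply] at hij
  by_cases hi : i = y
  · subst hi
    by_cases hj : j = z
    · subst hj
      rw [hzero i j (by omega), hzero j j (by simp), hzero i i (by simp),
        hzero j i (fun h => (h.1.trans hyz).false)] at hij
      simp at hij
    · rw [if_pos rfl, if_neg hj, sub_zero] at hij
      by_cases h1 : X i j = 0
      · have h2 : X z j ≠ 0 := fun h => by simp [h1, h] at hij
        obtain ⟨h3, h4⟩ := hX' z j h2
        refine ⟨hyz.trans h3, hkeep i j ?_ (fun h => hxy.ne' h.1)⟩
        have h5 : f j ≠ f i := fun h => (hyz.trans h3).ne' (hf h)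
        omega
      · obtain ⟨h3, h4⟩ := hX' i j h1
        exact ⟨h3, hkeep i j h4 fun h => hj h.2⟩
  · by_cases hj : j = z
    · subst hj
      rw [if_neg hi, if_pos rfl, if_neg hi, add_zero, add_zero] at hij
      by_cases hix : i = x
      · subst hix
        rw [div_mul_cancel₀ _ hne, sub_self] at hij
        exact absurd rfl hij
      by_cases h1 : X i j = 0
      · have h2 : X i y ≠ 0 := fun h => by simp [h1, h] at hij
        obtain ⟨h3, h4⟩ := hX' i y h2
        refine ⟨h3.trans hyz, hkeep i j ?_ (fun h => hix h.1)⟩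
        have h5 : f i ≠ f j := fun h => (h3.trans hyz).ne (hf h)
        have h6 : f i ≠ f x := fun h => hix (hf h)
        omega
      · obtain ⟨h3, h4⟩ := hX' i j h1
        exact ⟨h3, hkeep i j h4 fun h => hix h.1⟩
    · rw [if_neg hi, if_neg hj, add_zero, sub_zero] at hij
      obtain ⟨h3, h4⟩ := hX' i j hij
      exact ⟨h3, hkeep i j h4 fun h => hj h.2⟩

/-- The mirror image: `y` now stands just before the exchanged pair, the pivot is at `(y, z)`, and
the transvection at `(x, y)` clears the entry at `(x, z)`. -/
theorem nonInversions_subset_right {n : ℕ} {f f' : Fin n → ℕ} {x y z : Fin n} (hxy : x < y)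
    (hyz : y < z) {m : ℕ} (hs : SwapPositions f f' x z m) (hy : f y + 1 = m) :
    nonInversions f ⊆ borelClosure (nonInversions f') := by
  have hkeep := hs.lt
  obtain ⟨hf, hx, hz, -, -, -⟩ := hs
  intro X hX
  refine mem_zariskiClosure_of_line (a := y) (b := z) fun s hs => ?_
  have hX' := add_single_mem_nonInversions hX hyz (by omega) s
  have hne : (X + Matrix.single y z s) y z ≠ 0 := by simpa using hs
  generalize X + Matrix.single y z s = X at hX' hne
  have hzero : ∀ i j, ¬ (i < j ∧ f i < f j) → X i j = 0 := fun i j h => by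
    by_contra hc
    exact h (hX' i j hc)
  refine conj_transvection_mem_borelClosure hxy (-(X x z / X y z)) ?_
  intro i j hij
  rw [conj_transvection_apply] at hij
  by_cases hi : i = x
  · subst hi
    by_cases hj : j = y
    · subst hj
      rw [hzero i j (by omega), hzero j j (by simp), hzero i i (by simp),
        hzero j i (fun h => (h.1.trans hxy).false)] at hij
      simp at hij
    · rw [if_pos rfl, if_neg hj, sub_zero] at hij
      by_cases hjz : j = z
      · subst hjz
        rw [neg_mul, div_mul_cancel₀ _ hne, add_neg_cancel] at hij
        exact absurd rfl hij
      by_cases h1 : X i j = 0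
      · have h2 : X y j ≠ 0 := fun h => by simp [h1, h] at hij
        obtain ⟨h3, h4⟩ := hX' y j h2
        refine ⟨hxy.trans h3, hkeep i j ?_ (fun h => hjz h.2)⟩
        have h5 : f j ≠ f i := fun h => (hxy.trans h3).ne' (hf h)
        omega
      · obtain ⟨h3, h4⟩ := hX' i j h1
        exact ⟨h3, hkeep i j h4 fun h => hjz h.2⟩
  · by_cases hj : j = y
    · subst hj
      rw [if_neg hi, if_pos rfl, if_neg hi, add_zero, add_zero] at hij
      by_cases h1 : X i j = 0
      · have h2 : X i x ≠ 0 := fun h => by simp [h1, h] at hij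
        obtain ⟨h3, h4⟩ := hX' i x h2
        refine ⟨h3.trans hxy, hkeep i j ?_ (fun h => hi h.1)⟩
        have h5 : f i ≠ f j := fun h => (h3.trans hxy).ne (hf h)
        omega
      · obtain ⟨h3, h4⟩ := hX' i j h1
        exact ⟨h3, hkeep i j h4 fun h => hi h.1⟩
    · rw [if_neg hi, if_neg hj, add_zero, sub_zero] at hij
      obtain ⟨h3, h4⟩ := hX' i j hij
      exact ⟨h3, hkeep i j h4 fun h => hi h.1⟩

/-- The positions of the letters in a word. -/
def positions (n : ℕ) (l : List ℕ) (i : Fin n) : ℕ := l.idxOf ((i : ℕ) + 1)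

theorem positions_injective {n : ℕ} {l : List ℕ} (hl : l.Perm (List.range' 1 n)) :
    Function.Injective (positions n l) := by
  intro i j hij
  have hi : (i : ℕ) + 1 ∈ l := by
    rw [hl.mem_iff, List.mem_range'_1]
    omega
  have := (List.idxOf_inj hi).1 hij
  exact Fin.ext (by omega)

theorem positions_word {n : ℕ} (w : Equiv.Perm (Fin n)) :
    nonInversions (positions n (word w)) = nilIntersection w := by
  ext X
  refine forall_congr' fun i => forall_congr' fun j => forall_congr' fun _ => ?_
  rw [positions, positions, idxOf_word, idxOf_word, Fin.lt_def (a := w.symm i)]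

theorem exists_fin_of_mem {n : ℕ} {l : List ℕ} (hl : l.Perm (List.range' 1 n)) {x : ℕ}
    (hx : x ∈ l) : ∃ i : Fin n, (i : ℕ) + 1 = x := by
  rw [hl.mem_iff, List.mem_range'_1] at hx
  exact ⟨⟨x - 1, by omega⟩, by simp; omega⟩

theorem swapPositions_append {n : ℕ} {P Q : List ℕ} {u v : Fin n}
    (hl : (P ++ ((u : ℕ) + 1) :: ((v : ℕ) + 1) :: Q).Perm (List.range' 1 n)) :
    SwapPositions (positions n (P ++ ((u : ℕ) + 1) :: ((v : ℕ) + 1) :: Q))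
      (positions n (P ++ ((v : ℕ) + 1) :: ((u : ℕ) + 1) :: Q)) u v P.length := by
  have hnd : (P ++ ((u : ℕ) + 1) :: ((v : ℕ) + 1) :: Q).Nodup :=
    hl.nodup_iff.2 List.nodup_range'
  have huP : (u : ℕ) + 1 ∉ P := by
    rw [List.nodup_append] at hnd
    exact fun h => hnd.2.2 _ h _ (by simp) rfl
  have huv : (u : ℕ) ≠ v := by
    have := (List.nodup_append.1 hnd).2.1
    rw [List.nodup_cons] at this
    exact fun h => this.1 (by simp [h])
  have hm := idxOf_move (P := P) (A := [(u : ℕ) + 1]) (Q := Q) (x := (v : ℕ) + 1)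
    (by simpa using hnd)
  simp only [List.append_assoc, List.cons_append, List.nil_append, List.length_singleton,
    List.mem_singleton] at hm
  obtain ⟨⟨h1, h2⟩, h3⟩ := hm
  have h4 : (P ++ ((u : ℕ) + 1) :: ((v : ℕ) + 1) :: Q).idxOf ((u : ℕ) + 1) = P.length := by
    rw [List.idxOf_append_of_notMem huP, List.idxOf_cons_self]
    rfl
  have h5 := h3 ((u : ℕ) + 1) (by omega)
  refine ⟨positions_injective hl, h4, h1, ?_, h2, fun t ht1 ht2 => ?_⟩
  · unfold positions
    omega
  · have h6 : (t : ℕ) ≠ u := fun h => ht1 (Fin.ext h)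
    have h7 : (t : ℕ) ≠ v := fun h => ht2 (Fin.ext h)
    have := h3 ((t : ℕ) + 1) (by omega)
    unfold positions
    omega

/-- One of the two supports contains the other, with the pair `(x, z)` as the only extra
non-inversion. The other inclusion, up to closure and conjugation, is elimination with pivot
supplied by `y`. -/
theorem KnuthStep.borelClosure_eq {n : ℕ} {l l' : List ℕ} (h : KnuthStep l l')
    (hl : l.Perm (List.range' 1 n)) :
    borelClosure (nonInversions (positions n l)) =
      borelClosure (nonInversions (positions n l')) := by
  have hnd : l.Nodup := hl.nodup_iff.2 List.nodup_range'
  rcases h with ⟨P, Q, x, y, z, hxy, hyz⟩ | ⟨P, Q, x, y, z, hxy, hyz⟩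
  · obtain ⟨x, rfl⟩ := exists_fin_of_mem hl (x := x) (by simp)
    obtain ⟨y, rfl⟩ := exists_fin_of_mem hl (x := y) (by simp)
    obtain ⟨z, rfl⟩ := exists_fin_of_mem hl (x := z) (by simp)
    have hs := swapPositions_append hl
    have hy : (P ++ ((x : ℕ) + 1) :: ((z : ℕ) + 1) :: ((y : ℕ) + 1) :: Q).idxOf ((y : ℕ) + 1) =
        P.length + 2 := by
      have hyP : (y : ℕ) + 1 ∉ P := by
        rw [List.nodup_append] at hnd
        exact fun h => hnd.2.2 _ h _ (by simp) rfl
      rw [List.idxOf_append_of_notMem hyP, List.idxOf_cons_ne _ (by omega),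
        List.idxOf_cons_ne _ (by omega), List.idxOf_cons_self]
    exact Set.Subset.antisymm
      (borelClosure_subset (nonInversions_subset_left (y := y) (by omega) (by omega) hs hy))
      (borelClosure_subset ((hs.symm.nonInversions_subset (by omega)).trans
        (subset_borelClosure _)))
  · obtain ⟨x, rfl⟩ := exists_fin_of_mem hl (x := x) (by simp)
    obtain ⟨y, rfl⟩ := exists_fin_of_mem hl (x := y) (by simp)
    obtain ⟨z, rfl⟩ := exists_fin_of_mem hl (x := z) (by simp)
    have hs := swapPositions_append (P := P ++ [(y : ℕ) + 1]) (Q := Q) (u := z) (v := x)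
      (by simpa using hl)
    simp only [List.append_assoc, List.cons_append, List.nil_append] at hs
    have hy : (P ++ ((y : ℕ) + 1) :: ((x : ℕ) + 1) :: ((z : ℕ) + 1) :: Q).idxOf ((y : ℕ) + 1) + 1 =
        (P ++ [(y : ℕ) + 1]).length := by
      have hyP : (y : ℕ) + 1 ∉ P := by
        rw [List.nodup_append] at hnd
        exact fun h => hnd.2.2 _ h _ (by simp) rfl
      rw [List.idxOf_append_of_notMem hyP, List.idxOf_cons_self]
      simp
    exact Set.Subset.antisymm
      (borelClosure_subset ((hs.nonInversions_subset (by omega)).trans (subset_borelClosure _)))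
      (borelClosure_subset (nonInversions_subset_right (y := y) (by omega) (by omega) hs.symm hy))

theorem Knuth.borelClosure_eq {n : ℕ} {l l' : List ℕ} (h : Knuth l l')
    (hl : l.Perm (List.range' 1 n)) :
    borelClosure (nonInversions (positions n l)) =
      borelClosure (nonInversions (positions n l')) := by
  induction h with
  | refl => rfl
  | tail h1 h2 ih => exact ih.trans (h2.borelClosure_eq ((Knuth.perm h1).symm.trans hl))

theorem borelClosure_nilIntersection {n : ℕ} {w : Equiv.Perm (Fin n)} {T : StdTableau n}
    (hw : w ∈ cell T) : borelClosure (nilIntersection w) =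
      borelClosure (nonInversions (positions n (reading T.cols))) := by
  rw [← positions_word, (knuth_word hw).borelClosure_eq (word_perm w)]

/-- Going up in weak order adds inversions and so shrinks the support, and Knuth invariance makes
the closure independent of the representatives. No bound on the number of columns is needed, so
arbitrary intermediate tableaux are allowed. -/
theorem dufloLE.borelClosure_subset {n : ℕ} {T S : StdTableau n} (h : dufloLE T S) :
    borelClosure (nonInversions (positions n (reading S.cols))) ⊆
      borelClosure (nonInversions (positions n (reading T.cols))) := by
  induction h with
  | refl => exact subset_rfl
  | tail _ h2 ih =>
    obtain ⟨w, hw, y, hy, hwy⟩ := h2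
    refine Set.Subset.trans ?_ ih
    rw [← borelClosure_nilIntersection hw, ← borelClosure_nilIntersection hy]
    refine YoungOrder.borelClosure_subset (Set.Subset.trans ?_ (subset_borelClosure _))
    intro X hX i j hij
    obtain ⟨h3, h4⟩ := hX i j hij
    refine ⟨h3, ?_⟩
    by_contra hc
    rcases lt_or_eq_of_le (not_lt.1 hc) with h5 | h5
    · exact (h4.trans (hwy i j h3 h5)).false
    · exact h3.ne' (w.symm.injective h5)

end YoungOrder

namespace YoungOrder

/-! ### Gaussian elimination along the arcs -/

/-- The path is level between the ends of the arc, so no other arc starts or ends there. Dropping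
both steps flattens the piece and leaves arcs elsewhere or around it intact. -/
theorem arc_remove_iff {h h' : ℕ → ℤ} {a b : ℕ} (hab : Arc h a b)
    (hflat : ∀ k, a < k → k ≤ b → h k = h a + 1)
    (h1 : ∀ k, a < k → k ≤ b → h' k = h k - 1) (h2 : ∀ k, ¬ (a < k ∧ k ≤ b) → h' k = h k)
    {p q : ℕ} : Arc h' p q ↔ Arc h p q ∧ q ≠ b := by
  have hlt := hab.1
  have hend := hab.2.1
  have hflat' : ∀ k, a ≤ k → k ≤ b + 1 → h' k = h a := by
    intro k hk hkb
    rcases (by omega : k = a ∨ k = b + 1 ∨ (a < k ∧ k ≤ b)) with rfl | rfl | ⟨h3, h4⟩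
    · exact h2 k (by omega)
    · rw [h2 _ (by omega), hend]
    · rw [h1 k h3 h4, hflat k h3 h4]
      ring
  constructor
  · intro H
    have hp : p < a ∨ b < p := by
      by_contra hc
      have := H.up
      rw [hflat' p (by omega) (by omega), hflat' (p + 1) (by omega) (by omega)] at this
      exact this.false
    have hq : q < a ∨ b < q := by
      by_contra hc
      have := H.down
      rw [hflat' q (by omega) (by omega), hflat' (q + 1) (by omega) (by omega)] at this
      exact this.false
    obtain ⟨h3, h4, h5⟩ := H
    rw [h2 _ (by omega), h2 _ (by omega)] at h4
    refine ⟨⟨h3, h4, fun k hk hkq => ?_⟩, by omega⟩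
    have h6 := h5 k hk hkq
    rw [h2 p (by omega)] at h6
    by_cases h7 : a < k ∧ k ≤ b
    · rw [h1 k h7.1 h7.2] at h6
      omega
    · rwa [h2 k h7] at h6
  · rintro ⟨H, hqb⟩
    have hp : p < a ∨ b < p := by
      by_contra hc
      rcases (by omega : p = a ∨ p = b ∨ (a < p ∧ p < b)) with rfl | rfl | h3
      · exact hqb (H.right_unique hab)
      · have := H.up
        have := hab.down
        omega
      · have := H.up
        rw [hflat p h3.1 (by omega), hflat (p + 1) (by omega) (by omega)] at this
        exact this.false
    have hq : q < a ∨ b < q := by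
      by_contra hc
      rcases (by omega : q = a ∨ (a < q ∧ q < b)) with rfl | h3
      · have := H.down
        have := hab.up
        omega
      · have := H.down
        rw [hflat q h3.1 (by omega), hflat (q + 1) (by omega) (by omega)] at this
        exact this.false
    obtain ⟨h3, h4, h5⟩ := H
    refine ⟨h3, by rw [h2 _ (by omega), h2 _ (by omega), h4], fun k hk hkq => ?_⟩
    rw [h2 p (by omega)]
    by_cases h7 : a < k ∧ k ≤ b
    · rw [hflat' k (by omega) (by omega)]
      exact h5 a (by omega) (by omega)
    · rw [h2 k h7]
      exact h5 k hk hkq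

/-- The arc that ends at the smallest entry of the second column can be removed. -/
theorem Ballot.remove_arc {b : ℕ} {A D : List ℕ} (H : Ballot A (b :: D)) :
    ∃ a ∈ A, a < b ∧ (∀ c ∈ A, c < b → c ≤ a) ∧ Ballot (A.erase a) D ∧
      Arc (pathOf A (b :: D)) a b ∧
      ∀ p q, Arc (pathOf (A.erase a) D) p q ↔ Arc (pathOf A (b :: D)) p q ∧ q ≠ b := by
  obtain ⟨a, ha⟩ := H.exists_arc (b := b) (by simp)
  have haA := ha.left_mem H
  have hlt := ha.1
  have hbD := List.pairwise_cons.1 H.right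
  have hmax : ∀ c ∈ A, c < b → c ≤ a := by
    intro c hc hcb
    by_contra hca
    have h1 := ha.2.2 c (by omega) (by omega)
    obtain ⟨d, hd, hcd⟩ := exists_arc_right (j := b + 1) (fun k => (H.step_le k).2)
      (H.up_iff.2 hc) (by omega) (by rw [ha.2.1]; exact h1.le)
    rcases List.mem_cons.1 (hcd.right_mem H) with rfl | h2
    · have := hcd.left_unique ha
      omega
    · have := hbD.1 d h2
      omega
  have hflat : ∀ k, a < k → k ≤ b → pathOf A (b :: D) k = pathOf A (b :: D) a + 1 := by
    intro k hk
    induction k, hk using Nat.le_induction with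
    | base =>
      intro _
      have := H.disj a haA
      rw [Nat.succ_eq_add_one, pathOf_succ, H.count_left, H.count_right, if_pos haA, if_neg this]
      simp
    | succ k hk ih =>
      intro hkb
      have h1 : k ∉ A := fun h => by
        have := hmax k h (by omega)
        omega
      have h2 : k ∉ b :: D := fun h => by
        rcases List.mem_cons.1 h with rfl | h
        · omega
        · have := hbD.1 k h
          omega
      rw [pathOf_succ, H.count_left, H.count_right, if_neg h1, if_neg h2, ih (by omega)]
      simp
  have hpath : ∀ k, pathOf (A.erase a) D k =
      pathOf A (b :: D) k - if a < k ∧ k ≤ b then 1 else 0 := by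
    intro k
    have h1 := (List.perm_cons_erase haA).countP_eq (· < k)
    simp only [pathOf]
    rw [h1]
    simp only [List.countP_cons, decide_eq_true_eq]
    split_ifs <;> push_cast <;> omega
  have h1 : ∀ k, a < k → k ≤ b → pathOf (A.erase a) D k = pathOf A (b :: D) k - 1 := by
    intro k hk hkb
    rw [hpath, if_pos ⟨hk, hkb⟩]
  have h2 : ∀ k, ¬ (a < k ∧ k ≤ b) → pathOf (A.erase a) D k = pathOf A (b :: D) k := by
    intro k hk
    rw [hpath, if_neg hk, sub_zero]
  refine ⟨a, haA, hlt, hmax, ⟨H.left.erase a, hbD.2, fun x hx hx' => ?_, fun k => ?_⟩, ha,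
    fun p q => arc_remove_iff ha hflat h1 h2⟩
  · exact H.disj x (List.mem_of_mem_erase hx) (by simp [hx'])
  · by_cases hk : a < k ∧ k ≤ b
    · rw [h1 k hk.1 hk.2, hflat k hk.1 hk.2]
      have := H.nonneg a
      omega
    · rw [h2 k hk]
      exact H.nonneg k

/-- The matrices with support in the rows `A` and the columns `D` above the diagonal, and with
the additional nonzero entries `P`. -/
def partialPattern {n : ℕ} (A D : List ℕ) (P : Fin n → Fin n → Prop) :
    Set (Matrix (Fin n) (Fin n) ℂ) :=
  {X | (∀ i j, X i j ≠ 0 → P i j ∨ ((i : ℕ) + 1 ∈ A ∧ (j : ℕ) + 1 ∈ D ∧ i < j)) ∧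
    ∀ i j, P i j → X i j ≠ 0}

/-- The matrices whose nonzero entries are at the places `P` and at the arcs of the path `h`. -/
def arcPattern {n : ℕ} (h : ℕ → ℤ) (P : Fin n → Fin n → Prop) : Set (Matrix (Fin n) (Fin n) ℂ) :=
  {X | ∀ i j, X i j ≠ 0 ↔ P i j ∨ Arc h ((i : ℕ) + 1) ((j : ℕ) + 1)}

/-- The orthogonality relations kill the unwanted products, so the conjugation acts as independent
row operations with row `a` and column operations with column `b`. -/
theorem conj_elimination {n : ℕ} {X : Matrix (Fin n) (Fin n) ℂ} {u v : Fin n → ℂ} {a b : Fin n}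
    (hu : u a = 0) (hv : v b = 0) (huv : v ⬝ᵥ u = 0) (hXu : X.mulVec u = 0)
    (hvX : Matrix.vecMul v X = 0) :
    ((1 + Matrix.vecMulVec u (Pi.single a 1)) * (1 - Matrix.vecMulVec (Pi.single b 1) v)) * X *
      ((1 + Matrix.vecMulVec (Pi.single b 1) v) * (1 - Matrix.vecMulVec u (Pi.single a 1))) =
      Matrix.of (fun i j => X i j + u i * X a j + X i b * v j + u i * X a b * v j) ∧
    ((1 + Matrix.vecMulVec (Pi.single b 1) v) * (1 - Matrix.vecMulVec u (Pi.single a 1))) *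
      ((1 + Matrix.vecMulVec u (Pi.single a 1)) * (1 - Matrix.vecMulVec (Pi.single b 1) v)) = 1 := by
  set L := Matrix.vecMulVec u (Pi.single a 1 : Fin n → ℂ) with hL
  set K := Matrix.vecMulVec (Pi.single b 1 : Fin n → ℂ) v with hK
  have hLL : L * L = 0 := by
    rw [hL, Matrix.vecMulVec_mul_vecMulVec, single_one_dotProduct, hu, zero_smul,
      Matrix.vecMulVec_zero]
  have hKK : K * K = 0 := by
    rw [hK, Matrix.vecMulVec_mul_vecMulVec, dotProduct_single_one, hv, zero_smul,
      Matrix.vecMulVec_zero]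
  have hKL : K * L = 0 := by
    rw [hK, hL, Matrix.vecMulVec_mul_vecMulVec, huv, zero_smul, Matrix.vecMulVec_zero]
  have hXL : X * L = 0 := by
    rw [hL, Matrix.mul_vecMulVec, hXu, Matrix.zero_vecMulVec]
  have hKX : K * X = 0 := by
    rw [hK, Matrix.vecMulVec_mul, hvX, Matrix.vecMulVec_zero]
  constructor
  · have h1 : (1 + L) * (1 - K) * X = (1 + L) * X := by
      rw [mul_assoc, sub_mul, hKX, one_mul, sub_zero]
    have h2 : (1 + L) * X * ((1 + K) * (1 - L)) = (1 + L) * X * (1 + K) := by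
      have h3 : (1 + K) * (1 - L) = 1 + K - L := by
        rw [add_mul, mul_sub, mul_sub, hKL]
        simp
        abel
      rw [h3, mul_sub, mul_assoc (1 + L) X L, hXL, mul_zero, sub_zero]
    rw [h1, h2]
    ext i j
    have e1 : ∀ k, ((1 + L) * X) i k = X i k + u i * X a k := by
      intro k
      rw [add_mul, one_mul, Matrix.add_apply, hL, Matrix.vecMulVec_mul, Matrix.vecMulVec_apply,
        Matrix.single_one_vecMul]
      rfl
    rw [mul_add, mul_one, Matrix.add_apply, hK, Matrix.mul_vecMulVec, Matrix.vecMulVec_apply,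
      Matrix.mulVec_single_one, e1, Matrix.of_apply]
    show _ + ((1 + L) * X) i b * v j = _
    rw [e1]
    ring
  · have h1 : (1 - L) * (1 + L) = 1 := by
      rw [sub_mul, mul_add, mul_add, hLL]
      simp
    have h2 : (1 + K) * (1 - K) = 1 := by
      rw [add_mul, mul_sub, mul_sub, hKK]
      simp
    rw [mul_assoc, ← mul_assoc (1 - L), h1, one_mul, h2]

/-- One elimination step with pivot at the arc `(a₀, b₀)`, made nonzero by passing to the closure.
Here `b₀` is the first remaining column and `a₀` the last row that can meet it, so clearing the rest
of row `a₀` and of column `b₀` takes only upper triangular operations. Earlier pivots lie in other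
rows and columns and survive. -/
theorem partialPattern_step {n : ℕ} {b : ℕ} {A D : List ℕ} {P : Fin n → Fin n → Prop}
    (H : Ballot A (b :: D)) (hP : ∀ i j, P i j → ((i : ℕ) + 1 ∉ A ∧ (i : ℕ) + 1 ∉ b :: D) ∧
      ((j : ℕ) + 1 ∉ A ∧ (j : ℕ) + 1 ∉ b :: D)) {a₀ b₀ : Fin n} (hb₀ : (b₀ : ℕ) + 1 = b)
    (ha₀ : (a₀ : ℕ) + 1 ∈ A) (hab : a₀ < b₀)
    (hmax : ∀ c ∈ A, c < b → c ≤ (a₀ : ℕ) + 1) :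
    partialPattern A (b :: D) P ⊆ borelClosure (partialPattern (A.erase ((a₀ : ℕ) + 1)) D
      fun i j => P i j ∨ (i = a₀ ∧ j = b₀)) := by
  subst hb₀
  have hbD := List.pairwise_cons.1 H.right
  intro X hX
  refine mem_zariskiClosure_of_line (a := a₀) (b := b₀) fun s hs => ?_
  have hX' : X + Matrix.single a₀ b₀ s ∈ partialPattern A (((b₀ : ℕ) + 1) :: D) P := by
    refine ⟨fun i j hij => ?_, fun i j hij => ?_⟩
    · by_cases h : a₀ = i ∧ b₀ = j
      · right
        rw [← h.1, ← h.2]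
        exact ⟨ha₀, by simp, hab⟩
      · rw [Matrix.add_apply, Matrix.single_apply, if_neg h, add_zero] at hij
        exact hX.1 i j hij
    · have h : ¬ (a₀ = i ∧ b₀ = j) := fun h => (hP i j hij).1.1 (h.1 ▸ ha₀)
      rw [Matrix.add_apply, Matrix.single_apply, if_neg h, add_zero]
      exact hX.2 i j hij
  have hne : (X + Matrix.single a₀ b₀ s) a₀ b₀ ≠ 0 := by simpa using hs
  generalize X + Matrix.single a₀ b₀ s = X at hX' hne
  obtain ⟨h1, h2⟩ := hX'
  have hcol : ∀ i j, X i j ≠ 0 → (i : ℕ) + 1 ∈ A → (j : ℕ) + 1 ∈ ((b₀ : ℕ) + 1) :: D ∧ i < j :=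
    fun i j hij hi => ((h1 i j hij).resolve_left fun h => (hP i j h).1.1 hi).2
  have hrow : ∀ i j, X i j ≠ 0 → (j : ℕ) + 1 ∈ ((b₀ : ℕ) + 1) :: D → (i : ℕ) + 1 ∈ A ∧ i < j :=
    fun i j hij hj => by
      have := (h1 i j hij).resolve_left fun h => (hP i j h).2.2 hj
      exact ⟨this.1, this.2.2⟩
  have hcolA : ∀ i j : Fin n, (j : ℕ) + 1 ∈ A → X i j = 0 := fun i j hj => by
    by_contra hc
    rcases h1 i j hc with h | h
    · exact (hP i j h).2.1 hj
    · exact H.disj _ hj h.2.1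
  have hrowD : ∀ i j : Fin n, (i : ℕ) + 1 ∈ ((b₀ : ℕ) + 1) :: D → X i j = 0 := fun i j hi => by
    by_contra hc
    rcases h1 i j hc with h | h
    · exact (hP i j h).1.2 hi
    · exact H.disj _ h.1 hi
  -- These are the multipliers clearing column `b₀` and row `a₀`; they vanish at the pivot itself.
  let u : Fin n → ℂ := fun i => if i = a₀ then 0 else -(X i b₀ / X a₀ b₀)
  let v : Fin n → ℂ := fun j => if j = b₀ then 0 else -(X a₀ j / X a₀ b₀)
  have hu : ∀ i, u i ≠ 0 → i ≠ a₀ ∧ X i b₀ ≠ 0 := by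
    intro i hi
    simp only [u] at hi
    split_ifs at hi with h
    · exact absurd rfl hi
    · exact ⟨h, fun h' => hi (by rw [h', zero_div, neg_zero])⟩
  have hv : ∀ j, v j ≠ 0 → j ≠ b₀ ∧ X a₀ j ≠ 0 := by
    intro j hj
    simp only [v] at hj
    split_ifs at hj with h
    · exact absurd rfl hj
    · exact ⟨h, fun h' => hj (by rw [h', zero_div, neg_zero])⟩
  have huA : ∀ i, u i ≠ 0 → (i : ℕ) + 1 ∈ A ∧ i < a₀ := by
    intro i hi
    obtain ⟨h3, h4⟩ := hu i hi
    obtain ⟨h5, h6⟩ := hrow i b₀ h4 (by simp)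
    have := hmax _ h5 (by omega)
    have : (i : ℕ) ≠ a₀ := fun h => h3 (Fin.ext h)
    exact ⟨h5, by omega⟩
  have hvD : ∀ j, v j ≠ 0 → (j : ℕ) + 1 ∈ ((b₀ : ℕ) + 1) :: D ∧ b₀ < j := by
    intro j hj
    obtain ⟨h3, h4⟩ := hv j hj
    obtain ⟨h5, h6⟩ := hcol a₀ j h4 ha₀
    refine ⟨h5, ?_⟩
    rcases List.mem_cons.1 h5 with h7 | h7
    · exact absurd (Fin.ext (by omega)) h3
    · have := hbD.1 _ h7
      omega
  obtain ⟨hconj, hinv⟩ := conj_elimination (X := X) (u := u) (v := v) (a := a₀) (b := b₀)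
    (by simp [u]) (by simp [v])
    (Finset.sum_eq_zero fun i _ => by
      by_contra hc
      exact H.disj _ (huA i (right_ne_zero_of_mul hc)).1 (hvD i (left_ne_zero_of_mul hc)).1)
    (funext fun i => by
      show ∑ j, X i j * u j = 0
      refine Finset.sum_eq_zero fun j _ => ?_
      by_contra hc
      exact left_ne_zero_of_mul hc (hcolA i j (huA j (right_ne_zero_of_mul hc)).1))
    (funext fun j => by
      show ∑ i, v i * X i j = 0
      refine Finset.sum_eq_zero fun i _ => ?_
      by_contra hc
      exact right_ne_zero_of_mul hc (hrowD i j (hvD i (left_ne_zero_of_mul hc)).1))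
  refine conj_mem_borelClosure hinv ?_ (hconj ▸ ?_)
  · refine Matrix.BlockTriangular.mul (fun i j hij => ?_) (fun i j hij => ?_)
    · have hij' : j < i := hij
      rw [Matrix.add_apply, Matrix.one_apply_ne hij'.ne', zero_add, Matrix.vecMulVec_apply]
      by_contra hc
      have h3 := (hvD j (right_ne_zero_of_mul hc)).2
      have h4 : i = b₀ := by
        by_contra h
        exact left_ne_zero_of_mul hc (Pi.single_eq_of_ne h _)
      omega
    · have hij' : j < i := hij
      rw [Matrix.sub_apply, Matrix.one_apply_ne hij'.ne', zero_sub, Matrix.vecMulVec_apply,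
        neg_eq_zero]
      by_contra hc
      have h3 := (huA i (left_ne_zero_of_mul hc)).2
      have h4 : j = a₀ := by
        by_contra h
        exact right_ne_zero_of_mul hc (Pi.single_eq_of_ne h _)
      omega
  · have hA : A.Nodup := H.left.imp ne_of_lt
    refine ⟨fun i j hij => ?_, fun i j hij => ?_⟩
    · rw [Matrix.of_apply] at hij
      by_cases hi : i = a₀
      · subst hi
        by_cases hj : j = b₀
        · exact .inl (.inr ⟨rfl, hj⟩)
        · exfalso
          apply hij
          simp only [u, v, if_pos, if_neg hj]
          field_simp
          ring
      · by_cases hj : j = b₀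
        · exfalso
          subst hj
          apply hij
          simp only [u, v, if_pos, if_neg hi]
          field_simp
          ring
        · have key : ∀ k l, X k l ≠ 0 → k ≠ a₀ → l ≠ b₀ → P k l ∨
              ((k : ℕ) + 1 ∈ A.erase ((a₀ : ℕ) + 1) ∧ (l : ℕ) + 1 ∈ D ∧ k < l) := by
            intro k l hkl hk hl
            rcases h1 k l hkl with h | ⟨h3, h4, h5⟩
            · exact .inl h
            · refine .inr ⟨?_, ?_, h5⟩
              · rw [hA.mem_erase_iff]
                exact ⟨fun h => hk (Fin.ext (by omega)), h3⟩
              · exact (List.mem_cons.1 h4).resolve_left fun h => hl (Fin.ext (by omega))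
          -- Fill-in occurs only where row `i` meets column `b₀` and column `j` meets row `a₀`. Then
          -- `i ≤ a₀ < j` by maximality of `a₀`, so it stays above the diagonal.
          by_cases hXij : X i j = 0
          · have h3 : X i b₀ ≠ 0 := by
              intro h
              apply hij
              simp [u, v, hi, hj, hXij, h]
            have h4 : X a₀ j ≠ 0 := by
              intro h
              apply hij
              simp [u, v, hi, hj, hXij, h]
            have h5 := hrow i b₀ h3 (by simp)
            have h6 := hcol a₀ j h4 ha₀
            refine .inr ⟨?_, (List.mem_cons.1 h6.1).resolve_left fun h => hj (Fin.ext (by omega)), ?_⟩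
            · rw [hA.mem_erase_iff]
              exact ⟨fun h => hi (Fin.ext (by omega)), h5.1⟩
            · have := hmax _ h5.1 (by omega)
              have := h6.2
              omega
          · rcases key i j hXij hi hj with h | h
            · exact .inl (.inl h)
            · exact .inr h
    · rw [Matrix.of_apply]
      rcases hij with hij | ⟨rfl, rfl⟩
      · have h3 : u i = 0 := by
          by_contra h
          exact (hP i j hij).1.1 (huA i h).1
        have h4 : v j = 0 := by
          by_contra h
          exact (hP i j hij).2.2 (hvD j h).1
        rw [h3, h4]
        simpa using h2 i j hij
      · simpa [u, v] using hne

theorem partialPattern_subset {n : ℕ} {A D : List ℕ} {P : Fin n → Fin n → Prop}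
    (H : Ballot A D) (hD : ∀ x ∈ D, x ≤ n) (hA : ∀ x ∈ A, 1 ≤ x)
    (hP : ∀ i j, P i j → ((i : ℕ) + 1 ∉ A ∧ (i : ℕ) + 1 ∉ D) ∧
      ((j : ℕ) + 1 ∉ A ∧ (j : ℕ) + 1 ∉ D)) :
    partialPattern A D P ⊆ borelClosure (arcPattern (pathOf A D) P) := by
  induction D generalizing A P with
  | nil =>
    refine Set.Subset.trans (fun X hX => fun i j => ?_) (subset_borelClosure _)
    constructor
    · intro hij
      rcases hX.1 i j hij with h | h
      · exact .inl h
      · simp at h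
    · rintro (h | h)
      · exact hX.2 i j h
      · simpa using h.right_mem H
  | cons b D ih =>
    obtain ⟨a, haA, hlt, hmax, hB, harc, hiff⟩ := H.remove_arc
    have hbn := hD b (by simp)
    have ha1 := hA a haA
    obtain ⟨a₀, rfl⟩ : ∃ a₀ : Fin n, (a₀ : ℕ) + 1 = a := ⟨⟨a - 1, by omega⟩, by simp; omega⟩
    obtain ⟨b₀, rfl⟩ : ∃ b₀ : Fin n, (b₀ : ℕ) + 1 = b := ⟨⟨b - 1, by omega⟩, by simp; omega⟩
    refine (partialPattern_step H hP rfl haA (by omega) hmax).trans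
      (borelClosure_subset ((ih hB (fun x hx => hD x (by simp [hx]))
        (fun x hx => hA x (List.mem_of_mem_erase hx)) ?_).trans ?_))
    · have hAn : A.Nodup := H.left.imp ne_of_lt
      have hbD : (b₀ : ℕ) + 1 ∉ D := fun h => ((List.pairwise_cons.1 H.right).1 _ h).false
      have haD : (a₀ : ℕ) + 1 ∉ D := fun h => H.disj _ haA (by simp [h])
      have hbA : (b₀ : ℕ) + 1 ∉ A := fun h => H.disj _ h (by simp)
      rintro i j (h | ⟨rfl, rfl⟩)
      · obtain ⟨⟨h1, h2⟩, h3, h4⟩ := hP i j h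
        exact ⟨⟨fun h => h1 (List.mem_of_mem_erase h), fun h => h2 (by simp [h])⟩,
          fun h => h3 (List.mem_of_mem_erase h), fun h => h4 (by simp [h])⟩
      · exact ⟨⟨fun h => (hAn.mem_erase_iff.1 h).1 rfl, haD⟩,
          fun h => hbA (List.mem_of_mem_erase h), hbD⟩
    · refine zariskiClosure_mono (conjugates_mono subset_rfl fun X hX i j => ?_)
      rw [hX i j, hiff]
      constructor
      · rintro ((h | ⟨rfl, rfl⟩) | h)
        · exact .inl h
        · exact .inr harc
        · exact .inr h.1
      · rintro (h | h)
        · exact .inl (.inl h)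
        · by_cases hj : (j : ℕ) + 1 = (b₀ : ℕ) + 1
          · rw [hj] at h
            have := h.left_unique harc
            exact .inl (.inr ⟨Fin.ext (by omega), Fin.ext (by omega)⟩)
          · exact .inr ⟨h, hj⟩

end YoungOrder

namespace YoungOrder

/-! ### Orbital varieties of tableaux with two columns -/

theorem lt_of_idxOf_lt {l : List ℕ} (hl : l.Pairwise (· > ·)) {u v : ℕ} (hu : u ∈ l) (hv : v ∈ l)
    (h : l.idxOf u < l.idxOf v) : v < u := by
  have := List.pairwise_iff_getElem.1 hl _ _ (List.idxOf_lt_length_of_mem hu)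
    (List.idxOf_lt_length_of_mem hv) h
  simpa using this

variable {n : ℕ} {C D : List ℕ}

/-- Each column is read downwards in size, so a non-inversion must join an entry of the first column
to a larger one of the second. -/
theorem TwoCol.nonInversions_subset (H : TwoCol n C D) :
    nonInversions (positions n (C.reverse ++ D.reverse)) ⊆
      partialPattern C D fun _ _ => False := by
  intro X hX
  refine ⟨fun i j hij => .inr ?_, fun i j h => h.elim⟩
  obtain ⟨h1, h2⟩ := hX i j hij
  have hmem : ∀ t : Fin n, (t : ℕ) + 1 ∈ C ∨ (t : ℕ) + 1 ∈ D := fun t => H.mem_iff.2 (by omega)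
  have hposD : ∀ t : Fin n, (t : ℕ) + 1 ∈ D →
      positions n (C.reverse ++ D.reverse) t = D.reverse.idxOf ((t : ℕ) + 1) + C.length := by
    intro t ht
    rw [positions, List.idxOf_append_of_notMem, List.length_reverse, add_comm]
    rw [List.mem_reverse]
    exact fun h => H.disj _ h ht
  have hposC : ∀ t : Fin n, (t : ℕ) + 1 ∈ C →
      positions n (C.reverse ++ D.reverse) t = C.reverse.idxOf ((t : ℕ) + 1) := by
    intro t ht
    rw [positions, List.idxOf_append_of_mem (by simpa using ht)]
  have hlC : ∀ t : Fin n, (t : ℕ) + 1 ∈ C → C.reverse.idxOf ((t : ℕ) + 1) < C.length := by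
    intro t ht
    simpa using List.idxOf_lt_length_of_mem (l := C.reverse) (a := (t : ℕ) + 1) (by simpa using ht)
  rcases hmem i with hi | hi <;> rcases hmem j with hj | hj
  · rw [hposC i hi, hposC j hj] at h2
    have := lt_of_idxOf_lt (List.pairwise_reverse.2 H.left) (by simpa using hi) (by simpa using hj) h2
    omega
  · exact ⟨hi, hj, h1⟩
  · rw [hposD i hi, hposC j hj] at h2
    have := hlC j hj
    omega
  · rw [hposD i hi, hposD j hj] at h2
    have := lt_of_idxOf_lt (List.pairwise_reverse.2 H.right) (by simpa using hi) (by simpa using hj)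
      (by omega)
    omega

theorem TwoCol.arcPattern_subset (H : TwoCol n C D) :
    arcPattern (pathOf C D) (fun _ _ => False) ⊆
      nonInversions (positions n (C.reverse ++ D.reverse)) := by
  intro X hX i j hij
  have h := ((hX i j).1 hij).resolve_left id
  have hi := h.left_mem H.toBallot
  have hj := h.right_mem H.toBallot
  have hjC : (j : ℕ) + 1 ∉ C := fun h => H.disj _ h hj
  have h1 := List.idxOf_lt_length_of_mem (l := C.reverse) (a := (i : ℕ) + 1) (by simpa using hi)
  have := h.1
  refine ⟨by omega, ?_⟩
  rw [positions, positions, List.idxOf_append_of_mem (by simpa using hi),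
    List.idxOf_append_of_notMem (by simpa using hjC)]
  omega

theorem TwoCol.borelClosure_reading (H : TwoCol n C D) {T : StdTableau n} (hT : T.cols = tab C D) :
    borelClosure (nonInversions (positions n (reading T.cols))) =
      borelClosure (arcPattern (pathOf C D) fun _ _ => False) := by
  rw [hT, reading_tab]
  refine Set.Subset.antisymm (borelClosure_subset (H.nonInversions_subset.trans
    (partialPattern_subset H.toBallot (fun x hx => (H.mem_iff.1 (.inr hx)).2)
      (fun x hx => (H.mem_iff.1 (.inl hx)).1) fun i j h => h.elim)))
    (borelClosure_subset (H.arcPattern_subset.trans (subset_borelClosure _)))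

/-- Two matrices with the same arcs as nonzero entries are conjugate under the torus. -/
theorem mem_conjugates_of_arcPattern {h : ℕ → ℤ} {X Y : Matrix (Fin n) (Fin n) ℂ}
    (hX : X ∈ arcPattern h fun _ _ => False) (hY : Y ∈ arcPattern h fun _ _ => False) :
    Y ∈ conjugates (borel n) {X} := by
  classical
  -- The torus entry at the left end of an arc is the ratio of the two matrix entries, and it is `1`
  -- elsewhere. A right end is never a left end, so these choices do not interfere.
  let t : Fin n → ℂ := fun i =>
    if hi : ∃ j : Fin n, Arc h ((i : ℕ) + 1) ((j : ℕ) + 1) then Y i hi.choose / X i hi.choose else 1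
  have hX0 : ∀ i j : Fin n, Arc h ((i : ℕ) + 1) ((j : ℕ) + 1) → X i j ≠ 0 :=
    fun i j hij => (hX i j).2 (.inr hij)
  have hY0 : ∀ i j : Fin n, Arc h ((i : ℕ) + 1) ((j : ℕ) + 1) → Y i j ≠ 0 :=
    fun i j hij => (hY i j).2 (.inr hij)
  have ht : ∀ i, t i ≠ 0 := by
    intro i
    simp only [t]
    split_ifs with hi
    · exact div_ne_zero (hY0 _ _ hi.choose_spec) (hX0 _ _ hi.choose_spec)
    · exact one_ne_zero
  have hval : ∀ i j : Fin n, Arc h ((i : ℕ) + 1) ((j : ℕ) + 1) → t i = Y i j / X i j := by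
    intro i j hij
    have hi : ∃ j : Fin n, Arc h ((i : ℕ) + 1) ((j : ℕ) + 1) := ⟨j, hij⟩
    have : hi.choose = j := Fin.ext (by
      have := hi.choose_spec.right_unique hij
      omega)
    simp only [t, dif_pos hi, this]
  have hend : ∀ i j : Fin n, Arc h ((i : ℕ) + 1) ((j : ℕ) + 1) → t j = 1 := by
    intro i j hij
    refine dif_neg ?_
    rintro ⟨k, hk⟩
    have := hk.up
    have := hij.down
    omega
  have hconj : Matrix.diagonal t * X * Matrix.diagonal (fun i => (t i)⁻¹) = Y := by
    ext i j
    rw [Matrix.mul_diagonal, Matrix.diagonal_mul]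
    by_cases hij : Arc h ((i : ℕ) + 1) ((j : ℕ) + 1)
    · rw [hval i j hij, hend i j hij, inv_one, mul_one, div_mul_cancel₀ _ (hX0 i j hij)]
    · have h1 : X i j = 0 := by
        by_contra hc
        exact hij (((hX i j).1 hc).resolve_left id)
      have h2 : Y i j = 0 := by
        by_contra hc
        exact hij (((hY i j).1 hc).resolve_left id)
      rw [h1, h2]
      ring
  rw [← hconj]
  refine mem_conjugates_borel ?_ (Matrix.blockTriangular_diagonal _) rfl
  rw [Matrix.diagonal_mul_diagonal, ← Matrix.diagonal_one]
  congr 1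
  funext i
  exact mul_inv_cancel₀ (ht i)

/-- The matrices supported exactly at the arcs form a single torus class up to Borel conjugation,
and their Borel conjugates are dense in the closure attached to `w`. Hence each such conjugate
generates the closure of `G(𝔫 ∩ ʷ𝔫)`, that is, it lies in the orbit of `w`. -/
theorem TwoCol.closure_orbitalVariety (H : TwoCol n C D) {T : StdTableau n}
    (hT : T.cols = tab C D) {w : Equiv.Perm (Fin n)} (hw : w ∈ cell T) :
    zariskiClosure (orbitalVariety w) =
      borelClosure (arcPattern (pathOf C D) fun _ _ => False) := by
  have hcl := (borelClosure_nilIntersection hw).trans (H.borelClosure_reading hT)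
  have huniv : borelClosure (nilIntersection w) ⊆
      zariskiClosure (conjugates Set.univ (nilIntersection w)) :=
    zariskiClosure_mono (conjugates_mono (Set.subset_univ _) subset_rfl)
  refine Set.Subset.antisymm ?_ ?_
  · refine zariskiClosure_subset (Set.inter_subset_left.trans ?_)
    exact hcl.subset
  · refine zariskiClosure_mono ?_
    rintro Y hY
    have hYcl : Y ∈ borelClosure (nilIntersection w) := by
      rw [hcl]
      exact subset_zariskiClosure _ hY
    refine ⟨hYcl, ?_⟩
    obtain ⟨g, hg, X, hX, hYX⟩ := hY
    refine Set.Subset.antisymm ?_ ?_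
    · refine zariskiClosure_subset (conjugates_subset_zariskiClosure (fun _ _ _ _ => trivial) ?_)
      rintro _ rfl
      exact huniv hYcl
    · refine zariskiClosure_subset (conjugates_subset_zariskiClosure (fun _ _ _ _ => trivial) ?_)
      refine ((subset_borelClosure _).trans hcl.subset).trans (zariskiClosure_mono ?_)
      rintro V ⟨k, hk, Z, hZ, rfl⟩
      obtain ⟨g', hg', _, rfl, rfl⟩ := mem_conjugates_of_arcPattern hX hZ
      refine ⟨k * g' * g⁻¹, trivial, Y, rfl, ?_⟩
      have h1 : ((g⁻¹ : Matrix.SpecialLinearGroup (Fin n) ℂ) : Matrix (Fin n) (Fin n) ℂ) *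
          (g : Matrix (Fin n) (Fin n) ℂ) = 1 := by
        rw [← Matrix.SpecialLinearGroup.coe_mul, inv_mul_cancel, Matrix.SpecialLinearGroup.coe_one]
      rw [hYX, mul_inv_rev, mul_inv_rev, inv_inv]
      simp only [Matrix.SpecialLinearGroup.coe_mul, mul_assoc]
      rw [← mul_assoc ((g⁻¹ : Matrix.SpecialLinearGroup (Fin n) ℂ) : Matrix (Fin n) (Fin n) ℂ)
          (g : Matrix (Fin n) (Fin n) ℂ), h1, one_mul,
        ← mul_assoc ((g⁻¹ : Matrix.SpecialLinearGroup (Fin n) ℂ) : Matrix (Fin n) (Fin n) ℂ)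
          (g : Matrix (Fin n) (Fin n) ℂ), h1, one_mul]

/-! ### Ranks of corners -/

/-- Large minors of the south-west corners vanish on the orbits of the matrices supported at
arcs. -/
theorem det_submatrix_eq_zero {h : ℕ → ℤ} {i j : ℕ} {ι : Type} [Fintype ι] [DecidableEq ι]
    {r c : ι → Fin n} (hr : ∀ s, i ≤ (r s : ℕ) + 1) (hc : ∀ s, (c s : ℕ) + 1 ≤ j)
    (hcard : (arcEnds h i j).card < Fintype.card ι) {Y : Matrix (Fin n) (Fin n) ℂ}
    (hY : Y ∈ borelClosure (arcPattern h fun _ _ => False)) : (Y.submatrix r c).det = 0 := by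
  have hpoly : ∀ Z : Matrix (Fin n) (Fin n) ℂ, MvPolynomial.eval (fun ij => Z ij.1 ij.2)
      (Matrix.det (Matrix.of fun s t => (MvPolynomial.X (r s, c t) :
        MvPolynomial (Fin n × Fin n) ℂ))) = (Z.submatrix r c).det := by
    intro Z
    rw [RingHom.map_det]
    congr 1
    ext s t
    simp
  rw [← hpoly]
  refine hY _ ?_
  rintro Z ⟨g, hg, X, hX, rfl⟩
  rw [hpoly]
  by_contra hdet
  set g' := ((g⁻¹ : Matrix.SpecialLinearGroup (Fin n) ℂ) : Matrix (Fin n) (Fin n) ℂ) with hg'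
  set G := (g : Matrix (Fin n) (Fin n) ℂ) with hG
  let ρ := {k : Fin n // (k : ℕ) + 1 ∈ arcEnds h i j}
  -- By triangularity of `g` and its inverse, only entries of `X` in rows from `i` on and columns up
  -- to `j` contribute. The corner therefore factors through the columns that end an arc in `[i,
  -- j]`, which bounds its rank.
  have hfac : (G * X * g').submatrix r c =
      Matrix.of (fun s (k : ρ) => (G * X) (r s) k.1) *
        Matrix.of (fun (k : ρ) t => g' k.1 (c t)) := by
    ext s t
    rw [Matrix.submatrix_apply, Matrix.mul_apply, Matrix.mul_apply]
    simp only [Matrix.of_apply]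
    rw [← Finset.sum_subtype {k : Fin n | (k : ℕ) + 1 ∈ arcEnds h i j} (by simp)
      (fun k => (G * X) (r s) k * g' k (c t))]
    refine (Finset.sum_subset (Finset.subset_univ _) fun k _ hk => ?_).symm
    by_contra hne
    refine hk (Finset.mem_filter.2 ⟨Finset.mem_univ _, ?_⟩)
    have hGX : ∑ l, G (r s) l * X l k ≠ 0 := left_ne_zero_of_mul hne
    obtain ⟨l, -, hl⟩ := Finset.exists_ne_zero_of_sum_ne_zero hGX
    have harc := ((hX l k).1 (right_ne_zero_of_mul hl)).resolve_left id
    have h1 : r s ≤ l := by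
      by_contra hlt
      exact left_ne_zero_of_mul hl (hg _ _ (not_le.1 hlt))
    have h2 : k ≤ c t := by
      by_contra hlt
      exact right_ne_zero_of_mul hne (inv_mem_borel hg _ _ (not_le.1 hlt))
    have h3 := hr s
    have h4 := hc t
    exact mem_arcEnds.2 ⟨by omega, _, by omega, harc⟩
  have h1 : (Fintype.card ι) ≤ Fintype.card ρ := by
    rw [← Matrix.rank_of_isUnit _ ((Matrix.isUnit_iff_isUnit_det _).2 (isUnit_iff_ne_zero.2 hdet)),
      hfac]
    exact (Matrix.rank_mul_le_left _ _).trans (Matrix.rank_le_card_width _)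
  have h2 : Fintype.card ρ ≤ (arcEnds h i j).card := by
    rw [← Fintype.card_coe]
    refine Fintype.card_le_of_injective (fun k : ρ => (⟨(k.1 : ℕ) + 1, k.2⟩ : arcEnds h i j)) ?_
    intro k l hkl
    have := congrArg Subtype.val hkl
    simp only [Nat.add_right_cancel_iff] at this
    exact Subtype.ext (Fin.ext this)
  omega

/-- The zero-one matrix of the arcs has an identity minor on the arcs inside `[i, j]`. Too few arcs
of `h` there would force this minor to vanish. -/
theorem card_arcEnds_le_of_borelClosure {C' D' : List ℕ} (H' : TwoCol n C' D') {h : ℕ → ℤ}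
    (hsub : borelClosure (arcPattern (n := n) (pathOf C' D') fun _ _ => False) ⊆
      borelClosure (arcPattern h fun _ _ => False)) (i j : ℕ) :
    (arcEnds (pathOf C' D') i j).card ≤ (arcEnds h i j).card := by
  classical
  by_contra! hlt
  have hex : ∀ b : arcEnds (pathOf C' D') i j, ∃ a₀ b₀ : Fin n, (b₀ : ℕ) + 1 = b.1 ∧
      i ≤ (a₀ : ℕ) + 1 ∧ Arc (pathOf C' D') ((a₀ : ℕ) + 1) ((b₀ : ℕ) + 1) := by
    rintro ⟨b, hb⟩
    obtain ⟨-, a, ha, hab⟩ := mem_arcEnds.1 hb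
    have := H'.isPath.arc_mem hab
    have := hab.1
    refine ⟨⟨a - 1, by omega⟩, ⟨b - 1, by omega⟩, ?_, ?_, ?_⟩
    · simp
      omega
    · simp
      omega
    · simpa [show a - 1 + 1 = a by omega, show b - 1 + 1 = b by omega] using hab
  choose r c hc hr hrc using hex
  let N : Matrix (Fin n) (Fin n) ℂ := Matrix.of fun a b =>
    if Arc (pathOf C' D') ((a : ℕ) + 1) ((b : ℕ) + 1) then 1 else 0
  have hN : N ∈ arcPattern (pathOf C' D') fun _ _ => False := by
    intro a b
    simp [N]
  have hdet := det_submatrix_eq_zero (r := r) (c := c) hr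
    (fun s => by rw [hc]; exact (mem_arcEnds.1 s.2).1) (by simpa using hlt)
    (hsub (subset_borelClosure _ hN))
  have hone : N.submatrix r c = 1 := by
    ext s t
    rw [Matrix.submatrix_apply, Matrix.one_apply]
    by_cases hst : s = t
    · subst hst
      simp [N, hrc s]
    · rw [if_neg hst]
      refine if_neg fun hh => hst (Subtype.ext ?_)
      rw [← hc s, ← hc t]
      exact (hrc s).right_unique hh
  rw [hone, Matrix.det_one] at hdet
  exact one_ne_zero hdet

/-! ### The three orders on tableaux with two columns -/

/-- The lattice path of a tableau with two columns. -/
def StdTableau.path (T : StdTableau n) : ℕ → ℤ := pathOf (col₁ T) (col₂ T)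

theorem StdTableau.ext_path {T S : StdTableau n} (hT : T ∈ twoColumn n) (hS : S ∈ twoColumn n)
    (h : T.path = S.path) : T = S := by
  obtain ⟨H, hT⟩ := T.twoCol hT
  obtain ⟨H', hS⟩ := S.twoCol hS
  obtain ⟨h1, h2⟩ := H.ext H' h
  ext1
  rw [hT, hS, h1, h2]

theorem StdTableau.eq_of_arc_iff {T S : StdTableau n} (hT : T ∈ twoColumn n)
    (hS : S ∈ twoColumn n) (h : ∀ a b, Arc T.path a b ↔ Arc S.path a b) : T = S :=
  StdTableau.ext_path hT hS ((T.twoCol hT).1.isPath.eq_of_arc_iff (S.twoCol hS).1.isPath h)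

/-- The tableau `T⟨x⟩` for an outer entry `x`. -/
theorem StdTableau.exists_move {T : StdTableau n} (hT : T ∈ twoColumn n) {m x : ℕ}
    (ho : Outer T.path x) (hm : Arc T.path m x) :
    ∃ S ∈ twoColumn n, S.cols = moveToFirst T x ∧ dufloLE T S ∧
      (col₂ S).length < (col₂ T).length ∧
      ∀ a b, Arc S.path a b ↔ Arc T.path a b ∧ b ≠ x := by
  obtain ⟨H, hT⟩ := T.twoCol hT
  obtain ⟨S, hS, hSc, hS1, hS2⟩ := (H.move ho).exists_tableau
  have hx : x ∈ col₂ T := H.down_iff.1 ho.1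
  refine ⟨S, hS, hSc, H.dufloLE_move ho hT hSc, ?_, fun a b => ?_⟩
  · rw [hS2, List.length_erase_of_mem hx]
    have := List.length_pos_of_mem hx
    omega
  · rw [StdTableau.path, hS1, hS2, pathOf_move hx]
    exact arc_raise_iff (fun k => (H.step_le k).2) ho hm

/-- Outer arcs absent from `S` are removed one by one, each by a Duflo step that shortens the second
column. -/
theorem dufloLE_of_arc_subset {S : StdTableau n} (hS : S ∈ twoColumn n) (l : ℕ) :
    ∀ T ∈ twoColumn n, (col₂ T).length = l → (∀ a b, Arc S.path a b → Arc T.path a b) →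
      dufloLE T S := by
  induction l using Nat.strong_induction_on with
  | _ l ih =>
    intro T hT hl hsub
    by_cases hne : T.path = S.path
    · rw [StdTableau.ext_path hT hS hne]
      exact Relation.ReflTransGen.refl
    · obtain ⟨m, x, ho, hm, hx⟩ :=
        (T.twoCol hT).1.isPath.exists_outer (S.twoCol hS).1.isPath hsub hne
      obtain ⟨P, hP, -, hTP, hlen, harc⟩ := StdTableau.exists_move hT ho hm
      exact Relation.ReflTransGen.trans hTP (ih _ (hl ▸ hlen) P hP rfl
        fun a b hab => (harc a b).2 ⟨hsub a b hab, hx a b hab⟩)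

theorem geometricLE_iff {T S : StdTableau n} (hT : T ∈ twoColumn n) (hS : S ∈ twoColumn n) :
    geometricLE T S ↔ borelClosure (arcPattern (n := n) S.path fun _ _ => False) ⊆
      borelClosure (arcPattern T.path fun _ _ => False) := by
  obtain ⟨H, hT⟩ := T.twoCol hT
  obtain ⟨H', hS⟩ := S.twoCol hS
  constructor
  · rintro ⟨w, hw, y, hy, hwy⟩
    rwa [H.closure_orbitalVariety hT hw, H'.closure_orbitalVariety hS hy] at hwy
  · intro h
    obtain ⟨w, hw, -⟩ := H.exists_mem_cell hT
    obtain ⟨y, hy, -⟩ := H'.exists_mem_cell hS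
    refine ⟨w, hw, y, hy, ?_⟩
    rwa [H.closure_orbitalVariety hT hw, H'.closure_orbitalVariety hS hy]

/-- On tableaux with two columns the three orders are the reverse inclusion of the sets of arcs. -/
theorem order_iff {le : StdTableau n → StdTableau n → Prop}
    (hle : le = dufloLE ∨ le = geometricLE ∨ le = chainLE) {T S : StdTableau n}
    (hT : T ∈ twoColumn n) (hS : S ∈ twoColumn n) :
    le T S ↔ ∀ a b, Arc S.path a b → Arc T.path a b := by
  have hT' := T.twoCol hT
  have hS' := S.twoCol hS
  have hduflo := dufloLE_of_arc_subset hS _ T hT rfl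
  have hgeom : dufloLE T S → geometricLE T S := by
    intro h
    have := h.borelClosure_subset
    rw [hT'.1.borelClosure_reading hT'.2, hS'.1.borelClosure_reading hS'.2] at this
    exact (geometricLE_iff hT hS).2 this
  have hcard : (∀ i j, 1 ≤ i → i < j → j ≤ n →
      (arcEnds S.path i j).card ≤ (arcEnds T.path i j).card) →
      ∀ a b, Arc S.path a b → Arc T.path a b :=
    fun h a b => arc_of_card_arcEnds_le hS'.1.isPath h (b - a) a b rfl
  have harc : geometricLE T S → ∀ a b, Arc S.path a b → Arc T.path a b := fun h =>
    hcard fun i j _ _ _ => card_arcEnds_le_of_borelClosure hS'.1 ((geometricLE_iff hT hS).1 h) i j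
  rcases hle with rfl | rfl | rfl
  · exact ⟨fun h => harc (hgeom h), hduflo⟩
  · exact ⟨harc, fun h => hgeom (hduflo h)⟩
  · rw [chainLE_iff hT'.1 hT'.2 hS'.1 hS'.2]
    exact ⟨hcard, fun h i j _ _ _ => card_arcEnds_mono h i j⟩

end YoungOrder

/-! ### Covers as removals of single outer arcs -/

theorem proposition3p16 {n : ℕ} (T : YoungOrder.StdTableau n) (hT : T ∈ YoungOrder.twoColumn n)
    (s : ℕ) (a k : Fin s → ℕ)
    (hruns : ∀ x : ℕ, x ∈ YoungOrder.col₂ T ↔ ∃ j : Fin s, a j ≤ x ∧ x ≤ a j + k j)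
    (hgap : ∀ i j : Fin s, (i : ℕ) + 1 = (j : ℕ) → a i + k i + 1 < a j)
    (le : YoungOrder.StdTableau n → YoungOrder.StdTableau n → Prop)
    (hle : le = YoungOrder.dufloLE ∨ le = YoungOrder.geometricLE ∨ le = YoungOrder.chainLE) :
    YoungOrder.StdTableau.cols '' YoungOrder.cover le (YoungOrder.twoColumn n) T =
      {S : List (List ℕ) | ∃ j : Fin s,
        YoungOrder.proj 1 (a j + k j) T = YoungOrder.brace T (a j + k j) ∧
          S = YoungOrder.moveToFirst T (a j + k j)} := by
  open YoungOrder in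
  have H := (T.twoCol hT).1
  have hcols := (T.twoCol hT).2
  ext E
  constructor
  · rintro ⟨S, ⟨hS, ⟨hTS, hne⟩, hmin⟩, rfl⟩
    have hsub := (order_iff hle hT hS).1 hTS
    obtain ⟨m, x, ho, hm, hx⟩ := H.isPath.exists_outer (S.twoCol hS).1.isPath hsub
      fun h => hne (StdTableau.ext_path hT hS h)
    -- Removing one outer arc that `S` lacks gives a tableau strictly above `T` and at most `S`; the
    -- covering property makes it equal to `S`.
    obtain ⟨P, hP, hPc, -, -, harc⟩ := StdTableau.exists_move hT ho hm
    have hTP : le T P := (order_iff hle hT hP).2 fun p q h => ((harc p q).1 h).1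
    have hPS : le P S := (order_iff hle hP hS).2 fun p q h => (harc p q).2 ⟨hsub p q h, hx p q h⟩
    have hTP' : T ≠ P := by
      rintro rfl
      exact ((harc m x).1 hm).2 rfl
    have hPS' : P = S := by
      by_contra h
      exact hmin ⟨P, hP, ⟨hTP, hTP'⟩, hPS, h⟩
    subst hPS'
    have hxD : x ∈ col₂ T := H.down_iff.1 ho.1
    obtain ⟨j, hj1, hj2⟩ := (hruns x).1 hxD
    have hxj : x = a j + k j := by
      -- If the run continued, the down step at `x + 1` would go below the height after `x`.
      by_contra hlt
      have h1 := H.down_iff.2 ((hruns (x + 1)).2 ⟨j, by omega, by omega⟩)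
      have h2 := ho.2 (x + 1 + 1) (by omega)
      exact h1.not_ge h2
    subst hxj
    exact ⟨j, (proj_eq_brace_iff H hcols hxD).2 ho, hPc⟩
  · rintro ⟨j, hj, rfl⟩
    have hxD : a j + k j ∈ col₂ T := (hruns _).2 ⟨j, by omega, le_rfl⟩
    have ho := (proj_eq_brace_iff H hcols hxD).1 hj
    obtain ⟨m, hm⟩ := H.exists_arc hxD
    obtain ⟨P, hP, hPc, -, -, harc⟩ := StdTableau.exists_move hT ho hm
    refine ⟨P, ⟨hP, ⟨(order_iff hle hT hP).2 fun p q h => ((harc p q).1 h).1, ?_⟩, ?_⟩, hPc⟩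
    · rintro rfl
      exact ((harc m _).1 hm).2 rfl
    · rintro ⟨Q, hQ, ⟨hTQ, hTQ'⟩, hQP, hQP'⟩
      have h1 := (order_iff hle hT hQ).1 hTQ
      have h2 := (order_iff hle hQ hP).1 hQP
      -- The arc sets of `T` and `P` differ in one arc, so `Q` between them equals `T` or `P`
      -- according to whether it has that arc.
      by_cases hmQ : Arc Q.path m (a j + k j)
      · refine hTQ' (StdTableau.eq_of_arc_iff hT hQ fun p q => ⟨fun h => ?_, h1 p q⟩)
        by_cases hq : q = a j + k j
        · subst hq
          exact h.left_unique hm ▸ hmQ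
        · exact h2 p q ((harc p q).2 ⟨h, hq⟩)
      · refine hQP' (StdTableau.eq_of_arc_iff hQ hP fun p q => ⟨fun h => ?_, h2 p q⟩)
        refine (harc p q).2 ⟨h1 p q h, ?_⟩
        rintro rfl
        exact hmQ ((h1 p _ h).left_unique hm ▸ h)
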